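/- Let $H$ be a finite-dimensional complex Hilbert space and $\mathcal N\subset\mathcal M\subset\mathcal B(H)$ unital $*$-subalgebras, with commutants $\mathcal M'\subset\mathcal N'$ in $\mathcal B(H)$. Write $\mathcal Z(\cdot)$ for the center, $\mathrm{Tr}_{\mathcal A}$ for the canonical trace of a finite-dimensional $*$-algebra $\mathcal A$ (equal to $1$ on each minimal projection), and, for states $\omega,\phi$ on $\mathcal A$ with density matrices $\rho^\omega,\rho^\phi\in\mathcal A$, let $S_{\mathcal A}(\omega|\phi)=\mathrm{Tr}_{\mathcal A}\big(\rho^\omega(\log\rho^\omega-\log\rho^\phi)\big)$, which is $+\infty$ if the support of $\rho^\omega$ is not contained in that of $\rho^\phi$. Let $C(\mathcal M,\mathcal N)$ be the set of conditional expectations $\varepsilon:\mathcal M\to\mathcal N$ (positive unital linear maps with $\varepsilon(n_1 m n_2)=n_1\varepsilon(m)n_2$ for $m\in\mathcal M$, $n_1,n_2\in\mathcal N$). Let $P_j$ and $Q_k$ be the minimal projections of $\mathcal Z(\mathcal M)$ and $\mathcal Z(\mathcal N)$. For $\varepsilon\in C(\mathcal M,\mathcal N)$ and each $k$ there is a state $\varphi_k$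 on $Q_k(\mathcal M\cap\mathcal N')Q_k$ with $\varepsilon(C)=\varphi_k(C)\,Q_k$. If $P_jQ_k\neq0$, then $P_jQ_k(\mathcal M\cap\mathcal N')\cong M_{\mu_{kj}}(\mathbb C)$; let $p_{kj}\rho_{kj}$, with $\rho_{kj}$ of trace one, be the density matrix of the restriction of $\varphi_k$ to this block, and let $t_{1,jk},\dots,t_{\mu_{kj},jk}$ be the eigenvalues of $\rho_{kj}$. Put $$\lambda_j(\varepsilon)=\sum_{k:\,P_jQ_k\ne0}\frac1{p_{kj}}\sum_{l=1}^{\mu_{kj}}\frac1{t_{l,jk}}\in(0,+\infty],\qquad \lambda(\varepsilon)=\max_j\lambda_j(\varepsilon),$$ where $\lambda_j(\varepsilon)=+\infty$ if some $p_{kj}$ or $t_{l,jk}$ occurring in the sum vanishes. The number $\lambda(\varepsilon)$ is the index of $\varepsilon$. Let $\{E_i\}$ be the minimal projections of $\mathcal Z(\mathcal M)\cap\mathcal Z(\mathcal N)$, $\mathcal M_i=E_i\mathcal ME_i$ and $\mathcal N_i=E_i\mathcal NE_i$. Every $\varepsilon\in C(\mathcal M,\mathcal N)$ restricts to conditional expectations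 $\varepsilon_i\in C(\mathcal M_i,\mathcal N_i)$, and $\varepsilon=\bigoplus_i\varepsilon_i$. Let $\hat C(\mathcal M,\mathcal N)$ be the set of those $\varepsilon\in C(\mathcal M,\mathcal N)$ such that, for every $i$, $\lambda(\varepsilon_i)<\infty$ and $\lambda_j(\varepsilon_i)=\lambda(\varepsilon_i)$ for all $j$ (with $j$ running over the minimal projections of $\mathcal Z(\mathcal M_i)$). The set $\hat C(\mathcal N',\mathcal M')$ is defined in the same way from the inclusion $\mathcal M'\subset\mathcal N'$. Then for every $\varepsilon\in\hat C(\mathcal M,\mathcal N)$ there is a unique $\varepsilon'\in\hat C(\mathcal N',\mathcal M')$ such that $$S_{\mathcal M}(\omega|\omega\circ\varepsilon)+S_{\mathcal N'}(\omega|\omega\circ\varepsilon')=\sum_i\omega(E_i)\log\lambda(\varepsilon_i)$$ for every pure state $\omega=\langle\psi,\,\cdot\,\psi\rangle$, $\|\psi\|=1$, of $\mathcal B(H)$. Moreover $\lambda(\varepsilon'_i)=\lambda(\varepsilon_i)$ for every $i$, where $\varepsilon'_i:E_i\mathcal N'E_i\to E_i\mathcal M'E_i$ is the restriction of $\varepsilon'$.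 -/

import Mathlib

open scoped ENNReal

noncomputable section

namespace EntropicCertainty

variable {H : Type*} [NormedAddCommGroup H] [InnerProductSpace ℂ H] [CompleteSpace H]

/-- *-subalgebras of `B(H)`, not necessarily containing the identity of `H` (so that corners
`E M E` are again of this kind; their unit is `E`). -/
abbrev OpAlg (H : Type*) [NormedAddCommGroup H] [InnerProductSpace ℂ H] [CompleteSpace H] :=
  NonUnitalStarSubalgebra ℂ (H →L[ℂ] H)

/-- Orthogonal projections in `B(H)`. -/
abbrev Proj (H : Type*) [NormedAddCommGroup H] [InnerProductSpace ℂ H] [CompleteSpace H] :=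
  {e : H →L[ℂ] H // IsStarProjection e}

/-- The commutant in `B(H)` of a *-subalgebra. -/
def commutant (A : OpAlg H) : OpAlg H :=
  NonUnitalStarSubalgebra.centralizer ℂ (A : Set (H →L[ℂ] H))

/-- The center `Z(A) = A ∩ A'`. -/
def center (A : OpAlg H) : OpAlg H := A ⊓ commutant A

/-- The common center `Z(M) ∩ Z(N)`. -/
def commonCenter (M N : OpAlg H) : OpAlg H := center M ⊓ center N

/-- The minimal (nonzero) projections of `Z`; here `q * p = q` says `q ≤ p`. -/
def minProj (Z : OpAlg H) : Set (Proj H) :=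
  {p | p.1 ∈ Z ∧ p.1 ≠ 0 ∧ ∀ q : Proj H, q.1 ∈ Z → q.1 * p.1 = q.1 → q.1 = 0 ∨ q = p}

/-- The corner algebra: the elements `x` of `A` with `e x = x = x e`. For a projection `e` that
lies in `A` or commutes with `A` and multiplies `A` into itself, this is `e A e`. -/
def corner (A : OpAlg H) (e : Proj H) : OpAlg H where
  carrier := {x | x ∈ A ∧ e.1 * x = x ∧ x * e.1 = x}
  zero_mem' := ⟨A.zero_mem, by simp, by simp⟩
  add_mem' := by
    rintro x y ⟨hx, hx1, hx2⟩ ⟨hy, hy1, hy2⟩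
    exact ⟨A.add_mem hx hy, by rw [mul_add, hx1, hy1], by rw [add_mul, hx2, hy2]⟩
  mul_mem' := by
    rintro x y ⟨hx, hx1, hx2⟩ ⟨hy, hy1, hy2⟩
    exact ⟨A.mul_mem hx hy, by rw [← mul_assoc, hx1], by rw [mul_assoc, hy2]⟩
  smul_mem' := by
    rintro c x ⟨hx, hx1, hx2⟩
    exact ⟨A.smul_mem c hx, by rw [mul_smul_comm, hx1], by rw [smul_mul_assoc, hx2]⟩
  star_mem' := by
    rintro x ⟨hx, hx1, hx2⟩
    have he : star e.1 = e.1 := e.2.isSelfAdjoint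
    refine ⟨star_mem hx, ?_, ?_⟩
    · have h := congrArg star hx2
      rwa [star_mul, he] at h
    · have h := congrArg star hx1
      rwa [star_mul, he] at h

/-- The trace of `B(H)`. -/
def tr (T : H →L[ℂ] H) : ℂ := LinearMap.trace ℂ H (T : H →ₗ[ℂ] H)

/-- The canonical trace of a finite-dimensional *-algebra `A ⊆ B(H)`, the one that is `1` on every
minimal projection of `A`. If `P` is a minimal central projection, then `P A` is
`M_m(ℂ) ⊗ 1_{m'}` on `P H`, so `dim (P A) = m²`, `tr P = m m'`, and the canonical trace on this
summand is `tr / m' = (m / tr P) tr`. -/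
def canTrace (A : OpAlg H) (a : H →L[ℂ] H) : ℂ :=
  ∑ᶠ P ∈ minProj (center A),
    ((Real.sqrt (Module.finrank ℂ (corner A P)) : ℝ) : ℂ) / tr P.1 * tr (P.1 * a)

open Classical in
/-- The density matrix in `A` of a linear functional on `A`: the (unique) `ρ ∈ A` such that
`Tr_A (ρ a) = ω a` for all `a ∈ A`. -/
def density (A : OpAlg H) (ω : A →ₗ[ℂ] ℂ) : H →L[ℂ] H :=
  if h : ∃ ρ : H →L[ℂ] H, ρ ∈ A ∧ ∀ a : A, canTrace A (ρ * a) = ω a then h.choose else 0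

open Classical in
/-- The relative entropy `S_A(ω | φ) = Tr_A (ρ^ω (log ρ^ω - log ρ^φ))`, which is `+∞` when the
support of `ρ^ω` is not contained in that of `ρ^φ`. On the kernel of a density matrix its logarithm
is taken to be `0` (the convention `0 log 0 = 0`). -/
def relEntropy (A : OpAlg H) (ω φ : A →ₗ[ℂ] ℂ) : EReal :=
  if LinearMap.ker (density A φ : H →ₗ[ℂ] H) ≤ LinearMap.ker (density A ω : H →ₗ[ℂ] H) then
    (((canTrace A (density A ω * (CFC.log (density A ω) - CFC.log (density A φ)))).re : ℝ) : EReal)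
  else ⊤

/-- A conditional expectation `M → N`: a linear map that is positive, unital (it fixes the unit of
`M`) and an `N`-bimodule map. -/
@[ext]
structure CondExp (M N : OpAlg H) where
  toLin : M →ₗ[ℂ] N
  pos : ∀ a : M, (a : H →L[ℂ] H).IsPositive → (toLin a : H →L[ℂ] H).IsPositive
  unital : ∀ u : M, (∀ a : M, u * a = a ∧ a * u = a) → (toLin u : H →L[ℂ] H) = u
  bimodule : ∀ (a b : M) (n₁ n₂ : N), (b : H →L[ℂ] H) = n₁ * a * n₂ →
    (toLin b : H →L[ℂ] H) = n₁ * toLin a * n₂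

section Index

variable {M N : OpAlg H}

/-- For minimal projections `Pk` of `Z(N)` and `Pj` of `Z(M)`: the summand number `j`, a full
matrix algebra, of the relative commutant `M_k ∩ N'`, where `M_k = Pk M Pk`. -/
def block (M N : OpAlg H) (Pk Pj : Proj H) : OpAlg H :=
  corner (corner (M ⊓ commutant N) Pk) Pj

/-- The restriction to the block `(k, j)` of the state `φ_k` on `M_k ∩ N'` that is given by
`ε(C) = φ_k(C) Pk`. -/
def blockState (ε : CondExp M N) (Pk Pj : Proj H) : block M N Pk Pj →ₗ[ℂ] ℂ where
  toFun c := tr (ε.toLin ⟨c.1, c.2.1.1.1⟩ : H →L[ℂ] H) / tr Pk.1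
  map_add' x y := by
    have h : ε.toLin ⟨(x + y).1, (x + y).2.1.1.1⟩ =
        ε.toLin ⟨x.1, x.2.1.1.1⟩ + ε.toLin ⟨y.1, y.2.1.1.1⟩ := by
      rw [← map_add]; rfl
    rw [h]
    simp [tr, add_div]
  map_smul' c x := by
    have h : ε.toLin ⟨(c • x).1, (c • x).2.1.1.1⟩ = c • ε.toLin ⟨x.1, x.2.1.1.1⟩ := by
      rw [← map_smul]; rfl
    rw [h]
    simp [tr, mul_div_assoc]

/-- The component `p_{kj} ρ_{kj}` in the block `(k, j)` of the density matrix of `φ_k`. -/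
def blockDensity (ε : CondExp M N) (Pk Pj : Proj H) : H →L[ℂ] H :=
  density (block M N Pk Pj) (blockState ε Pk Pj)

/-- The weight `p_{kj}`. -/
def blockWeight (ε : CondExp M N) (Pk Pj : Proj H) : ℝ :=
  (canTrace (block M N Pk Pj) (blockDensity ε Pk Pj)).re

/-- The normalized density matrix `ρ_{kj}`. -/
def blockRho (ε : CondExp M N) (Pk Pj : Proj H) : H →L[ℂ] H :=
  ((blockWeight ε Pk Pj : ℂ))⁻¹ • blockDensity ε Pk Pj

open Classical in
/-- The index of the block `(k, j)`: the sum `∑ 1 / t` over the eigenvalues `t` of `ρ_{kj}` in the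
matrix algebra `block M N Pk Pj` (with multiplicity), i.e. the canonical trace of the inverse of
`ρ_{kj}` in this algebra, and `+∞` if `ρ_{kj}` is not invertible. -/
def blockIndex (ε : CondExp M N) (Pk Pj : Proj H) : ℝ≥0∞ :=
  if h : ∃ x : H →L[ℂ] H, x ∈ block M N Pk Pj ∧
      blockRho ε Pk Pj * x = Pk.1 * Pj.1 ∧ x * blockRho ε Pk Pj = Pk.1 * Pj.1 then
    ENNReal.ofReal (canTrace (block M N Pk Pj) h.choose).re
  else ⊤

/-- `λ_j(ε) = ∑_k λ_{jk}(ε) / p_{kj}`, the sum over the `k` for which the block is not zero. -/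
def indexAt (ε : CondExp M N) (Pj : Proj H) : ℝ≥0∞ :=
  ∑ᶠ Pk ∈ {Pk ∈ minProj (center N) | Pk.1 * Pj.1 ≠ 0},
    (ENNReal.ofReal (blockWeight ε Pk Pj))⁻¹ * blockIndex ε Pk Pj

/-- The algebraic index `λ(ε) = max_j λ_j(ε)`. -/
def index (ε : CondExp M N) : ℝ≥0∞ := ⨆ Pj ∈ minProj (center M), indexAt ε Pj

/-- `ε` has finite and scalar index: `λ_j(ε) < ∞` does not depend on `j`. For a connected inclusion
this is membership in the space `Ĉ(M, N)`. -/
def HasScalarIndex (ε : CondExp M N) : Prop :=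
  index ε < ⊤ ∧ ∀ Pj ∈ minProj (center M), indexAt ε Pj = index ε

end Index

/-- The conditional expectation `ε_E : E M E → E N E`, the restriction of `ε`, for a
projection `E` of the common center. -/
def CondExp.part {M N : StarSubalgebra ℂ (H →L[ℂ] H)}
    (ε : CondExp M.toNonUnitalStarSubalgebra N.toNonUnitalStarSubalgebra) (E : Proj H)
    (hE : E.1 ∈ commonCenter M.toNonUnitalStarSubalgebra N.toNonUnitalStarSubalgebra) :
    CondExp (corner M.toNonUnitalStarSubalgebra E) (corner N.toNonUnitalStarSubalgebra E) where
  toLin :=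
    { toFun := fun x => ⟨ε.toLin ⟨x.1, x.2.1⟩, (ε.toLin ⟨x.1, x.2.1⟩).2, by
        have h := ε.bimodule ⟨x.1, x.2.1⟩ ⟨x.1, x.2.1⟩ ⟨E.1, hE.2.1⟩ ⟨E.1, hE.2.1⟩
          (by simp only [x.2.2.1, x.2.2.2])
        have e2 : E.1 * E.1 = E.1 := E.2.isIdempotentElem
        constructor
        · rw [h]; simp only [← mul_assoc, e2]
        · rw [h]; simp only [mul_assoc, e2]⟩
      map_add' := fun x y => by
        apply Subtype.ext
        change (ε.toLin (⟨x.1, x.2.1⟩ + ⟨y.1, y.2.1⟩) : H →L[ℂ] H) = _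
        rw [map_add]; rfl
      map_smul' := fun c x => by
        apply Subtype.ext
        change (ε.toLin (c • ⟨x.1, x.2.1⟩) : H →L[ℂ] H) = _
        rw [map_smul]; rfl }
  pos := fun a ha => ε.pos ⟨a.1, a.2.1⟩ ha
  unital := fun u hu => by
    have e2 : E.1 * E.1 = E.1 := E.2.isIdempotentElem
    have huE : u.1 = E.1 := by
      have h := congrArg Subtype.val (hu ⟨E.1, hE.1.1, e2, e2⟩).1
      change u.1 * E.1 = E.1 at h
      rw [← h]; exact u.2.2.2.symm
    have h1 := ε.unital ⟨1, M.one_mem⟩ fun a => ⟨Subtype.ext (one_mul _), Subtype.ext (mul_one _)⟩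
    have h := ε.bimodule ⟨1, M.one_mem⟩ ⟨u.1, u.2.1⟩ ⟨E.1, hE.2.1⟩ ⟨E.1, hE.2.1⟩
      (by simp only [huE, mul_one, e2])
    change (ε.toLin ⟨u.1, u.2.1⟩ : H →L[ℂ] H) = u.1
    rw [h, h1]
    simp only [huE, mul_one, e2]
  bimodule := fun a b n₁ n₂ h =>
    ε.bimodule ⟨a.1, a.2.1⟩ ⟨b.1, b.2.1⟩ ⟨n₁.1, n₁.2.1⟩ ⟨n₂.1, n₂.2.1⟩ h

/-- The space `Ĉ(M, N)` of a general inclusion: the conditional expectations `ε = ⊕ ε_i` whose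
summands, along the minimal projections `E_i` of `Z(M) ∩ Z(N)`, have finite scalar index. -/
def hatC (M N : StarSubalgebra ℂ (H →L[ℂ] H)) :
    Set (CondExp M.toNonUnitalStarSubalgebra N.toNonUnitalStarSubalgebra) :=
  {ε | ∀ (E : Proj H) (hE : E ∈ minProj
    (commonCenter M.toNonUnitalStarSubalgebra N.toNonUnitalStarSubalgebra)),
    HasScalarIndex (ε.part E hE.1)}

/-- The commutant of a unital *-subalgebra. -/
abbrev starCommutant (M : StarSubalgebra ℂ (H →L[ℂ] H)) : StarSubalgebra ℂ (H →L[ℂ] H) :=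
  StarSubalgebra.centralizer ℂ (M : Set (H →L[ℂ] H))

theorem commonCenter_dual {M N : StarSubalgebra ℂ (H →L[ℂ] H)} {x : H →L[ℂ] H}
    (hx : x ∈ commonCenter M.toNonUnitalStarSubalgebra N.toNonUnitalStarSubalgebra) :
    x ∈ commonCenter (starCommutant N).toNonUnitalStarSubalgebra (starCommutant M).toNonUnitalStarSubalgebra := by
  have key : ∀ A : StarSubalgebra ℂ (H →L[ℂ] H), x ∈ center A.toNonUnitalStarSubalgebra →
      x ∈ center (starCommutant A).toNonUnitalStarSubalgebra := by
    intro A hA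
    refine ⟨StarSubalgebra.mem_centralizer_iff ℂ |>.2 fun g hg =>
      NonUnitalStarSubalgebra.mem_centralizer_iff ℂ |>.1 hA.2 g hg, ?_⟩
    refine (NonUnitalStarSubalgebra.mem_centralizer_iff ℂ).2 fun g hg => ?_
    have hg' := (StarSubalgebra.mem_centralizer_iff ℂ).1 hg
    have hs := (StarSubalgebra.mem_centralizer_iff ℂ).1 (star_mem hg : star g ∈ starCommutant A)
    exact ⟨((hg' x hA.1).1).symm, ((hs x hA.1).1).symm⟩
  exact ⟨key N hx.2, key M hx.1⟩

/-- The restriction of a functional on `B(H)` to a subalgebra. -/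
def restrict (A : OpAlg H) (ω : (H →L[ℂ] H) →ₗ[ℂ] ℂ) : A →ₗ[ℂ] ℂ where
  toFun a := ω a
  map_add' _ _ := map_add ω _ _
  map_smul' c a := map_smul ω c a.1

/-- The pure states of `B(H)`, `H` finite-dimensional: the functionals `⟨ψ, · ψ⟩`, `‖ψ‖ = 1`. -/
def IsPureState (ω : (H →L[ℂ] H) →ₗ[ℂ] ℂ) : Prop :=
  ∃ ψ : H, ‖ψ‖ = 1 ∧ ∀ A : H →L[ℂ] H, ω A = inner ℂ ψ (A ψ)

/-- The entropic certainty relation for `ε : M → N` and `ε' : N' → M'`: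
`S_M(ω | ω ∘ ε) + S_{N'}(ω | ω ∘ ε') = ∑_i ω(E_i) log λ(ε_i)` for all pure states `ω`. -/
def CertaintyRelation {M N : StarSubalgebra ℂ (H →L[ℂ] H)}
    (ε : CondExp M.toNonUnitalStarSubalgebra N.toNonUnitalStarSubalgebra)
    (ε' : CondExp (starCommutant N).toNonUnitalStarSubalgebra (starCommutant M).toNonUnitalStarSubalgebra) : Prop :=
  ∀ ω : (H →L[ℂ] H) →ₗ[ℂ] ℂ, IsPureState ω →
    relEntropy _ (restrict _ ω) (restrict _ ω ∘ₗ ε.toLin) +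
      relEntropy _ (restrict _ ω) (restrict _ ω ∘ₗ ε'.toLin) =
    ((∑ᶠ E : minProj (commonCenter M.toNonUnitalStarSubalgebra N.toNonUnitalStarSubalgebra),
      (ω E.1.1).re * Real.log (index (ε.part E.1 E.2.1)).toReal : ℝ) : EReal)

end EntropicCertainty

end

noncomputable section

namespace EntropicCertainty

open scoped ComplexOrder

set_option linter.unusedSectionVars false

variable {H : Type*} [NormedAddCommGroup H] [InnerProductSpace ℂ H] [CompleteSpace H]

/-! Everything is carried by the density `h` of `Tr_N ∘ ε` with respect to `Tr_M`
(`CondExp.rnDensity`). The bimodule property puts `h` in `M ∩ N'`, and `h` determines `ε`. If `ρ_A`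
is the density of `ω` on `A`, then `ω ∘ ε` has density `h ρ_N` on `M`. These factors commute, so the
logarithm splits, and for invertible `h` one gets `S_M(ω | ω ∘ ε) = ω(log ρ_M) - ω(log h) - ω(log
ρ_N)`.

For a vector state, `ρ_A ψ = ρ_{A'} ψ` (`density_apply_eq_commutant`). The two densities commute,
hence also `log ρ_A ψ = log ρ_{A'} ψ`. In the sum with the entropy of the dual inclusion all
densities of `ω` cancel, and `-ω(log h + log h')` remains (`relEntropy_add_relEntropy`).

The certainty relation therefore says `h' = h⁻¹ ∑ λ_i⁻¹ E_i`, which gives uniqueness. For existence,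
this `h'` is positive and lies in `N' ∩ M''`; what is left is the normalization `Tr_{N'}(h' b) =
Tr_{M'}(b)` for `b ∈ M'`. Since `h⁻¹ ∈ M`, the functional `Tr_{N'}(h⁻¹ ·)` is tracial on `M'`, so on
each `P_j` it is a multiple of `Tr_{M'}`. The multiple is exactly `λ_j(ε)` (`CondExp.indexAt_part`),
and scalar index makes it constant under each `E_i`. The same index formula applied to `h'` yields
`λ(ε'_i) = λ(ε_i)`.

The index formula needs the canonical trace of the blocks `P_j Q_k (M ∩ N')`, which comes from a
dimension count (`finrank_block`) and the triviality of their centers. The structure theory is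
obtained without decomposing `H`, from averages `∑ a_i X a_i*` over a Hilbert–Schmidt orthonormal
basis of an algebra (`IsFrame`) and from comparing traces of such maps. -/

theorem op_mul_apply (x y : H →L[ℂ] H) (v : H) : (x * y) v = x (y v) := rfl

/-! ### The trace of `B(H)`: positivity and faithfulness. -/

section Trace

theorem tr_zero : tr (0 : H →L[ℂ] H) = 0 := by simp [tr]

theorem tr_add (x y : H →L[ℂ] H) : tr (x + y) = tr x + tr y := by simp [tr]

theorem tr_sub (x y : H →L[ℂ] H) : tr (x - y) = tr x - tr y := by simp [tr]

theorem tr_smul (c : ℂ) (x : H →L[ℂ] H) : tr (c • x) = c * tr x := by simp [tr]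

/-- The trace as a linear functional. -/
def trLin : (H →L[ℂ] H) →ₗ[ℂ] ℂ where
  toFun := tr
  map_add' := tr_add
  map_smul' := tr_smul

theorem tr_sum {ι : Type*} (s : Finset ι) (x : ι → H →L[ℂ] H) :
    tr (∑ i ∈ s, x i) = ∑ i ∈ s, tr (x i) := map_sum (trLin (H := H)) x s

theorem tr_mul_comm (x y : H →L[ℂ] H) : tr (x * y) = tr (y * x) :=
  LinearMap.trace_mul_comm ℂ (x : H →ₗ[ℂ] H) (y : H →ₗ[ℂ] H)

variable [FiniteDimensional ℂ H]

theorem tr_eq_sum_inner (x : H →L[ℂ] H) :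
    tr x = ∑ i, inner ℂ (stdOrthonormalBasis ℂ H i) (x (stdOrthonormalBasis ℂ H i)) :=
  LinearMap.trace_eq_sum_inner _ (stdOrthonormalBasis ℂ H)

theorem tr_star (x : H →L[ℂ] H) : tr (star x) = star (tr x) := by
  rw [tr_eq_sum_inner, tr_eq_sum_inner, star_sum]
  refine Finset.sum_congr rfl fun i _ => ?_
  rw [ContinuousLinearMap.star_eq_adjoint, ContinuousLinearMap.adjoint_inner_right]
  exact (inner_conj_symm _ _).symm

theorem tr_rankOne (u v : H) : tr (InnerProductSpace.rankOne ℂ u v) = inner ℂ v u := by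
  rw [tr_eq_sum_inner]
  simp only [InnerProductSpace.rankOne_apply, inner_smul_right]
  rw [← (stdOrthonormalBasis ℂ H).sum_inner_mul_inner v u]

theorem tr_star_mul_self (x : H →L[ℂ] H) :
    tr (star x * x) = ((∑ i, ‖x (stdOrthonormalBasis ℂ H i)‖ ^ 2 : ℝ) : ℂ) := by
  rw [tr_eq_sum_inner, Complex.ofReal_sum]
  refine Finset.sum_congr rfl fun i _ => ?_
  rw [op_mul_apply, ContinuousLinearMap.star_eq_adjoint,
    ContinuousLinearMap.adjoint_inner_right, inner_self_eq_norm_sq_to_K,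
    Complex.ofReal_pow]
  rfl

theorem tr_star_mul_self_nonneg (x : H →L[ℂ] H) : 0 ≤ tr (star x * x) := by
  rw [tr_star_mul_self]
  exact Complex.zero_le_real.2 (Finset.sum_nonneg fun i _ => sq_nonneg _)

theorem eq_zero_of_tr_star_mul_self {x : H →L[ℂ] H} (h : tr (star x * x) = 0) : x = 0 := by
  rw [tr_star_mul_self] at h
  have h' := (Finset.sum_eq_zero_iff_of_nonneg fun i _ => sq_nonneg _).1 (Complex.ofReal_eq_zero.1 h)
  have : (x : H →ₗ[ℂ] H) = 0 := by
    refine (stdOrthonormalBasis ℂ H).toBasis.ext fun i => ?_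
    simpa using h' i (Finset.mem_univ i)
  exact ContinuousLinearMap.coe_injective this

theorem exists_sqrt {p : H →L[ℂ] H} (hp : 0 ≤ p) :
    ∃ r : H →L[ℂ] H, star r = r ∧ r * r = p :=
  ⟨CFC.sqrt p, (CFC.sqrt_nonneg p).isSelfAdjoint, CFC.sqrt_mul_sqrt_self p⟩

theorem tr_nonneg {p : H →L[ℂ] H} (hp : 0 ≤ p) : 0 ≤ tr p := by
  obtain ⟨r, hr, rfl⟩ := exists_sqrt hp
  nth_rewrite 1 [← hr]
  exact tr_star_mul_self_nonneg r

theorem tr_mul_nonneg {p y : H →L[ℂ] H} (hp : 0 ≤ p) (hy : 0 ≤ y) : 0 ≤ tr (p * y) := by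
  obtain ⟨r, hr, rfl⟩ := exists_sqrt hp
  obtain ⟨s, hs, rfl⟩ := exists_sqrt hy
  have : tr (r * r * (s * s)) = tr (star (r * s) * (r * s)) := by
    rw [star_mul, hr, hs, ← mul_assoc, tr_mul_comm]
    simp only [mul_assoc]
  rw [this]
  exact tr_star_mul_self_nonneg _

theorem eq_zero_of_tr_eq_zero {p : H →L[ℂ] H} (hp : 0 ≤ p) (h : tr p = 0) : p = 0 := by
  obtain ⟨r, hr, rfl⟩ := exists_sqrt hp
  rw [eq_zero_of_tr_star_mul_self (x := r) (by rwa [hr]), mul_zero]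

theorem conj_nonneg' {x p : H →L[ℂ] H} (hp : 0 ≤ p) : 0 ≤ x * p * star x :=
  star_right_conjugate_nonneg hp x

theorem mul_eq_one_symm {x y : H →L[ℂ] H} (h : x * y = 1) : y * x = 1 := by
  have h1 : (x : H →ₗ[ℂ] H) * (y : H →ₗ[ℂ] H) = 1 :=
    congrArg (fun z : H →L[ℂ] H => (z : H →ₗ[ℂ] H)) h
  exact ContinuousLinearMap.coe_injective (mul_eq_one_comm.1 h1)

/-- For positive `p`, if `tr (p x* x) = 0` and `p` is invertible then `x = 0`. -/
theorem eq_zero_of_tr_mul_star_mul_self {p q x : H →L[ℂ] H} (hp : 0 ≤ p) (hqp : q * p = 1)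
    (h : tr (p * (star x * x)) = 0) : x = 0 := by
  obtain ⟨r, hr, rfl⟩ := exists_sqrt hp
  have h1 : tr (star (x * r) * (x * r)) = 0 := by
    rw [star_mul, hr, ← mul_assoc, tr_mul_comm, ← h]
    simp only [mul_assoc]
  have h2 := eq_zero_of_tr_star_mul_self h1
  have hrr : (q * r) * r = 1 := by rw [mul_assoc, hqp]
  have hrl : r * (q * r) = 1 := mul_eq_one_symm hrr
  calc x = x * (r * (q * r)) := by rw [hrl, mul_one]
    _ = 0 := by rw [← mul_assoc, h2, zero_mul]

end Trace

/-! ### Functional calculus in finite dimension, tested on eigenvectors. -/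

section FunctionalCalculus

variable [FiniteDimensional ℂ H]

/-- Finiteness allows any real function on the spectrum to be replaced by an interpolating
polynomial, with no continuity condition. -/
theorem finite_spectrum_real (a : H →L[ℂ] H) : (spectrum ℝ a).Finite := by
  have h : (spectrum ℂ a).Finite := by
    have h1 := Module.End.finite_spectrum (K := ℂ) (a : H →ₗ[ℂ] H)
    refine h1.subset fun z hz => ?_
    rw [spectrum.mem_iff] at hz ⊢
    contrapose! hz
    obtain ⟨u, hu⟩ := hz
    refine (isUnit_iff_exists).2 ⟨LinearMap.toContinuousLinearMap (u⁻¹ : (H →ₗ[ℂ] H)ˣ).1, ?_, ?_⟩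
    · refine ContinuousLinearMap.coe_injective ?_
      have := u.mul_inv
      rw [hu] at this
      exact this
    · refine ContinuousLinearMap.coe_injective ?_
      have := u.inv_mul
      rw [hu] at this
      exact this
  have h2 : spectrum ℝ a = algebraMap ℝ ℂ ⁻¹' spectrum ℂ a := by
    ext z; exact spectrum.algebraMap_mem_iff ℂ |>.symm
  rw [h2]
  exact h.preimage (FaithfulSMul.algebraMap_injective ℝ ℂ).injOn

open Polynomial in
theorem exists_polynomial_interpolating (f : ℝ → ℝ) {S : Set ℝ} (hS : S.Finite) :
    ∃ p : ℝ[X], ∀ x ∈ S, p.eval x = f x := by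
  classical
  refine ⟨Lagrange.interpolate hS.toFinset id f, fun x hx => ?_⟩
  exact Lagrange.eval_interpolate_at_node (v := id) f (Set.injOn_id _) (hS.mem_toFinset.2 hx)

open Polynomial in
theorem cfc_eq_aeval {a : H →L[ℂ] H} (ha : IsSelfAdjoint a) {f : ℝ → ℝ} {p : ℝ[X]}
    (hp : ∀ x ∈ spectrum ℝ a, p.eval x = f x) : cfc f a = aeval a p := by
  rw [← cfc_polynomial p a ha]
  exact cfc_congr fun x hx => (hp x hx).symm

-- Induction on powers: `a (b ^ n ψ) = b ^ n (a ψ) = b ^ n (b ψ)`.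
open Polynomial in
theorem aeval_apply_eq_of_commute {a b : H →L[ℂ] H} (hab : Commute a b) {ψ : H} (h : a ψ = b ψ)
    (p : ℝ[X]) : aeval a p ψ = aeval b p ψ := by
  have hpow : ∀ n : ℕ, (a ^ n) ψ = (b ^ n) ψ := by
    intro n
    induction n with
    | zero => simp
    | succ n ih =>
      rw [pow_succ', op_mul_apply, ih, ← op_mul_apply,
        (hab.pow_right n).eq, op_mul_apply, h, pow_succ]
      rfl
  induction p using Polynomial.induction_on' with
  | add p q hp hq => simp [hp, hq]
  | monomial n c => simp [aeval_monomial, hpow, Algebra.algebraMap_eq_smul_one]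

/-- One polynomial interpolates `f` on both spectra. With `f = log` this carries the agreement on
`ψ` of the densities for `A` and `A'` over to their logarithms. -/
theorem cfc_apply_eq_of_commute {a b : H →L[ℂ] H} (ha : IsSelfAdjoint a) (hb : IsSelfAdjoint b)
    (hab : Commute a b) {ψ : H} (h : a ψ = b ψ) (f : ℝ → ℝ) : cfc f a ψ = cfc f b ψ := by
  obtain ⟨p, hp⟩ := exists_polynomial_interpolating f
    ((finite_spectrum_real a).union (finite_spectrum_real b))
  rw [cfc_eq_aeval ha fun x hx => hp x (Or.inl hx), cfc_eq_aeval hb fun x hx => hp x (Or.inr hx)]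
  exact aeval_apply_eq_of_commute hab h p

/-- The scalar operator `c` commutes with `a` and agrees with it on `v`, so the previous lemma
applies. -/
theorem cfc_apply_of_eigenvector {a : H →L[ℂ] H} (ha : IsSelfAdjoint a) {c : ℝ} {v : H}
    (h : a v = (c : ℂ) • v) (f : ℝ → ℝ) : cfc f a v = (f c : ℂ) • v := by
  have hb : IsSelfAdjoint (algebraMap ℝ (H →L[ℂ] H) c) := .algebraMap _ rfl
  have hv : ∀ d : ℝ, algebraMap ℝ (H →L[ℂ] H) d v = (d : ℂ) • v := fun d => by
    rw [Algebra.algebraMap_eq_smul_one, Complex.coe_smul]; rfl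
  rw [cfc_apply_eq_of_commute ha hb (Algebra.commutes c a).symm (by rw [h, hv]) f,
    cfc_algebraMap, hv]

/-- *-subalgebras containing the identity are closed under the functional calculus. -/
theorem cfc_mem {A : OpAlg H} (h1 : (1 : H →L[ℂ] H) ∈ A) {a : H →L[ℂ] H} (ha : IsSelfAdjoint a)
    (haA : a ∈ A) (f : ℝ → ℝ) : cfc f a ∈ A := by
  obtain ⟨p, hp⟩ := exists_polynomial_interpolating f (finite_spectrum_real a)
  rw [cfc_eq_aeval ha hp]
  have hpow : ∀ n : ℕ, a ^ n ∈ A := by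
    intro n
    induction n with
    | zero => simpa using h1
    | succ n ih => rw [pow_succ]; exact A.mul_mem ih haA
  induction p using Polynomial.induction_on' generalizing f with
  | add p q hp' hq' =>
    rw [map_add]
    exact A.add_mem (hp' (fun x => p.eval x) fun _ _ => rfl) (hq' (fun x => q.eval x) fun _ _ => rfl)
  | monomial n c =>
    rw [Polynomial.aeval_monomial, Algebra.algebraMap_eq_smul_one, smul_mul_assoc, one_mul]
    have : (c • a ^ n : H →L[ℂ] H) = (c : ℂ) • a ^ n := by ext v; simp
    rw [this]
    exact A.smul_mem _ (hpow n)

/-- Two operators that agree on the joint eigenvectors of a commuting pair of self-adjoint operators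
are equal. -/
theorem ext_joint_eigenvectors {a b x y : H →L[ℂ] H} (ha : IsSelfAdjoint a) (hb : IsSelfAdjoint b)
    (hab : Commute a b)
    (h : ∀ (α β : ℝ) (v : H), a v = (α : ℂ) • v → b v = (β : ℂ) • v → x v = y v) : x = y := by
  have hsa : (a : H →ₗ[ℂ] H).IsSymmetric := ContinuousLinearMap.isSelfAdjoint_iff_isSymmetric.1 ha
  have hsb : (b : H →ₗ[ℂ] H).IsSymmetric := ContinuousLinearMap.isSelfAdjoint_iff_isSymmetric.1 hb
  have hab' : Commute (a : H →ₗ[ℂ] H) (b : H →ₗ[ℂ] H) :=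
    congrArg (fun z : H →L[ℂ] H => (z : H →ₗ[ℂ] H)) hab.eq
  have htop := LinearMap.IsSymmetric.iSup_iSup_eigenspace_inf_eigenspace_eq_top_of_commute
    hsa hsb hab'
  have hle : (⊤ : Submodule ℂ H) ≤ LinearMap.ker ((x - y : H →L[ℂ] H) : H →ₗ[ℂ] H) := by
    rw [← htop]
    refine iSup_le fun α => iSup_le fun β => fun v hv => ?_
    by_cases hv0 : v = 0
    · simp [hv0]
    have hva := Module.End.mem_eigenspace_iff.1 hv.1
    have hvb := Module.End.mem_eigenspace_iff.1 hv.2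
    have hα := hsa.conj_eigenvalue_eq_self (Module.End.hasEigenvalue_of_hasEigenvector ⟨hv.1, hv0⟩)
    have hβ := hsb.conj_eigenvalue_eq_self (Module.End.hasEigenvalue_of_hasEigenvector ⟨hv.2, hv0⟩)
    rw [Complex.conj_eq_iff_re] at hα hβ
    have := h α.re β.re v (by rw [hα]; exact hva) (by rw [hβ]; exact hvb)
    simpa [sub_eq_zero] using this
  ext v
  have := hle (Submodule.mem_top (x := v))
  simpa [sub_eq_zero] using this

theorem ext_eigenvectors {a x y : H →L[ℂ] H} (ha : IsSelfAdjoint a)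
    (h : ∀ (α : ℝ) (v : H), a v = (α : ℂ) • v → x v = y v) : x = y :=
  ext_joint_eigenvectors ha ha (Commute.refl a) fun α _ v h1 _ => h α v h1

theorem nonneg_eigenvalue {a : H →L[ℂ] H} (ha : 0 ≤ a) {c : ℝ} {v : H} (hv : v ≠ 0)
    (h : a v = (c : ℂ) • v) : 0 ≤ c := by
  have h1 := (ContinuousLinearMap.nonneg_iff_isPositive a).1 ha
  have h2 := h1.re_inner_nonneg_right v
  rw [h, inner_smul_right, inner_self_eq_norm_sq_to_K] at h2
  have h3 : (0:ℝ) ≤ c * ‖v‖ ^ 2 := by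
    have : ((c : ℂ) * ((‖v‖ : ℝ) : ℂ) ^ 2) = ((c * ‖v‖ ^ 2 : ℝ) : ℂ) := by push_cast; rfl
    exact (this ▸ h2 : 0 ≤ RCLike.re ((c * ‖v‖ ^ 2 : ℝ) : ℂ))
  have : 0 < ‖v‖ ^ 2 := by positivity
  exact nonneg_of_mul_nonneg_left h3 this

/-- The support projection of a self-adjoint operator. -/
def supp (a : H →L[ℂ] H) : H →L[ℂ] H := cfc (fun x : ℝ => if x = 0 then 0 else 1) a

theorem supp_apply {a : H →L[ℂ] H} (ha : IsSelfAdjoint a) {v : H} (h : a v = 0) : supp a v = 0 := by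
  have := cfc_apply_of_eigenvector ha (c := 0) (v := v) (by simpa using h)
    (fun x : ℝ => if x = 0 then 0 else 1)
  simpa [supp] using this

theorem isSelfAdjoint_supp (a : H →L[ℂ] H) : IsSelfAdjoint (supp a) := cfc_predicate _ a

theorem supp_mul_supp {a : H →L[ℂ] H} (ha : IsSelfAdjoint a) : supp a * supp a = supp a := by
  refine ext_eigenvectors ha fun α v h => ?_
  have := cfc_apply_of_eigenvector ha h (fun x : ℝ => if x = 0 then 0 else 1)
  rw [op_mul_apply, supp, this, map_smul, this, smul_smul]
  split_ifs <;> simp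

theorem mul_supp {a : H →L[ℂ] H} (ha : IsSelfAdjoint a) : a * supp a = a := by
  refine ext_eigenvectors ha fun α v h => ?_
  have := cfc_apply_of_eigenvector ha h (fun x : ℝ => if x = 0 then 0 else 1)
  rw [op_mul_apply, supp, this, map_smul, h, smul_smul]
  split_ifs with h0 <;> simp [h0]

/-- The logarithm of a product of commuting positive operators, the first one injective. -/
theorem log_mul_of_commute {a b : H →L[ℂ] H} (ha : 0 ≤ a) (hb : 0 ≤ b) (hab : Commute a b)
    (hinj : ∀ v, a v = 0 → v = 0) :
    CFC.log (a * b) = CFC.log a * supp b + CFC.log b := by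
  have hsa := ha.isSelfAdjoint
  have hsb := hb.isSelfAdjoint
  have hsab : IsSelfAdjoint (a * b) := (IsSelfAdjoint.commute_iff hsa hsb).1 hab
  refine ext_joint_eigenvectors hsa hsb hab fun α β v hα hβ => ?_
  by_cases hv : v = 0
  · simp [hv]
  have hα0 : α ≠ 0 := by
    rintro rfl
    exact hv (hinj v (by simpa using hα))
  have h1 : (a * b) v = ((α * β : ℝ) : ℂ) • v := by
    rw [op_mul_apply, hβ, map_smul, hα, smul_smul]; push_cast; rw [mul_comm]
  have e1 := cfc_apply_of_eigenvector hsab h1 Real.log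
  have e2 := cfc_apply_of_eigenvector hsa hα Real.log
  have e3 := cfc_apply_of_eigenvector hsb hβ Real.log
  have e4 := cfc_apply_of_eigenvector hsb hβ (fun x : ℝ => if x = 0 then 0 else 1)
  rw [add_apply, op_mul_apply, CFC.log, CFC.log, CFC.log, supp,
    e1, e3, e4, map_smul, e2, smul_smul, ← add_smul]
  -- On the kernel of `b` both sides vanish, by `Real.log 0 = 0` and the factor `supp b`; without
  -- that factor `log α` would survive.
  by_cases hβ0 : β = 0
  · simp [hβ0]
  · rw [Real.log_mul hα0 hβ0]; simp [hβ0]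

end FunctionalCalculus

/-! ### Minimal projections of a commutative algebra. -/

section Projections

theorem Proj.mul_self (p : Proj H) : p.1 * p.1 = p.1 := p.2.isIdempotentElem

theorem Proj.star_eq (p : Proj H) : star p.1 = p.1 := p.2.isSelfAdjoint

theorem Proj.nonneg (p : Proj H) : 0 ≤ p.1 := p.2.nonneg

theorem isStarProjection_mul {p q : H →L[ℂ] H} (hp : IsStarProjection p) (hq : IsStarProjection q)
    (h : p * q = q * p) : IsStarProjection (p * q) where
  isIdempotentElem := by
    have e1 := hp.isIdempotentElem.eq
    have e2 := hq.isIdempotentElem.eq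
    change p * q * (p * q) = p * q
    rw [mul_assoc, ← mul_assoc q, ← h, mul_assoc p, e2, ← mul_assoc, e1]
  isSelfAdjoint := by
    have e1 := hp.isSelfAdjoint.star_eq
    have e2 := hq.isSelfAdjoint.star_eq
    change star (p * q) = p * q
    rw [star_mul, e1, e2, h]

/-- A *-subalgebra is commutative. -/
def IsCommAlg (Z : OpAlg H) : Prop := ∀ x ∈ Z, ∀ y ∈ Z, x * y = y * x

variable {Z : OpAlg H}

theorem minProj_mul_eq_zero_or (hZ : IsCommAlg Z) {p q : Proj H} (hp : p ∈ minProj Z)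
    (hq : q.1 ∈ Z) : p.1 * q.1 = 0 ∨ p.1 * q.1 = p.1 := by
  have hc := hZ _ hp.1 _ hq
  rcases hp.2.2 ⟨p.1 * q.1, isStarProjection_mul p.2 q.2 hc⟩ (Z.mul_mem hp.1 hq)
    (by simp only [hc, mul_assoc, p.mul_self]) with h | h
  · exact Or.inl h
  · exact Or.inr (congrArg Subtype.val h)

theorem minProj_mul_eq_zero (hZ : IsCommAlg Z) {p q : Proj H} (hp : p ∈ minProj Z)
    (hq : q ∈ minProj Z) (hne : p ≠ q) : p.1 * q.1 = 0 := by
  rcases minProj_mul_eq_zero_or hZ hp hq.1 with h | h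
  · exact h
  · rcases minProj_mul_eq_zero_or hZ hq hp.1 with h' | h'
    · rw [hZ _ hp.1 _ hq.1, h']
    · refine absurd (Subtype.ext ?_) hne
      rw [← h, hZ _ hp.1 _ hq.1, h']

variable [FiniteDimensional ℂ H]

theorem minProj_finite (hZ : IsCommAlg Z) : (minProj Z).Finite := by
  have hli : LinearIndependent ℂ (fun p : minProj Z => p.1.1) := by
    rw [linearIndependent_iff']
    intro s g hg i hi
    have h := congrArg (fun x => x * i.1.1) hg
    simp only [Finset.sum_mul, zero_mul, smul_mul_assoc] at h
    rw [Finset.sum_eq_single i, i.1.mul_self] at h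
    · exact (smul_eq_zero.1 h).resolve_right i.2.2.1
    · intro j _ hj
      rw [minProj_mul_eq_zero hZ j.2 i.2 fun h' => hj (Subtype.ext h'), smul_zero]
    · exact fun h' => absurd hi h'
  have := hli.finite
  exact Set.toFinite _

/-- Among the nonzero projections of `Z` below `e`, one whose range is minimal as a subspace is
minimal in `Z`. -/
theorem exists_minProj_le {e : Proj H} (he : e.1 ∈ Z) (he0 : e.1 ≠ 0) :
    ∃ p ∈ minProj Z, p.1 * e.1 = p.1 := by
  let S : Set (Submodule ℂ H) :=
    {V | ∃ p : Proj H, p.1 ∈ Z ∧ p.1 ≠ 0 ∧ p.1 * e.1 = p.1 ∧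
      LinearMap.range (p.1 : H →ₗ[ℂ] H) = V}
  have hS : S.Nonempty := ⟨_, e, he, he0, e.mul_self, rfl⟩
  obtain ⟨V, ⟨p, hpZ, hp0, hpe, rfl⟩, hmin⟩ := WellFounded.has_min
    (wellFounded_lt : WellFounded ((· < ·) : Submodule ℂ H → Submodule ℂ H → Prop)) S hS
  refine ⟨p, ⟨hpZ, hp0, fun q hqZ hqp => ?_⟩, hpe⟩
  by_cases hq0 : q.1 = 0
  · exact Or.inl hq0
  right
  have hpq : p.1 * q.1 = q.1 := by
    have := congrArg star hqp
    rwa [star_mul, q.star_eq, p.star_eq] at this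
  have hle : LinearMap.range (q.1 : H →ₗ[ℂ] H) ≤ LinearMap.range (p.1 : H →ₗ[ℂ] H) := by
    rintro _ ⟨v, rfl⟩
    exact ⟨q.1 v, congrArg (fun z : H →L[ℂ] H => z v) hpq⟩
  have hnlt := hmin _ ⟨q, hqZ, hq0, by rw [← hqp, mul_assoc, hpe], rfl⟩
  have heq : LinearMap.range (p.1 : H →ₗ[ℂ] H) ≤ LinearMap.range (q.1 : H →ₗ[ℂ] H) := by
    by_contra h
    exact hnlt (lt_of_le_not_ge hle h)
  have hqp' : q.1 * p.1 = p.1 := by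
    ext v
    obtain ⟨w, hw⟩ := heq ⟨v, rfl⟩
    have hw' : q.1 w = p.1 v := hw
    rw [op_mul_apply, ← hw', ← op_mul_apply, q.mul_self]
  exact Subtype.ext (hqp.symm.trans hqp')

/-- The sum `∑ f(p) p` over the minimal projections of `Z`. -/
def projSum (Z : OpAlg H) (f : Proj H → ℂ) : H →L[ℂ] H := ∑ᶠ p ∈ minProj Z, f p • p.1

theorem projSum_eq (hZ : IsCommAlg Z) (f : Proj H → ℂ) :
    projSum Z f = ∑ p ∈ (minProj_finite hZ).toFinset, f p • p.1 :=
  finsum_mem_eq_finite_toFinset_sum _ _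

theorem projSum_mem (hZ : IsCommAlg Z) (f : Proj H → ℂ) : projSum Z f ∈ Z := by
  rw [projSum_eq hZ]
  exact sum_mem fun p hp => Z.smul_mem _ ((Set.Finite.mem_toFinset _).1 hp).1

theorem projSum_mul (hZ : IsCommAlg Z) (f : Proj H → ℂ) {p : Proj H} (hp : p ∈ minProj Z) :
    projSum Z f * p.1 = f p • p.1 := by
  rw [projSum_eq hZ, Finset.sum_mul, Finset.sum_eq_single p]
  · rw [smul_mul_assoc, p.mul_self]
  · intro q hq hne
    rw [smul_mul_assoc, minProj_mul_eq_zero hZ ((Set.Finite.mem_toFinset _).1 hq) hp hne, smul_zero]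
  · exact fun h => absurd ((Set.Finite.mem_toFinset _).2 hp) h

theorem mul_projSum (hZ : IsCommAlg Z) (f : Proj H → ℂ) {p : Proj H} (hp : p ∈ minProj Z) :
    p.1 * projSum Z f = f p • p.1 := by
  rw [hZ _ hp.1 _ (projSum_mem hZ f), projSum_mul hZ f hp]

theorem projSum_mul_projSum (hZ : IsCommAlg Z) (f g : Proj H → ℂ) :
    projSum Z f * projSum Z g = projSum Z (fun p => f p * g p) := by
  rw [projSum_eq hZ g, projSum_eq hZ fun p => f p * g p, Finset.mul_sum]
  refine Finset.sum_congr rfl fun p hp => ?_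
  rw [mul_smul_comm, projSum_mul hZ f ((Set.Finite.mem_toFinset _).1 hp), smul_smul, mul_comm]

/-- Otherwise the complement of the sum would dominate a minimal projection, which is orthogonal to
it. -/
theorem projSum_one (hZ : IsCommAlg Z) (h1 : (1 : H →L[ℂ] H) ∈ Z) : projSum Z (fun _ => 1) = 1 := by
  set R := projSum Z (fun _ => 1) with hR
  have hRs : star R = R := by
    rw [hR, projSum_eq hZ, star_sum]
    exact Finset.sum_congr rfl fun p _ => by rw [one_smul, p.star_eq]
  have hRR : R * R = R := by
    rw [hR, projSum_mul_projSum hZ]; simp only [mul_one]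
  by_contra hne
  have hproj : IsStarProjection (1 - R) :=
    { isIdempotentElem := by
        change (1 - R) * (1 - R) = 1 - R
        rw [sub_mul, mul_sub, mul_sub, hRR]; simp
      isSelfAdjoint := by
        change star (1 - R) = 1 - R
        rw [star_sub, star_one, hRs] }
  obtain ⟨p, hp, hpe⟩ := exists_minProj_le (e := ⟨1 - R, hproj⟩) (Z := Z)
    (Z.sub_mem h1 (projSum_mem hZ _)) fun h => hne (sub_eq_zero.1 h).symm
  have : p.1 * (1 - R) = 0 := by
    rw [mul_sub, mul_one, hR, mul_projSum hZ _ hp, one_smul, sub_self]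
  exact hp.2.1 (hpe.symm.trans this)

theorem sum_minProj (hZ : IsCommAlg Z) (h1 : (1 : H →L[ℂ] H) ∈ Z) :
    ∑ p ∈ (minProj_finite hZ).toFinset, p.1 = 1 := by
  rw [← projSum_one hZ h1, projSum_eq hZ]
  simp

theorem ext_minProj (hZ : IsCommAlg Z) (h1 : (1 : H →L[ℂ] H) ∈ Z) {x y : H →L[ℂ] H}
    (h : ∀ p ∈ minProj Z, x * p.1 = y * p.1) : x = y := by
  rw [← mul_one x, ← mul_one y, ← sum_minProj hZ h1, Finset.mul_sum, Finset.mul_sum]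
  exact Finset.sum_congr rfl fun p hp => h p ((Set.Finite.mem_toFinset _).1 hp)

theorem exists_minProj_mul_ne_zero (hZ : IsCommAlg Z) (h1 : (1 : H →L[ℂ] H) ∈ Z) {x : H →L[ℂ] H}
    (hx : x ≠ 0) : ∃ p ∈ minProj Z, x * p.1 ≠ 0 := by
  by_contra! h
  exact hx (ext_minProj hZ h1 fun p hp => by rw [h p hp, zero_mul])

theorem projSum_congr (hZ : IsCommAlg Z) {f g : Proj H → ℂ} (h : ∀ p ∈ minProj Z, f p = g p) :
    projSum Z f = projSum Z g := by
  rw [projSum_eq hZ f, projSum_eq hZ g]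
  exact Finset.sum_congr rfl fun p hp => by rw [h p ((Set.Finite.mem_toFinset _).1 hp)]

theorem projSum_mul_inv (hZ : IsCommAlg Z) (h1 : (1 : H →L[ℂ] H) ∈ Z) {f : Proj H → ℂ}
    (h : ∀ p ∈ minProj Z, f p ≠ 0) : projSum Z f * projSum Z (fun p => (f p)⁻¹) = 1 := by
  rw [projSum_mul_projSum hZ, ← projSum_one hZ h1]
  exact projSum_congr hZ fun p hp => mul_inv_cancel₀ (h p hp)

theorem projSum_nonneg (hZ : IsCommAlg Z) {f : Proj H → ℝ} (h : ∀ p ∈ minProj Z, 0 ≤ f p) :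
    0 ≤ projSum Z (fun p => (f p : ℂ)) := by
  rw [projSum_eq hZ]
  refine Finset.sum_nonneg fun p hp => ?_
  have := smul_nonneg (h p ((Set.Finite.mem_toFinset _).1 hp)) p.nonneg
  rwa [Complex.coe_smul]

/-- The elements of a commutative algebra are scalar on the minimal projections. -/
theorem exists_mul_minProj_eq_smul (hZ : IsCommAlg Z) (h1 : (1 : H →L[ℂ] H) ∈ Z) {p : Proj H}
    (hp : p ∈ minProj Z) {x : H →L[ℂ] H} (hx : x ∈ Z) : ∃ c : ℂ, x * p.1 = c • p.1 := by
  have key : ∀ y ∈ Z, IsSelfAdjoint y → ∃ c : ℂ, y * p.1 = c • p.1 := by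
    intro y hy hys
    by_contra! hno
    refine hp.2.1 (ext_eigenvectors hys fun α v hv => ?_)
    -- `s` is the spectral projection of `y` at `α`, and it lies in `Z`. By minimality `p s` is `0`
    -- or `p`. The second case would make `y` scalar on `p`; so `p` kills every eigenvector of `y`,
    -- hence `p = 0`.
    set f : ℝ → ℝ := fun t => if t = α then 1 else 0 with hf
    set s := cfc f y with hs
    have hsa : IsSelfAdjoint s := cfc_predicate _ y
    have hsZ : s ∈ Z := cfc_mem h1 hys hy f
    have hss : s * s = s := by
      refine ext_eigenvectors hys fun β w hw => ?_
      have := cfc_apply_of_eigenvector hys hw f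
      rw [op_mul_apply, hs, this, map_smul, this, smul_smul, hf]
      dsimp only
      split_ifs <;> simp
    have hys' : y * s = (α : ℂ) • s := by
      refine ext_eigenvectors hys fun β w hw => ?_
      have := cfc_apply_of_eigenvector hys hw f
      rw [op_mul_apply, smul_apply, hs, this, map_smul, hw, smul_smul, smul_smul,
        hf]
      dsimp only
      split_ifs with h <;> simp [h]
    have hsv : s v = v := by
      have := cfc_apply_of_eigenvector hys hv f
      rw [hs, this, hf]
      simp
    rcases minProj_mul_eq_zero_or hZ hp (q := ⟨s, hss, hsa⟩) hsZ with h | h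
    · have := congrArg (fun z : H →L[ℂ] H => z v) h
      simp only [op_mul_apply, hsv] at this
      simpa using this
    · refine absurd ?_ (hno α)
      change p.1 * s = p.1 at h
      rw [← h, hZ _ hp.1 _ hsZ, ← mul_assoc, hys', smul_mul_assoc]
  have hs : star x ∈ Z := star_mem hx
  obtain ⟨c, hc⟩ := key (x + star x) (Z.add_mem hx hs) (IsSelfAdjoint.add_star_self x)
  obtain ⟨d, hd⟩ := key (Complex.I • (x - star x)) (Z.smul_mem _ (Z.sub_mem hx hs)) (by
    change star _ = _
    rw [star_smul, star_sub, star_star, RCLike.star_def, Complex.conj_I, neg_smul, ← smul_neg, neg_sub])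
  refine ⟨(c - Complex.I * d) / 2, ?_⟩
  have : x = (1 / 2 : ℂ) • ((x + star x) - Complex.I • (Complex.I • (x - star x))) := by
    rw [smul_smul, Complex.I_mul_I]
    module
  rw [this, smul_mul_assoc, sub_mul, smul_mul_assoc, hc, hd]
  module

end Projections

/-! ### Commutants and centers. -/

section Commutant

theorem mem_commutant {A : OpAlg H} {x : H →L[ℂ] H} :
    x ∈ commutant A ↔ ∀ a ∈ A, a * x = x * a := by
  refine ⟨fun h a ha => (NonUnitalStarSubalgebra.mem_centralizer_iff ℂ).1 h a ha |>.1, fun h => ?_⟩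
  exact (NonUnitalStarSubalgebra.mem_centralizer_iff ℂ).2 fun a ha =>
    ⟨h a ha, h _ (star_mem ha)⟩

theorem commutant_anti {A B : OpAlg H} (h : A ≤ B) : commutant B ≤ commutant A :=
  fun _ hx => mem_commutant.2 fun a ha => mem_commutant.1 hx a (h ha)

theorem one_mem_commutant (A : OpAlg H) : (1 : H →L[ℂ] H) ∈ commutant A :=
  mem_commutant.2 fun a _ => by rw [mul_one, one_mul]

theorem mem_center {A : OpAlg H} {x : H →L[ℂ] H} :
    x ∈ center A ↔ x ∈ A ∧ ∀ a ∈ A, a * x = x * a := by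
  rw [← mem_commutant]; rfl

theorem isCommAlg_center (A : OpAlg H) : IsCommAlg (center A) :=
  fun _ hx y hy => ((mem_center.1 hx).2 y hy.1).symm

theorem one_mem_center {A : OpAlg H} (h1 : (1 : H →L[ℂ] H) ∈ A) : (1 : H →L[ℂ] H) ∈ center A :=
  ⟨h1, one_mem_commutant A⟩

end Commutant

/-! ### Averaging over a frame: double commutant, dimensions, uniqueness of the trace. -/

section Frames

/-- A frame of `A` for the Hilbert–Schmidt inner product `tr (x* y)`. -/
structure IsFrame {ι : Type*} [Fintype ι] (A : OpAlg H) (a : ι → H →L[ℂ] H) : Prop where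
  mem : ∀ i, a i ∈ A
  expand : ∀ x ∈ A, ∑ i, tr (star (a i) * x) • a i = x

theorem exists_orthonormal_expansion {V : Type*} [AddCommGroup V] [Module ℂ V]
    [FiniteDimensional ℂ V] (c : InnerProductSpace.Core ℂ V) :
    ∃ (n : ℕ) (b : Fin n → V), ∀ x, ∑ i, c.inner (b i) x • b i = x := by
  let := c.toNormedAddCommGroup
  let : InnerProductSpace ℂ V := InnerProductSpace.ofCore c.toCore
  exact ⟨_, stdOrthonormalBasis ℂ V, fun x => (stdOrthonormalBasis ℂ V).sum_repr' x⟩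

/-- Both sides are the trace of `c • id`. -/
theorem mul_finrank_eq_sum {V : Type*} [AddCommGroup V] [Module ℂ V] [FiniteDimensional ℂ V]
    {ι : Type*} [Fintype ι] (φ : ι → V →ₗ[ℂ] ℂ) (e : ι → V) (c : ℂ)
    (h : ∀ x, c • x = ∑ i, φ i x • e i) :
    c * Module.finrank ℂ V = ∑ i, φ i (e i) := by
  have h1 : c • (LinearMap.id : V →ₗ[ℂ] V) = ∑ i, (φ i).smulRight (e i) := by
    ext x
    simpa using h x
  have h2 := congrArg (LinearMap.trace ℂ V) h1
  simpa [LinearMap.trace_smulRight] using h2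

variable [FiniteDimensional ℂ H]

instance (A : OpAlg H) : FiniteDimensional ℂ A :=
  inferInstanceAs (FiniteDimensional ℂ A.toSubmodule)

theorem exists_frame (A : OpAlg H) : ∃ (n : ℕ) (a : Fin n → H →L[ℂ] H), IsFrame A a := by
  let c : InnerProductSpace.Core ℂ A :=
    { inner := fun x y => tr (star x.1 * y.1)
      conj_inner_symm := fun x y => by
        change star (tr (star y.1 * x.1)) = tr (star x.1 * y.1)
        rw [← tr_star, star_mul, star_star]
      re_inner_nonneg := fun x => (Complex.nonneg_iff.1 (tr_star_mul_self_nonneg x.1)).1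
      add_left := fun x y z => by
        change tr (star (x.1 + y.1) * z.1) = tr (star x.1 * z.1) + tr (star y.1 * z.1)
        rw [star_add, add_mul, tr_add]
      smul_left := fun x y r => by
        change tr (star (r • x.1) * y.1) = star r * tr (star x.1 * y.1)
        rw [star_smul, smul_mul_assoc, tr_smul]
      definite := fun x hx => Subtype.ext (eq_zero_of_tr_star_mul_self hx) }
  obtain ⟨n, b, hb⟩ := exists_orthonormal_expansion c
  refine ⟨n, fun i => b i, fun i => (b i).2, fun x hx => ?_⟩
  have h := congrArg (Subtype.val : A → H →L[ℂ] H) (hb ⟨x, hx⟩)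
  rw [AddSubmonoidClass.coe_finsetSum] at h
  exact h

variable {ι : Type*} [Fintype ι] {A : OpAlg H} {a : ι → H →L[ℂ] H}

theorem IsFrame.adjoint (ha : IsFrame A a) : IsFrame A (fun i => star (a i)) := by
  refine ⟨fun i => star_mem (ha.mem i), fun x hx => ?_⟩
  have h := congrArg star (ha.expand _ (star_mem hx))
  rw [star_star, star_sum] at h
  rw [← h]
  refine Finset.sum_congr rfl fun i _ => ?_
  rw [star_smul, ← tr_star, star_mul, star_star, star_star, tr_mul_comm, h]

theorem IsFrame.parseval (ha : IsFrame A a) {x : H →L[ℂ] H} (hx : x ∈ A) (y : H →L[ℂ] H) :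
    ∑ i, tr (star (a i) * x) * tr (y * a i) = tr (y * x) := by
  conv_rhs => rw [← ha.expand x hx]
  rw [Finset.mul_sum, tr_sum]
  exact Finset.sum_congr rfl fun i _ => by rw [mul_smul_comm, tr_smul]

/-- Expanding `y a_i` on the left and `a_j* y` on the right in the frame produces the same
coefficients `tr (a_j* y a_i)`. -/
theorem IsFrame.intertwine (ha : IsFrame A a) {y : H →L[ℂ] H} (hy : y ∈ A) (X : H →L[ℂ] H) :
    y * ∑ i, a i * X * star (a i) = (∑ i, a i * X * star (a i)) * y := by
  have h1 : ∀ i, y * (a i * X * star (a i)) =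
      ∑ j, tr (star (a j) * (y * a i)) • (a j * X * star (a i)) := fun i => by
    have h := ha.expand _ (mul_mem hy (ha.mem i))
    calc y * (a i * X * star (a i)) = (y * a i) * X * star (a i) := by simp only [mul_assoc]
      _ = _ := by
        conv_lhs => rw [← h]
        simp only [Finset.sum_mul, smul_mul_assoc]
  have h2 : ∀ j, (a j * X * star (a j)) * y =
      ∑ i, tr (star (a j) * (y * a i)) • (a j * X * star (a i)) := fun j => by
    have h := congrArg star (ha.expand _ (mul_mem (star_mem hy) (ha.mem j)))
    rw [star_mul, star_star, star_sum] at h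
    rw [mul_assoc, ← h, Finset.mul_sum]
    refine Finset.sum_congr rfl fun i _ => ?_
    rw [star_smul, ← tr_star, star_mul, star_mul, star_star, star_star, mul_smul_comm, mul_assoc]
  rw [Finset.mul_sum, Finset.sum_mul, Finset.sum_congr rfl fun i _ => h1 i,
    Finset.sum_congr rfl fun i _ => h2 i, Finset.sum_comm]

theorem IsFrame.sum_mem_commutant (ha : IsFrame A a) (X : H →L[ℂ] H) :
    ∑ i, a i * X * star (a i) ∈ commutant A :=
  mem_commutant.2 fun _ hy => ha.intertwine hy X

/-- Contracting an identity of two-sided multiplication operators with the trace. -/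
theorem sum_tr_smul_eq {x y x' y' : ι → H →L[ℂ] H}
    (h : ∀ T, ∑ i, x i * T * y i = ∑ i, x' i * T * y' i) :
    ∑ i, tr (y i) • x i = ∑ i, tr (y' i) • x' i := by
  -- Insert the rank-one operators `|u⟩⟨e_p|` for `T`, evaluate at `e_p` and sum over `p`: the
  -- second factors turn into traces.
  have key : ∀ (x y : ι → H →L[ℂ] H) (u : H), (∑ i, tr (y i) • x i) u =
      ∑ p, (∑ i, x i * InnerProductSpace.rankOne ℂ u (stdOrthonormalBasis ℂ H p) * y i)
        (stdOrthonormalBasis ℂ H p) := by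
    intro x y u
    simp only [sum_apply]
    rw [Finset.sum_comm]
    refine Finset.sum_congr rfl fun i _ => ?_
    rw [smul_apply, tr_eq_sum_inner, Finset.sum_smul]
    refine Finset.sum_congr rfl fun p _ => ?_
    rw [op_mul_apply, op_mul_apply, InnerProductSpace.rankOne_apply, map_smul]
  ext u
  rw [key, key]
  exact Finset.sum_congr rfl fun p _ => by rw [h]

/-- An `X ∈ A''` commutes with every average `∑ a_i T a_i* ∈ A'`. Contracting this identity in `T`
gives `X ∑ tr(a_i*) a_i = ∑ tr(a_i* X) a_i`. The sum on the left is the expansion of `1`, and the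
right side lies in `A`. -/
theorem commutant_commutant (h1 : (1 : H →L[ℂ] H) ∈ A) : commutant (commutant A) = A := by
  refine le_antisymm (fun X hX => ?_) fun x hx => mem_commutant.2 fun b hb =>
    (mem_commutant.1 hb x hx).symm
  obtain ⟨n, a, ha⟩ := exists_frame A
  have h : ∀ T, ∑ i, (X * a i) * T * star (a i) = ∑ i, a i * T * (star (a i) * X) := fun T => by
    have := mem_commutant.1 hX _ (ha.sum_mem_commutant T)
    rw [Finset.sum_mul, Finset.mul_sum] at this
    simp only [mul_assoc] at this ⊢
    exact this.symm
  have h2 := sum_tr_smul_eq h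
  have h3 := ha.expand 1 h1
  simp only [mul_one] at h3
  simp only [← mul_smul_comm] at h2
  rw [← Finset.mul_sum, h3, mul_one] at h2
  rw [h2]
  exact sum_mem fun i _ => A.smul_mem _ (ha.mem i)

/-- The trace of a completely positive map that is a multiple of a projection onto `B`. -/
theorem mul_finrank_eq_sum_tr {B : OpAlg H} {v : ι → H →L[ℂ] H} {c : ℂ}
    (hB : ∀ X, ∑ i, v i * X * star (v i) ∈ B) (hc : ∀ x ∈ B, ∑ i, v i * x * star (v i) = c • x) :
    c * Module.finrank ℂ B = ∑ i, tr (v i) * tr (star (v i)) := by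
  set e := stdOrthonormalBasis ℂ H
  have hexp : ∀ x : H →L[ℂ] H,
      x = ∑ s : Fin _ × Fin _, inner ℂ (e s.1) (x (e s.2)) • InnerProductSpace.rankOne ℂ (e s.1) (e s.2) := by
    intro x
    refine ContinuousLinearMap.coe_injective (e.toBasis.ext fun q => ?_)
    rw [Fintype.sum_prod_type]
    simp only [ContinuousLinearMap.coe_coe, OrthonormalBasis.coe_toBasis, sum_apply, smul_apply,
      InnerProductSpace.rankOne_apply, e.inner_eq_ite, ite_smul, one_smul, zero_smul, smul_ite,
      smul_zero, Finset.sum_ite_eq', Finset.mem_univ, if_true]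
    exact (e.sum_repr' _).symm
  -- The map `X ↦ ∑ v_i X v_i*` has range in `B` and is `c` there. Expressed in matrix units of
  -- `B(H)`, its trace is `∑ tr(v_i) tr(v_i*)`.
  have h := mul_finrank_eq_sum (V := B) (ι := Fin _ × Fin _)
    (fun s => (((innerSL ℂ (e s.1)).toLinearMap ∘ₗ
      (ContinuousLinearMap.apply ℂ H (e s.2)).toLinearMap) ∘ₗ B.toSubmodule.subtype))
    (fun s => ⟨_, hB (InnerProductSpace.rankOne ℂ (e s.1) (e s.2))⟩) c (fun x => by
      apply Subtype.ext
      rw [AddSubmonoidClass.coe_finsetSum]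
      change c • x.1 = _
      rw [← hc x.1 x.2]
      conv_lhs => rw [hexp x.1]
      simp only [Finset.mul_sum, Finset.sum_mul]
      rw [Finset.sum_comm]
      refine Finset.sum_congr rfl fun s _ => ?_
      simp only [mul_smul_comm, smul_mul_assoc, ← Finset.smul_sum]
      rfl)
  rw [h]
  have h2 : ∀ s : Fin _ × Fin _, (((innerSL ℂ (e s.1)).toLinearMap ∘ₗ
      (ContinuousLinearMap.apply ℂ H (e s.2)).toLinearMap) ∘ₗ B.toSubmodule.subtype)
      (⟨_, hB (InnerProductSpace.rankOne ℂ (e s.1) (e s.2))⟩ : B) =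
      ∑ i, inner ℂ (e s.1) (v i (e s.1)) * inner ℂ (e s.2) (star (v i) (e s.2)) := by
    intro s
    change inner ℂ (e s.1) ((∑ i, v i * InnerProductSpace.rankOne ℂ (e s.1) (e s.2) * star (v i))
      (e s.2)) = _
    rw [sum_apply, inner_sum]
    refine Finset.sum_congr rfl fun i _ => ?_
    rw [op_mul_apply, op_mul_apply, InnerProductSpace.rankOne_apply, map_smul, inner_smul_right,
      mul_comm]
  rw [Finset.sum_congr rfl fun s _ => h2 s, Finset.sum_comm]
  refine Finset.sum_congr rfl fun i _ => ?_
  rw [Fintype.sum_prod_type, tr_eq_sum_inner, tr_eq_sum_inner, Finset.sum_mul_sum]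

theorem tr_proj_pos {p : Proj H} (hp : p.1 ≠ 0) : 0 < tr p.1 :=
  lt_of_le_of_ne (tr_nonneg p.nonneg) fun h => hp (eq_zero_of_tr_eq_zero p.nonneg h.symm)

theorem IsFrame.sum_tr_eq_finrank (ha : IsFrame A a) {P : Proj H} (hP : P.1 ∈ center A) :
    ∑ i, tr (star (a i) * (P.1 * a i)) = Module.finrank ℂ (corner A P) := by
  have hmem : ∀ i, P.1 * a i ∈ corner A P := fun i => by
    refine ⟨mul_mem hP.1 (ha.mem i), by rw [← mul_assoc, P.mul_self], ?_⟩
    rw [mul_assoc, (mem_center.1 hP).2 _ (ha.mem i), ← mul_assoc, P.mul_self]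
  have h := mul_finrank_eq_sum (V := corner A P)
    (fun i => (trLin ∘ₗ LinearMap.mulLeft ℂ (star (a i))) ∘ₗ (corner A P).toSubmodule.subtype)
    (fun i => ⟨_, hmem i⟩) 1 (fun x => by
      apply Subtype.ext
      rw [AddSubmonoidClass.coe_finsetSum,
        one_smul]

      conv_lhs => rw [← x.2.2.1, ← ha.expand x.1 x.2.1, Finset.mul_sum]
      refine Finset.sum_congr rfl fun i _ => ?_
      rw [mul_smul_comm]
      rfl)
  rw [one_mul] at h
  rw [h]
  rfl

theorem mem_corner_self {P : Proj H} (hP : P.1 ∈ A) : P.1 ∈ corner A P :=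
  ⟨hP, P.mul_self, P.mul_self⟩

theorem finrank_pos_of_ne_zero {x : H →L[ℂ] H} (hx : x ∈ A) (h0 : x ≠ 0) :
    0 < Module.finrank ℂ A := by
  have : Nontrivial A := ⟨⟨x, hx⟩, 0, fun h => h0 (congrArg Subtype.val h)⟩
  exact Module.finrank_pos

variable (h1 : (1 : H →L[ℂ] H) ∈ A) {P : Proj H} (hP : P ∈ minProj (center A))

theorem IsFrame.sum_mul_mem_center (ha : IsFrame A a) {x : H →L[ℂ] H} (hx : x ∈ A) :
    ∑ i, a i * x * star (a i) ∈ center A :=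
  ⟨sum_mem fun i _ => mul_mem (mul_mem (ha.mem i) hx) (star_mem (ha.mem i) : star (a i) ∈ A),
    ha.sum_mem_commutant x⟩

-- The average of `1` is central, hence scalar on `P`; the trace identifies the scalar.
include h1 hP in
theorem IsFrame.sum_mul_star_mul (ha : IsFrame A a) :
    (∑ i, a i * star (a i)) * P.1 = (Module.finrank ℂ (corner A P) / tr P.1 : ℂ) • P.1 := by
  have hc := ha.sum_mul_mem_center h1
  simp only [mul_one] at hc
  obtain ⟨c, hc⟩ := exists_mul_minProj_eq_smul (isCommAlg_center A) (one_mem_center h1) hP hc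
  have h := congrArg tr hc
  rw [Finset.sum_mul, tr_sum, tr_smul] at h
  have h2 : ∑ i, tr (a i * star (a i) * P.1) = Module.finrank ℂ (corner A P) := by
    rw [← ha.sum_tr_eq_finrank hP.1]
    refine Finset.sum_congr rfl fun i _ => ?_
    rw [mul_assoc, tr_mul_comm, mul_assoc]
  rw [hc, ← h2, h, mul_div_cancel_right₀ _ (tr_proj_pos hP.2.1).ne']

include hP in
theorem finrank_corner_pos : 0 < Module.finrank ℂ (corner A P) :=
  finrank_pos_of_ne_zero (mem_corner_self hP.1.1) hP.2.1

-- The map `X ↦ ∑ a_i P X P a_i*` has range in `P A'` and acts there as the scalar `dim (P A) / tr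
-- P`, while its trace is `tr P` by Parseval.
include h1 hP in
theorem finrank_corner_mul :
    (Module.finrank ℂ (corner A P) : ℂ) * Module.finrank ℂ (corner (commutant A) P) =
      tr P.1 ^ 2 := by
  obtain ⟨n, a, ha⟩ := exists_frame A
  have hPc := (mem_center.1 hP.1).2
  have ht := (tr_proj_pos hP.2.1).ne'
  have key := mul_finrank_eq_sum_tr (B := corner (commutant A) P) (v := fun i => a i * P.1)
    (c := Module.finrank ℂ (corner A P) / tr P.1) (fun X => by
      have e : ∑ i, a i * P.1 * X * star (a i * P.1) = ∑ i, a i * (P.1 * X * P.1) * star (a i) :=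
        Finset.sum_congr rfl fun i _ => by rw [star_mul, P.star_eq]; simp only [mul_assoc]
      refine ⟨e ▸ ha.sum_mem_commutant _, ?_, ?_⟩
      · rw [Finset.mul_sum]
        refine Finset.sum_congr rfl fun i _ => ?_
        rw [← mul_assoc, ← mul_assoc, ← mul_assoc, ← hPc _ (ha.mem i), mul_assoc (a i), P.mul_self]
      · rw [Finset.sum_mul]
        refine Finset.sum_congr rfl fun i _ => ?_
        rw [star_mul, P.star_eq, ← hPc _ (star_mem (ha.mem i))]
        simp only [mul_assoc, P.mul_self])
    (fun x hx => by
      have e : ∀ i, a i * P.1 * x * star (a i * P.1) = a i * star (a i) * P.1 * x := fun i => by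
        have hxa := mem_commutant.1 hx.1 _ (star_mem (ha.mem i))
        calc a i * P.1 * x * star (a i * P.1) = a i * (P.1 * (x * P.1)) * star (a i) := by
              rw [star_mul, P.star_eq]; simp only [mul_assoc]
          _ = a i * (star (a i) * x) := by rw [hx.2.2, hx.2.1, mul_assoc, hxa]
          _ = a i * star (a i) * (P.1 * x) := by rw [hx.2.1, mul_assoc]
          _ = _ := by simp only [mul_assoc]
      rw [Finset.sum_congr rfl fun i _ => e i, ← Finset.sum_mul, ← Finset.sum_mul,
        ha.sum_mul_star_mul h1 hP, smul_mul_assoc, hx.2.1])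
  have h2 : ∑ i, tr (a i * P.1) * tr (star (a i * P.1)) = tr P.1 := by
    have := ha.parseval hP.1.1 P.1
    rw [P.mul_self] at this
    rw [← this]
    refine Finset.sum_congr rfl fun i _ => ?_
    rw [star_mul, P.star_eq, tr_mul_comm (a i), tr_mul_comm P.1 (star (a i)), mul_comm]
  rw [h2] at key
  field_simp at key
  rw [key]

include h1 hP in
/-- The trace on a factor is unique. -/
theorem tracial_eq {f : (H →L[ℂ] H) →ₗ[ℂ] ℂ} (hf : ∀ x ∈ A, ∀ y ∈ A, f (x * y) = f (y * x))
    {x : H →L[ℂ] H} (hx : x ∈ A) : f (x * P.1) * tr P.1 = f P.1 * tr (x * P.1) := by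
  obtain ⟨n, a, ha⟩ := exists_frame A
  have hPc := (mem_center.1 hP.1).2
  obtain ⟨s, hs⟩ := exists_mul_minProj_eq_smul (isCommAlg_center A) (one_mem_center h1) hP
    (ha.sum_mul_mem_center hx)
  have hst := ha.adjoint.sum_mul_star_mul h1 hP
  simp only [star_star] at hst
  -- The average of `x` equals the scalar `s` on `P`. Traciality moves the frame to one side, where
  -- it sums to a constant. Since `s` does not involve `f`, comparison with `tr` gives the claim.
  have key : ∀ f : (H →L[ℂ] H) →ₗ[ℂ] ℂ, (∀ x ∈ A, ∀ y ∈ A, f (x * y) = f (y * x)) →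
      (Module.finrank ℂ (corner A P) / tr P.1 : ℂ) * f (x * P.1) = s * f P.1 := by
    intro f hf
    rw [← smul_eq_mul, ← smul_eq_mul s, ← map_smul, ← map_smul, ← hs, ← mul_smul_comm, ← hst,
      Finset.sum_mul, Finset.sum_mul, Finset.mul_sum, map_sum, map_sum]
    refine Finset.sum_congr rfl fun i _ => ?_
    have e1 : a i * x * star (a i) * P.1 = a i * (x * star (a i) * P.1) := by simp only [mul_assoc]
    rw [e1, hf _ (ha.mem i) _ (mul_mem (mul_mem hx (star_mem (ha.mem i))) hP.1.1)]
    simp only [mul_assoc]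
    rw [hPc _ (ha.mem i)]
  have k1 := key f hf
  have k2 := key trLin fun x _ y _ => tr_mul_comm x y
  change _ * tr (x * P.1) = s * tr P.1 at k2
  have hc : (Module.finrank ℂ (corner A P) / tr P.1 : ℂ) ≠ 0 :=
    div_ne_zero (Nat.cast_ne_zero.2 (finrank_corner_pos hP).ne') (tr_proj_pos hP.2.1).ne'
  refine mul_left_cancel₀ hc ?_
  linear_combination tr P.1 * k1 - f P.1 * k2

end Frames

/-! ### Canonical traces and density matrices. -/

section CanonicalTrace

/-- The size `m` of the matrix algebra `P A`. -/
def cdim (A : OpAlg H) (P : Proj H) : ℝ := Real.sqrt (Module.finrank ℂ (corner A P))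

/-- The density of the canonical trace of `A` with respect to the trace of `B(H)`. -/
def traceDensity (A : OpAlg H) : H →L[ℂ] H :=
  projSum (center A) fun P => ((cdim A P / (tr P.1).re : ℝ) : ℂ)

variable [FiniteDimensional ℂ H]

theorem tr_proj_re (P : Proj H) : (((tr P.1).re : ℝ) : ℂ) = tr P.1 :=
  Complex.ext rfl (by simpa using (Complex.nonneg_iff.1 (tr_nonneg P.nonneg)).2)

theorem tr_proj_re_pos {P : Proj H} (hP : P.1 ≠ 0) : 0 < (tr P.1).re :=
  (Complex.pos_iff.1 (tr_proj_pos hP)).1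

theorem canTrace_eq_tr (A : OpAlg H) (x : H →L[ℂ] H) : canTrace A x = tr (traceDensity A * x) := by
  rw [canTrace, finsum_mem_eq_finite_toFinset_sum _ (minProj_finite (isCommAlg_center A)),
    traceDensity, projSum_eq (isCommAlg_center A), Finset.sum_mul, tr_sum]
  refine Finset.sum_congr rfl fun P _ => ?_
  rw [smul_mul_assoc, tr_smul, Complex.ofReal_div, tr_proj_re]
  rfl

variable {A : OpAlg H}

theorem traceDensity_mem (A : OpAlg H) : traceDensity A ∈ center A :=
  projSum_mem (isCommAlg_center A) _

theorem traceDensity_comm {x : H →L[ℂ] H} (hx : x ∈ A) :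
    x * traceDensity A = traceDensity A * x := (mem_center.1 (traceDensity_mem A)).2 x hx

theorem cdim_nonneg (A : OpAlg H) (P : Proj H) : 0 ≤ cdim A P := Real.sqrt_nonneg _

theorem cdim_pos {P : Proj H} (hP : P ∈ minProj (center A)) : 0 < cdim A P :=
  Real.sqrt_pos.2 (Nat.cast_pos.2 (finrank_corner_pos hP))

theorem cdim_sq (A : OpAlg H) (P : Proj H) : cdim A P ^ 2 = Module.finrank ℂ (corner A P) :=
  Real.sq_sqrt (Nat.cast_nonneg _)

theorem traceDensity_nonneg (A : OpAlg H) : 0 ≤ traceDensity A :=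
  projSum_nonneg (isCommAlg_center A) fun P hP =>
    div_nonneg (cdim_nonneg A P) (tr_proj_re_pos hP.2.1).le

theorem traceDensity_mul {P : Proj H} (hP : P ∈ minProj (center A)) :
    traceDensity A * P.1 = ((cdim A P / (tr P.1).re : ℝ) : ℂ) • P.1 :=
  projSum_mul (isCommAlg_center A) _ hP

theorem exists_traceDensity_inv (h1 : (1 : H →L[ℂ] H) ∈ A) :
    ∃ q ∈ center A, q * traceDensity A = 1 ∧ traceDensity A * q = 1 := by
  have h := projSum_mul_inv (isCommAlg_center A) (one_mem_center h1)
    (f := fun P => ((cdim A P / (tr P.1).re : ℝ) : ℂ)) fun P hP =>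
      Complex.ofReal_ne_zero.2 (div_pos (cdim_pos hP) (tr_proj_re_pos hP.2.1)).ne'
  exact ⟨_, projSum_mem (isCommAlg_center A) _, mul_eq_one_symm h, h⟩

theorem cdim_mul_cdim (h1 : (1 : H →L[ℂ] H) ∈ A) {P : Proj H} (hP : P ∈ minProj (center A)) :
    cdim A P * cdim (commutant A) P = (tr P.1).re := by
  have h := finrank_corner_mul h1 hP
  rw [← tr_proj_re] at h
  have h' : (Module.finrank ℂ (corner A P) : ℝ) * Module.finrank ℂ (corner (commutant A) P) =
      (tr P.1).re ^ 2 := by exact_mod_cast h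
  rw [cdim, cdim, ← Real.sqrt_mul (Nat.cast_nonneg _), h', Real.sqrt_sq (tr_proj_re_pos hP.2.1).le]

theorem center_commutant (h1 : (1 : H →L[ℂ] H) ∈ A) : center (commutant A) = center A := by
  rw [center, center, commutant_commutant h1, inf_comm]

/-- Faithfulness of the canonical trace. -/
theorem eq_zero_of_canTrace (h1 : (1 : H →L[ℂ] H) ∈ A) {x : H →L[ℂ] H}
    (h : tr (traceDensity A * (star x * x)) = 0) : x = 0 := by
  obtain ⟨q, -, hq, -⟩ := exists_traceDensity_inv h1
  exact eq_zero_of_tr_mul_star_mul_self (traceDensity_nonneg A) hq h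

theorem eq_of_canTrace_mul_eq (h1 : (1 : H →L[ℂ] H) ∈ A) {x y : H →L[ℂ] H} (hx : x ∈ A) (hy : y ∈ A)
    (h : ∀ a ∈ A, tr (traceDensity A * (x * a)) = tr (traceDensity A * (y * a))) : x = y := by
  have h2 := h (star (x - y)) (star_mem (sub_mem hx hy))
  rw [← sub_eq_zero, ← tr_sub, ← mul_sub, ← sub_mul] at h2
  have h3 : star (x - y) = 0 := eq_zero_of_canTrace h1 (by rwa [star_star])
  rw [star_eq_zero] at h3
  exact sub_eq_zero.1 h3

/-- Meant for blocks, which need not contain the identity of `H`; faithfulness is therefore a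
hypothesis. -/
theorem density_eq_of_faithful (hA : ∀ x ∈ A, canTrace A (x * star x) = 0 → x = 0)
    {ω : A →ₗ[ℂ] ℂ} {ρ : H →L[ℂ] H} (hρ : ρ ∈ A) (h : ∀ a : A, canTrace A (ρ * a) = ω a) :
    density A ω = ρ := by
  have hex : ∃ ρ : H →L[ℂ] H, ρ ∈ A ∧ ∀ a : A, canTrace A (ρ * a) = ω a := ⟨ρ, hρ, h⟩
  have hd : density A ω = hex.choose := dif_pos hex
  obtain ⟨hm, hs⟩ := hex.choose_spec
  rw [← hd] at hm hs
  have hmem := sub_mem hm hρ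
  refine sub_eq_zero.1 (hA _ hmem ?_)
  have e1 := hs ⟨_, (star_mem hmem : star (density A ω - ρ) ∈ A)⟩
  rw [← h, canTrace_eq_tr, canTrace_eq_tr] at e1
  rw [canTrace_eq_tr, sub_mul, mul_sub, tr_sub, e1, sub_self]

/-- `∑ ω(a_i) a_i*` represents `ω` for the trace of `B(H)`; the inverse of `traceDensity A` corrects
it to the canonical trace. -/
theorem exists_density (h1 : (1 : H →L[ℂ] H) ∈ A) (ω : A →ₗ[ℂ] ℂ) :
    ∃ ρ : H →L[ℂ] H, ρ ∈ A ∧ ∀ a : A, canTrace A (ρ * a) = ω a := by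
  obtain ⟨n, a, ha⟩ := exists_frame A
  obtain ⟨q, hq, hqk, hkq⟩ := exists_traceDensity_inv h1
  refine ⟨q * ∑ i, ω ⟨a i, ha.mem i⟩ • star (a i), mul_mem hq.1 (sum_mem fun i _ =>
    A.smul_mem _ (star_mem (ha.mem i) : star (a i) ∈ A)), fun x => ?_⟩
  rw [canTrace_eq_tr, ← mul_assoc, ← mul_assoc, hkq, one_mul, Finset.sum_mul, tr_sum]
  have hx : x = ∑ i, tr (star (a i) * x.1) • (⟨a i, ha.mem i⟩ : A) := by
    apply Subtype.ext
    rw [AddSubmonoidClass.coe_finsetSum]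
    exact (ha.expand x.1 x.2).symm
  conv_rhs => rw [hx, map_sum]
  refine Finset.sum_congr rfl fun i _ => ?_
  rw [map_smul, smul_mul_assoc, tr_smul, smul_eq_mul, mul_comm]

theorem density_mem (h1 : (1 : H →L[ℂ] H) ∈ A) (ω : A →ₗ[ℂ] ℂ) : density A ω ∈ A := by
  rw [density, dif_pos (exists_density h1 ω)]
  exact (exists_density h1 ω).choose_spec.1

theorem density_spec (h1 : (1 : H →L[ℂ] H) ∈ A) (ω : A →ₗ[ℂ] ℂ) {a : H →L[ℂ] H} (ha : a ∈ A) :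
    tr (traceDensity A * (density A ω * a)) = ω ⟨a, ha⟩ := by
  rw [← canTrace_eq_tr, density, dif_pos (exists_density h1 ω)]
  exact (exists_density h1 ω).choose_spec.2 ⟨a, ha⟩

theorem density_unique (h1 : (1 : H →L[ℂ] H) ∈ A) {ω : A →ₗ[ℂ] ℂ} {ρ : H →L[ℂ] H} (hρ : ρ ∈ A)
    (h : ∀ a (ha : a ∈ A), tr (traceDensity A * (ρ * a)) = ω ⟨a, ha⟩) : density A ω = ρ :=
  eq_of_canTrace_mul_eq h1 (density_mem h1 ω) hρ fun a ha => by rw [density_spec h1 ω ha, h a ha]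

/-- Traciality of the canonical trace. -/
theorem canTrace_mul_comm (x : H →L[ℂ] H) {y : H →L[ℂ] H} (hy : y ∈ A) :
    tr (traceDensity A * (x * y)) = tr (traceDensity A * (y * x)) := by
  rw [← mul_assoc, tr_mul_comm, ← mul_assoc, traceDensity_comm hy, mul_assoc]

theorem nonneg_of_forall_eigenvalue {a : H →L[ℂ] H} (ha : IsSelfAdjoint a)
    (h : ∀ (α : ℝ) (v : H), a v = (α : ℂ) • v → v ≠ 0 → 0 ≤ α) : 0 ≤ a := by
  have : a = cfc (fun t : ℝ => max t 0) a := by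
    refine ext_eigenvectors ha fun α v hv => ?_
    by_cases h0 : v = 0
    · simp [h0]
    · rw [cfc_apply_of_eigenvector ha hv, max_eq_left (h α v hv h0), hv]
  rw [this]
  exact cfc_nonneg fun x _ => le_max_right _ _

/-- Polarization against the unit: positivity at `1 + b` with `b = a` and `b = i a` gives the
imaginary and the real part. -/
theorem hermitian_of_positive (h1 : (1 : H →L[ℂ] H) ∈ A) {ω : A →ₗ[ℂ] ℂ}
    (hω : ∀ a : A, 0 ≤ ω (star a * a)) (a : A) : ω (star a) = star (ω a) := by
  let u : A := ⟨1, h1⟩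
  have hu : ∀ b : A, u * b = b ∧ b * u = b := fun b =>
    ⟨Subtype.ext (one_mul _), Subtype.ext (mul_one _)⟩
  have hus : star u = u := Subtype.ext (star_one _)
  have key : ∀ b : A, (ω b).im + (ω (star b)).im = 0 := by
    intro b
    have e1 := (Complex.nonneg_iff.1 (hω (u + b))).2
    have e2 := (Complex.nonneg_iff.1 (hω u)).2
    have e3 := (Complex.nonneg_iff.1 (hω b)).2
    rw [star_add, add_mul, mul_add, mul_add, map_add, map_add, map_add, hus, (hu _).1, (hu _).2,
      (hu _).1] at e1
    rw [hus, (hu _).1] at e2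
    simp only [Complex.add_im] at e1
    linarith
  have k1 := key a
  have k2 := key (Complex.I • a)
  rw [star_smul, map_smul, map_smul, RCLike.star_def, Complex.conj_I] at k2
  simp only [smul_eq_mul, Complex.mul_im, Complex.I_re, Complex.I_im, Complex.neg_re,
    Complex.neg_im] at k2
  refine Complex.ext ?_ ?_
  · rw [RCLike.star_def, Complex.conj_re]; linarith
  · rw [RCLike.star_def, Complex.conj_im]; linarith

theorem density_isSelfAdjoint (h1 : (1 : H →L[ℂ] H) ∈ A) {ω : A →ₗ[ℂ] ℂ}
    (hω : ∀ a : A, 0 ≤ ω (star a * a)) : IsSelfAdjoint (density A ω) := by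
  refine eq_of_canTrace_mul_eq h1 (star_mem (density_mem h1 ω)) (density_mem h1 ω) fun a ha => ?_
  have hs : star a ∈ A := star_mem ha
  have e : ω ⟨a, ha⟩ = star (ω ⟨star a, hs⟩) := by
    rw [← hermitian_of_positive h1 hω]
    exact congrArg ω (Subtype.ext (star_star a).symm)
  rw [density_spec h1 ω ha, e, ← density_spec h1 ω hs, ← tr_star, star_mul, star_mul, star_star,
    (traceDensity_nonneg A).isSelfAdjoint.star_eq, tr_mul_comm _ (traceDensity A),
    canTrace_mul_comm _ ha]

/-- Let `n` be the negative part of `ρ` and test the functional on `g = √n`. Since `ρ g² = -n²`,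
positivity forces the trace of `n²` to vanish, so `n = 0`. -/
theorem density_nonneg (h1 : (1 : H →L[ℂ] H) ∈ A) {ω : A →ₗ[ℂ] ℂ}
    (hω : ∀ a : A, 0 ≤ ω (star a * a)) : 0 ≤ density A ω := by
  have hsa := density_isSelfAdjoint h1 hω
  set ρ := density A ω with hρ
  refine nonneg_of_forall_eigenvalue hsa fun α v hv hv0 => ?_
  set g := cfc (fun t : ℝ => Real.sqrt (max (-t) 0)) ρ with hg
  set n := cfc (fun t : ℝ => max (-t) 0) ρ with hn
  have hgs : star g = g := (cfc_predicate _ ρ : IsSelfAdjoint g)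
  have hns : star n = n := (cfc_predicate _ ρ : IsSelfAdjoint n)
  have hgA : g ∈ A := cfc_mem h1 hsa (density_mem h1 ω) _
  have e : ρ * (g * g) = -(n * n) := by
    refine ext_eigenvectors hsa fun β w hw => ?_
    have c1 := cfc_apply_of_eigenvector hsa hw (fun t : ℝ => Real.sqrt (max (-t) 0))
    have c2 := cfc_apply_of_eigenvector hsa hw (fun t : ℝ => max (-t) 0)
    simp only [op_mul_apply, neg_apply, hg, hn, c1, c2, map_smul, hw, smul_smul]
    rw [← Complex.ofReal_mul, Real.mul_self_sqrt (le_max_right _ _), ← neg_smul]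
    congr 1
    rw [← Complex.ofReal_mul, ← Complex.ofReal_mul, ← Complex.ofReal_neg]
    congr 1
    rcases le_total (-β) 0 with hb | hb
    · simp [max_eq_right hb]
    · simp [max_eq_left hb]
  have h2 := hω ⟨g, hgA⟩
  have h3 : (star (⟨g, hgA⟩ : A) * ⟨g, hgA⟩ : A) = ⟨g * g, mul_mem hgA hgA⟩ :=
    Subtype.ext (by change star g * g = g * g; rw [hgs])
  rw [h3, ← density_spec h1 ω, ← hρ, e, mul_neg, ← neg_one_smul ℂ, tr_smul, neg_one_mul,
    Left.nonneg_neg_iff] at h2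
  have h4 : 0 ≤ tr (traceDensity A * (n * n)) := by
    refine tr_mul_nonneg (traceDensity_nonneg A) ?_
    nth_rewrite 1 [← hns]
    exact star_mul_self_nonneg _
  have h5 : n = 0 := eq_zero_of_canTrace h1 (by rw [hns]; exact le_antisymm h2 h4)
  have h6 := cfc_apply_of_eigenvector hsa hv (fun t : ℝ => max (-t) 0)
  rw [← hn, h5, zero_apply] at h6
  have h7 := (smul_eq_zero.1 h6.symm).resolve_right hv0
  have h8 := Complex.ofReal_eq_zero.1 h7
  have := le_max_left (-α) 0
  rw [h8] at this
  linarith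

end CanonicalTrace

/-! ### Densities of vector states on an algebra and on its commutant. -/

section VectorStates

variable [FiniteDimensional ℂ H] {A : OpAlg H} {ω : (H →L[ℂ] H) →ₗ[ℂ] ℂ} {ψ : H}

theorem restrict_positive (hω : ∀ x, ω x = inner ℂ ψ (x ψ)) (a : A) :
    0 ≤ restrict A ω (star a * a) := by
  change 0 ≤ ω (star a.1 * a.1)
  rw [hω, op_mul_apply, ContinuousLinearMap.star_eq_adjoint, ContinuousLinearMap.adjoint_inner_right]
  rw [inner_self_eq_norm_sq_to_K]
  exact Complex.zero_le_real.2 (sq_nonneg ‖a.1 ψ‖) |>.trans_eq (Complex.ofReal_pow _ _)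

/-- If `m`, `m'` are the sizes of `P A` and `P A'`, then on `P` this reads `(m² / tr P) (m' / tr P)
= m / tr P`, which holds because `m m' = tr P`. -/
theorem sum_star_mul_mul_traceDensity (h1 : (1 : H →L[ℂ] H) ∈ A) {ι : Type*} [Fintype ι]
    {a : ι → H →L[ℂ] H} (ha : IsFrame A a) :
    (∑ i, star (a i) * a i) * traceDensity (commutant A) = traceDensity A := by
  refine ext_minProj (isCommAlg_center A) (one_mem_center h1) fun P hP => ?_
  have hP' : P ∈ minProj (center (commutant A)) := by rwa [center_commutant h1]
  have h2 := ha.adjoint.sum_mul_star_mul h1 hP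
  simp only [star_star] at h2
  rw [mul_assoc, traceDensity_mul hP', mul_smul_comm, h2, traceDensity_mul hP, smul_smul,
    ← tr_proj_re]
  congr 1
  have h3 := cdim_mul_cdim h1 hP
  have h4 := tr_proj_re_pos hP.2.1
  have h5 := cdim_sq A P
  have : cdim (commutant A) P / (tr P.1).re * (Module.finrank ℂ (corner A P) / (tr P.1).re) =
      cdim A P / (tr P.1).re := by
    rw [← h5]
    field_simp
    linear_combination cdim A P * h3
  exact_mod_cast this

/-- The reduced densities of a vector state on an algebra and on its commutant agree on the
vector. -/
theorem density_apply_eq_commutant (h1 : (1 : H →L[ℂ] H) ∈ A)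
    (hω : ∀ x, ω x = inner ℂ ψ (x ψ)) :
    density A (restrict A ω) ψ = density (commutant A) (restrict (commutant A) ω) ψ := by
  obtain ⟨n, a, ha⟩ := exists_frame A
  obtain ⟨q, hq, hqk, hkq⟩ := exists_traceDensity_inv h1
  set Y := InnerProductSpace.rankOne ℂ ψ ψ
  -- With `κ` the trace density of `A`, `Φ` links both densities. Expanding `κ ρ` in the frame has
  -- coefficients `ω(a_i*)`, so `Φ ψ = κ ρ ψ`. On the other hand `κ⁻¹ Φ ∈ A'` is the density of `ω`
  -- on the commutant.
  set Φ := ∑ i, a i * Y * star (a i) with hΦ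
  have hΦm : Φ ∈ commutant A := ha.sum_mem_commutant Y
  set ρ := density A (restrict A ω) with hρ
  have e1 : Φ ψ = traceDensity A (ρ ψ) := by
    have h2 := ha.expand _ (mul_mem (traceDensity_mem A).1 (density_mem h1 (restrict A ω)))
    rw [← op_mul_apply, ← h2, hΦ, sum_apply, sum_apply]
    refine Finset.sum_congr rfl fun i _ => ?_
    rw [op_mul_apply, op_mul_apply, InnerProductSpace.rankOne_apply, map_smul, smul_apply,
      tr_mul_comm, mul_assoc, density_spec h1 _ (star_mem (ha.mem i) : star (a i) ∈ A)]
    exact congrArg (· • a i ψ) (hω _).symm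
  have e2 : density (commutant A) (restrict (commutant A) ω) = q * Φ := by
    refine density_unique (one_mem_commutant A) (mul_mem hq.2 hΦm) fun b hb => ?_
    have hw := sum_star_mul_mul_traceDensity h1 ha
    have hk' : traceDensity (commutant A) ∈ commutant A := (traceDensity_mem (commutant A)).1
    have hkq' : traceDensity (commutant A) * q ∈ commutant A := mul_mem hk' hq.2
    calc tr (traceDensity (commutant A) * (q * Φ * b))
        = ∑ i, tr (Y * b * (star (a i) * a i * (traceDensity (commutant A) * q))) := by
          rw [hΦ, Finset.mul_sum, Finset.sum_mul, Finset.mul_sum, tr_sum]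
          refine Finset.sum_congr rfl fun i _ => ?_
          have c1 := mem_commutant.1 hb _ (star_mem (ha.mem i))
          have c2 := mem_commutant.1 hkq' _ (ha.mem i)
          calc tr (traceDensity (commutant A) * (q * (a i * Y * star (a i)) * b))
              = tr (traceDensity (commutant A) * q * a i * (Y * (star (a i) * b))) := by
                simp only [mul_assoc]
            _ = tr (Y * (star (a i) * b) * (traceDensity (commutant A) * q * a i)) := tr_mul_comm _ _
            _ = _ := by rw [c1, ← c2]; simp only [mul_assoc]
      _ = tr (Y * b) := by
          rw [← tr_sum, ← Finset.mul_sum, ← Finset.sum_mul, ← mul_assoc _ _ q, hw, hkq, mul_one]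
      _ = ω b := by
          rw [hω, tr_mul_comm, ← tr_rankOne]
          congr 1
          ext v
          simp [Y]
  rw [e2, op_mul_apply, e1, ← op_mul_apply, hqk]
  rfl

variable (hω : ∀ x, ω x = inner ℂ ψ (x ψ))

-- The projection `1 - supp ρ` has expectation zero in `ω`, so it annihilates `ψ`.
include hω in
theorem supp_density_apply (h1 : (1 : H →L[ℂ] H) ∈ A) :
    supp (density A (restrict A ω)) ψ = ψ := by
  have hsa := density_isSelfAdjoint h1 (restrict_positive (A := A) hω)
  set ρ := density A (restrict A ω) with hρ
  have hsA : 1 - supp ρ ∈ A := sub_mem h1 (cfc_mem h1 hsa (density_mem h1 _) _)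
  have h2 := density_spec h1 (restrict A ω) hsA
  rw [← hρ, mul_sub, mul_supp hsa, mul_one, sub_self, mul_zero, tr_zero] at h2
  change 0 = ω (1 - supp ρ) at h2
  have h3 : star (1 - supp ρ) * (1 - supp ρ) = 1 - supp ρ := by
    rw [star_sub, star_one, (isSelfAdjoint_supp ρ).star_eq, sub_mul, mul_sub, mul_sub,
      supp_mul_supp hsa]
    simp
  rw [hω, ← h3, op_mul_apply, ContinuousLinearMap.star_eq_adjoint,
    ContinuousLinearMap.adjoint_inner_right] at h2
  have h4 := inner_self_eq_zero.1 h2.symm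
  rw [sub_apply, sub_eq_zero] at h4
  exact h4.symm

-- The projection `s = 1 - supp ρ_N` lies in `N` and has `ω(s) = 0`, so faithfulness of the trace of
-- `M` gives `√ρ_M s = 0`. This is the support condition that keeps the relative entropy finite.
include hω in
theorem density_mul_supp_of_le {M N : OpAlg H} (hNM : N ≤ M) (hN : (1 : H →L[ℂ] H) ∈ N) :
    density M (restrict M ω) * supp (density N (restrict N ω)) = density M (restrict M ω) := by
  have hM := hNM hN
  have hsa := density_isSelfAdjoint hN (restrict_positive (A := N) hω)
  set ρ := density N (restrict N ω) with hρ
  set s := 1 - supp ρ with hs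
  have hsN : s ∈ N := sub_mem hN (cfc_mem hN hsa (density_mem hN _) _)
  have hss : star s = s := by rw [hs, star_sub, star_one, (isSelfAdjoint_supp ρ).star_eq]
  have hs2 : s * s = s := by
    rw [hs, sub_mul, mul_sub, mul_sub, supp_mul_supp hsa]
    simp
  have h2 := density_spec hN (restrict N ω) hsN
  have h0 : ρ * s = 0 := by rw [hs, mul_sub, mul_supp hsa, mul_one, sub_self]
  rw [← hρ, h0, mul_zero, tr_zero] at h2
  have h3 := density_spec hM (restrict M ω) (hNM hsN)
  have h4 : restrict M ω ⟨s, hNM hsN⟩ = 0 := h2.symm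
  rw [h4] at h3
  obtain ⟨r, hr, hrr⟩ := exists_sqrt (density_nonneg hM (restrict_positive (A := M) hω))
  have h5 : r * s = 0 := by
    refine eq_zero_of_canTrace hM ?_
    rw [← h3, star_mul, hr, hss, ← hrr, mul_assoc, ← canTrace_mul_comm _ (hNM hsN)]
    simp only [mul_assoc, hs2]
  have h6 : density M (restrict M ω) * s = 0 := by rw [← hrr, mul_assoc, h5, mul_zero]
  rw [hs, mul_sub, mul_one, sub_eq_zero] at h6
  exact h6.symm

end VectorStates

/-! ### The blocks of the relative commutant are factors; their canonical trace. -/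

section Blocks

theorem mem_block {M N : OpAlg H} {Q P : Proj H} {x : H →L[ℂ] H} :
    x ∈ block M N Q P ↔ ((x ∈ M ∧ x ∈ commutant N) ∧ Q.1 * x = x ∧ x * Q.1 = x) ∧
      P.1 * x = x ∧ x * P.1 = x := Iff.rfl

variable [FiniteDimensional ℂ H]

theorem IsFrame.sum_tr_mul_tr_star {ι : Type*} [Fintype ι] {A : OpAlg H} {a : ι → H →L[ℂ] H}
    (ha : IsFrame A a) {P : Proj H} (hP : P.1 ∈ A) :
    ∑ i, tr (a i * P.1) * tr (star (a i * P.1)) = tr P.1 := by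
  have := ha.parseval hP P.1
  rw [P.mul_self] at this
  rw [← this]
  refine Finset.sum_congr rfl fun i _ => ?_
  rw [star_mul, P.star_eq, tr_mul_comm (a i), tr_mul_comm P.1 (star (a i)), mul_comm]

variable {M N : OpAlg H} (hNM : N ≤ M) (hN : (1 : H →L[ℂ] H) ∈ N) {P Q : Proj H}
  (hP : P ∈ minProj (center M)) (hQ : Q ∈ minProj (center N))

include hNM hP hQ in
theorem minProj_commute : Q.1 * P.1 = P.1 * Q.1 := (mem_center.1 hP.1).2 _ (hNM hQ.1.1)

/-- The product of minimal central projections of `N` and `M`. -/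
def blockUnit : Proj H := ⟨Q.1 * P.1, isStarProjection_mul Q.2 P.2 (minProj_commute hNM hP hQ)⟩

include hNM hP hQ in
theorem star_blockUnit : star (Q.1 * P.1) = Q.1 * P.1 := (blockUnit hNM hP hQ).star_eq

include hNM hP hQ in
theorem blockUnit_mem : Q.1 * P.1 ∈ block M N Q P := by
  have hc := minProj_commute hNM hP hQ
  refine mem_block.2 ⟨⟨⟨mul_mem (hNM hQ.1.1) hP.1.1, mul_mem hQ.1.2 (commutant_anti hNM hP.1.2)⟩,
    ?_, ?_⟩, ?_, ?_⟩
  · rw [← mul_assoc, Q.mul_self]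
  · rw [mul_assoc, ← hc, ← mul_assoc, Q.mul_self]
  · rw [← mul_assoc, ← hc, mul_assoc, P.mul_self]
  · rw [mul_assoc, P.mul_self]

include hNM hP hQ in
theorem blockUnit_mul {x : H →L[ℂ] H} (hx : x ∈ block M N Q P) : Q.1 * P.1 * x = x := by
  obtain ⟨⟨-, h1, -⟩, h2, -⟩ := mem_block.1 hx
  rw [mul_assoc, h2, h1]

include hNM hP hQ in
theorem mul_blockUnit {x : H →L[ℂ] H} (hx : x ∈ block M N Q P) : x * (Q.1 * P.1) = x := by
  obtain ⟨⟨-, -, h1⟩, -, h2⟩ := mem_block.1 hx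
  rw [← mul_assoc, h1, h2]

-- Uniqueness of the trace on a factor, used twice: `a ↦ tr (a b Q P)` is tracial on `N`, and `b ↦
-- tr (b Q P)` is tracial on `M'`.
include hNM hN hP hQ in
theorem tr_mul_mul_blockUnit {a b : H →L[ℂ] H} (ha : a ∈ N) (hb : b ∈ commutant M) :
    tr (a * b * (Q.1 * P.1)) =
      tr (Q.1 * P.1) / (tr Q.1 * tr P.1) * (tr (a * Q.1) * tr (b * P.1)) := by
  have hc := minProj_commute hNM hP hQ
  have he := (mem_block.1 (blockUnit_mem hNM hP hQ)).1
  have hM := hNM hN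
  have hbN := commutant_anti hNM hb
  have h1 := tracial_eq hN hQ (f := trLin ∘ₗ LinearMap.mulRight ℂ (b * (Q.1 * P.1)))
    (fun x hx y hy => by
      change tr (x * y * (b * (Q.1 * P.1))) = tr (y * x * (b * (Q.1 * P.1)))
      rw [mul_assoc, tr_mul_comm, mul_assoc, ← mem_commutant.1 (mul_mem hbN he.1.2) x hx, mul_assoc]) ha
  have h2 := tracial_eq (one_mem_commutant M) (P := P) (by rwa [center_commutant hM])
    (f := trLin ∘ₗ LinearMap.mulRight ℂ (Q.1 * P.1))
    (fun x hx y hy => by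
      change tr (x * y * (Q.1 * P.1)) = tr (y * x * (Q.1 * P.1))
      rw [mul_assoc, tr_mul_comm, mul_assoc, mem_commutant.1 hx _ he.1.1, mul_assoc]) hb
  change tr (a * Q.1 * (b * (Q.1 * P.1))) * tr Q.1 = tr (Q.1 * (b * (Q.1 * P.1))) * tr (a * Q.1) at h1
  change tr (b * P.1 * (Q.1 * P.1)) * tr P.1 = tr (P.1 * (Q.1 * P.1)) * tr (b * P.1) at h2
  have hQb : Q.1 * b = b * Q.1 := mem_commutant.1 hb _ (hNM hQ.1.1)
  have e1 : a * Q.1 * (b * (Q.1 * P.1)) = a * b * (Q.1 * P.1) := by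
    rw [mul_assoc, ← mul_assoc Q.1 b, hQb, mul_assoc b, he.2.1, mul_assoc]
  have e2 : Q.1 * (b * (Q.1 * P.1)) = b * (Q.1 * P.1) := by
    rw [← mul_assoc, hQb, mul_assoc, he.2.1]
  have e3 : b * P.1 * (Q.1 * P.1) = b * (Q.1 * P.1) := by
    rw [mul_assoc, (mem_block.1 (blockUnit_mem hNM hP hQ)).2.1]
  rw [e1, e2] at h1
  rw [e3, (mem_block.1 (blockUnit_mem hNM hP hQ)).2.1] at h2
  have hq := (tr_proj_pos hQ.2.1).ne'
  have hp := (tr_proj_pos hP.2.1).ne'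
  field_simp
  linear_combination tr P.1 * h1 + tr (a * Q.1) * h2

section BlockFrame

variable {ι κ : Type*} [Fintype ι] [Fintype κ] {a : ι → H →L[ℂ] H} {b : κ → H →L[ℂ] H}
  (ha : IsFrame N a) (hb : IsFrame (commutant M) b)

include hNM ha hb in
theorem frame_commute (i : ι) (j : κ) : a i * b j = b j * a i :=
  mem_commutant.1 (commutant_anti hNM (hb.mem j)) _ (ha.mem i)

include hNM ha hb in
theorem frame_commute_star (i : ι) (j : κ) : star (b j) * star (a i) = star (a i) * star (b j) := by
  rw [← star_mul, frame_commute hNM ha hb, star_mul]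

-- The products `a_i b_j` average over the commuting algebras `N` and `M'`. Taking the inner sum
-- over either index shows that the result commutes with both of them.
include hNM hN ha hb in
theorem sum_frame_mem (Y : H →L[ℂ] H) :
    ∑ s : ι × κ, a s.1 * b s.2 * Y * star (a s.1 * b s.2) ∈ M ⊓ commutant N := by
  have hc := frame_commute hNM ha hb
  constructor
  · have h := (hb.sum_mem_commutant (∑ i, a i * Y * star (a i)))
    rw [commutant_commutant (hNM hN)] at h
    have e : ∑ s : ι × κ, a s.1 * b s.2 * Y * star (a s.1 * b s.2) =
        ∑ j, b j * (∑ i, a i * Y * star (a i)) * star (b j) := ?_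
    · exact e ▸ h
    rw [Fintype.sum_prod_type_right]
    refine Finset.sum_congr rfl fun j _ => ?_
    rw [Finset.mul_sum, Finset.sum_mul]
    refine Finset.sum_congr rfl fun i _ => ?_
    rw [hc i j, star_mul]
    simp only [mul_assoc]
  · have h := (ha.sum_mem_commutant (∑ j, b j * Y * star (b j)))
    have e : ∑ s : ι × κ, a s.1 * b s.2 * Y * star (a s.1 * b s.2) =
        ∑ i, a i * (∑ j, b j * Y * star (b j)) * star (a i) := ?_
    · exact e ▸ h
    rw [Fintype.sum_prod_type]
    refine Finset.sum_congr rfl fun i _ => ?_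
    rw [Finset.mul_sum, Finset.sum_mul]
    refine Finset.sum_congr rfl fun j _ => ?_
    rw [star_mul]
    simp only [mul_assoc]

include hNM hP hQ ha hb in
theorem frame_mul_blockUnit (s : ι × κ) :
    a s.1 * b s.2 * (Q.1 * P.1) = Q.1 * P.1 * (a s.1 * b s.2) := by
  have he := (mem_block.1 (blockUnit_mem hNM hP hQ)).1.1
  rw [mul_assoc, ← mem_commutant.1 (hb.mem s.2) _ he.1, ← mul_assoc,
    mem_commutant.1 he.2 _ (ha.mem s.1), mul_assoc]

include hNM hN hP hQ ha hb in
theorem sum_blockFrame_mem (X : H →L[ℂ] H) :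
    ∑ s : ι × κ, a s.1 * b s.2 * (Q.1 * P.1) * X * star (a s.1 * b s.2 * (Q.1 * P.1)) ∈
      block M N Q P := by
  have he := mem_block.1 (blockUnit_mem hNM hP hQ)
  have hes := star_blockUnit hNM hP hQ
  have hcomm := frame_mul_blockUnit hNM hP hQ ha hb
  have hmem := sum_frame_mem hNM hN ha hb (Q.1 * P.1 * X * (Q.1 * P.1))
  have e : ∀ s : ι × κ, a s.1 * b s.2 * (Q.1 * P.1) * X * star (a s.1 * b s.2 * (Q.1 * P.1)) =
      a s.1 * b s.2 * (Q.1 * P.1 * X * (Q.1 * P.1)) * star (a s.1 * b s.2) := fun s => by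
    rw [star_mul _ (Q.1 * P.1), hes]
    simp only [mul_assoc]
  refine mem_block.2 ⟨⟨?_, ?_, ?_⟩, ?_, ?_⟩
  · rwa [Finset.sum_congr rfl fun s _ => e s]
  · rw [Finset.mul_sum]
    refine Finset.sum_congr rfl fun s _ => ?_
    rw [hcomm, ← mul_assoc, ← mul_assoc, ← mul_assoc, he.1.2.1]
  · rw [Finset.sum_mul]
    refine Finset.sum_congr rfl fun s _ => ?_
    rw [hcomm, star_mul (Q.1 * P.1), hes, mul_assoc, mul_assoc (star _), he.1.2.2]
  · rw [Finset.mul_sum]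
    refine Finset.sum_congr rfl fun s _ => ?_
    rw [hcomm, ← mul_assoc, ← mul_assoc, ← mul_assoc, he.2.1]
  · rw [Finset.sum_mul]
    refine Finset.sum_congr rfl fun s _ => ?_
    rw [hcomm, star_mul (Q.1 * P.1), hes, mul_assoc, mul_assoc (star _), he.2.2]

-- Elements of the block commute with `N` and `M'` and can be pulled out of the average. With `a' =
-- b' = 1` this is the scalar needed for the dimension count; general `a'`, `b'` serve to show that
-- the center is trivial.
include hNM hN hP hQ ha hb in
theorem sum_blockFrame_mul {a' b' : H →L[ℂ] H} {c c' : ℂ} (ha' : a' ∈ N) (hb' : b' ∈ commutant M)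
    (hc : (∑ i, a i * a' * star (a i)) * Q.1 = c • Q.1)
    (hc' : (∑ j, b j * b' * star (b j)) * P.1 = c' • P.1)
    {x : H →L[ℂ] H} (hx : x ∈ block M N Q P) :
    ∑ s : ι × κ, a s.1 * b s.2 * (Q.1 * P.1) * (a' * b' * x) *
      star (a s.1 * b s.2 * (Q.1 * P.1)) = (c * c') • x := by
  have hes := star_blockUnit hNM hP hQ
  have he := mem_block.1 (blockUnit_mem hNM hP hQ)
  have hx' := mem_block.1 hx
  have e : ∀ s : ι × κ, a s.1 * b s.2 * (Q.1 * P.1) * (a' * b' * x) *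
      star (a s.1 * b s.2 * (Q.1 * P.1)) =
      (a s.1 * a' * star (a s.1)) * ((b s.2 * b' * star (b s.2)) * x) := fun s => by
    have c1 : b s.2 * a' = a' * b s.2 :=
      (mem_commutant.1 (commutant_anti hNM (hb.mem s.2)) _ ha').symm
    have c2 : x * star (a s.1) = star (a s.1) * x :=
      (mem_commutant.1 hx'.1.1.2 _ (star_mem (ha.mem s.1))).symm
    have c3 : x * star (b s.2) = star (b s.2) * x :=
      mem_commutant.1 (star_mem (hb.mem s.2) : star (b s.2) ∈ commutant M) _ hx'.1.1.1
    have c4 : b' * star (a s.1) = star (a s.1) * b' :=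
      (mem_commutant.1 (commutant_anti hNM hb') _ (star_mem (ha.mem s.1))).symm
    have c5 : b s.2 * star (a s.1) = star (a s.1) * b s.2 :=
      (mem_commutant.1 (commutant_anti hNM (hb.mem s.2)) _ (star_mem (ha.mem s.1))).symm
    have c6 : Q.1 * P.1 * (a' * b') = a' * b' * (Q.1 * P.1) := by
      rw [mul_assoc a', ← mem_commutant.1 hb' _ he.1.1.1, ← mul_assoc, ← mul_assoc,
        mem_commutant.1 he.1.1.2 _ ha']
    calc a s.1 * b s.2 * (Q.1 * P.1) * (a' * b' * x) * star (a s.1 * b s.2 * (Q.1 * P.1))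
        = a s.1 * b s.2 * (Q.1 * P.1 * (a' * b')) * (x * (Q.1 * P.1)) *
            (star (b s.2) * star (a s.1)) := by
          rw [star_mul, hes, star_mul]; simp only [mul_assoc]
      _ = a s.1 * (b s.2 * a') * b' * (x * star (b s.2)) * star (a s.1) := by
          rw [mul_blockUnit hNM hP hQ hx, c6, mul_assoc _ (a' * b' * (Q.1 * P.1)),
            mul_assoc (a' * b'), blockUnit_mul hNM hP hQ hx]
          simp only [mul_assoc]
      _ = a s.1 * a' * b s.2 * b' * star (b s.2) * (x * star (a s.1)) := by
          rw [c1, c3]; simp only [mul_assoc]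
      _ = a s.1 * a' * (b s.2 * (b' * (star (b s.2) * star (a s.1)))) * x := by
          rw [c2]; simp only [mul_assoc]
      _ = a s.1 * a' * (b s.2 * ((b' * star (a s.1)) * star (b s.2))) * x := by
          rw [frame_commute_star hNM ha hb]; simp only [mul_assoc]
      _ = a s.1 * a' * ((b s.2 * star (a s.1)) * (b' * star (b s.2))) * x := by
          rw [c4]; simp only [mul_assoc]
      _ = _ := by rw [c5]; simp only [mul_assoc]
  rw [Finset.sum_congr rfl fun s _ => e s, Fintype.sum_prod_type]
  simp only [← Finset.mul_sum, ← Finset.sum_mul]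
  nth_rewrite 1 [← hx'.2.1]
  rw [← mul_assoc _ P.1, hc', smul_mul_assoc, hx'.2.1, mul_smul_comm]
  nth_rewrite 1 [← hx'.1.2.1]
  rw [← mul_assoc _ Q.1, hc, smul_mul_assoc, hx'.1.2.1, smul_smul, mul_comm]

end BlockFrame

-- The trace comparison of `finrank_corner_mul` again, now for the average over `N` and `M'` cut
-- down by `Q P`. In terms of matrix sizes it says `n_k m'_j μ_{kj} = tr (Q P)`.
include hNM hN hP hQ in
theorem finrank_block :
    (Module.finrank ℂ (corner N Q) : ℂ) * Module.finrank ℂ (corner (commutant M) P) *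
      Module.finrank ℂ (block M N Q P) = tr (Q.1 * P.1) ^ 2 := by
  obtain ⟨_, a, ha⟩ := exists_frame N
  obtain ⟨_, b, hb⟩ := exists_frame (commutant M)
  have hM := hNM hN
  have hP' : P ∈ minProj (center (commutant M)) := by rwa [center_commutant hM]
  have hc := ha.sum_mul_star_mul hN hQ
  have hc' := hb.sum_mul_star_mul (one_mem_commutant M) hP'
  have key := mul_finrank_eq_sum_tr (fun X => sum_blockFrame_mem hNM hN hP hQ ha hb X)
    (fun x hx => by
      have h := sum_blockFrame_mul hNM hN hP hQ ha hb hN (one_mem_commutant M)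
        (by simpa only [mul_one] using hc) (by simpa only [mul_one] using hc') hx
      simpa only [one_mul] using h)
  have hq := (tr_proj_pos hQ.2.1).ne'
  have hp := (tr_proj_pos hP.2.1).ne'
  have e : ∀ s : Fin _ × Fin _, tr (a s.1 * b s.2 * (Q.1 * P.1)) *
      tr (star (a s.1 * b s.2 * (Q.1 * P.1))) = (tr (Q.1 * P.1) / (tr Q.1 * tr P.1)) ^ 2 *
      ((tr (a s.1 * Q.1) * tr (star (a s.1 * Q.1))) *
        (tr (b s.2 * P.1) * tr (star (b s.2 * P.1)))) := fun s => by
    have hst : star (tr (Q.1 * P.1) / (tr Q.1 * tr P.1)) = tr (Q.1 * P.1) / (tr Q.1 * tr P.1) := by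
      rw [star_div₀, star_mul', ← tr_star, ← tr_star, ← tr_star, P.star_eq, Q.star_eq,
        star_blockUnit hNM hP hQ]
    rw [tr_star, tr_star, tr_star, tr_mul_mul_blockUnit hNM hN hP hQ (ha.mem _) (hb.mem _), star_mul',
      hst, star_mul']
    ring
  rw [Finset.sum_congr rfl fun s _ => e s, ← Finset.mul_sum, Fintype.sum_prod_type] at key
  dsimp only at key
  rw [← Finset.sum_mul_sum, ha.sum_tr_mul_tr_star hQ.1.1, hb.sum_tr_mul_tr_star hP'.1.1] at key
  field_simp at key
  rw [← key]

-- A central `x` commutes with all averages `∑ v_s T v_s*`; contraction in `T` gives `r x = ∑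
-- tr(v_s* x) v_s`. Averaging once more multiplies `x` by `C` and sends each `v_s` to a multiple of
-- `Q P`, so `x` is itself such a multiple.
include hNM hN hP hQ in
theorem exists_eq_smul_of_mem_center_block (h0 : Q.1 * P.1 ≠ 0) {x : H →L[ℂ] H}
    (hx : x ∈ center (block M N Q P)) : ∃ c : ℂ, x = c • (Q.1 * P.1) := by
  obtain ⟨_, a, ha⟩ := exists_frame N
  obtain ⟨_, b, hb⟩ := exists_frame (commutant M)
  have hM := hNM hN
  have hP' : P ∈ minProj (center (commutant M)) := by rwa [center_commutant hM]
  have hq := (tr_proj_pos hQ.2.1).ne'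
  have hp := (tr_proj_pos hP.2.1).ne'
  have ht : tr (Q.1 * P.1) ≠ 0 := (tr_proj_pos (p := blockUnit hNM hP hQ) h0).ne'
  set v : Fin _ × Fin _ → H →L[ℂ] H := fun s => a s.1 * b s.2 * (Q.1 * P.1) with hv
  have heB := blockUnit_mem hNM hP hQ
  set r := tr (Q.1 * P.1) / (tr Q.1 * tr P.1) with hr
  have hr0 : r ≠ 0 := div_ne_zero ht (mul_ne_zero hq hp)
  have hst : star r = r := by
    rw [hr, star_div₀, star_mul', ← tr_star, ← tr_star, ← tr_star, P.star_eq, Q.star_eq,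
      star_blockUnit hNM hP hQ]
  have h1 := sum_tr_smul_eq (x := fun s => x * v s) (y := fun s => star (v s)) (x' := v)
    (y' := fun s => star (v s) * x) (fun T => by
      have h := (mem_center.1 hx).2 _ (sum_blockFrame_mem hNM hN hP hQ ha hb T)
      rw [Finset.sum_mul, Finset.mul_sum] at h
      simp only [mul_assoc] at h
      simp only [hv, mul_assoc]
      exact h.symm)
  have h2 : ∑ s, tr (star (v s)) • v s = r • (Q.1 * P.1) := by
    have e : ∀ s, tr (star (v s)) • v s = r • ((tr (star (a s.1) * Q.1) • a s.1) *
        ((tr (star (b s.2) * P.1) • b s.2) * (Q.1 * P.1))) := fun s => by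
      have e1 : tr (star (v s)) = r * (tr (star (a s.1) * Q.1) * tr (star (b s.2) * P.1)) := by
        rw [tr_star, hv]
        dsimp only
        rw [tr_mul_mul_blockUnit hNM hN hP hQ (ha.mem _) (hb.mem _), star_mul', hst, star_mul',
          ← tr_star, ← tr_star, star_mul, star_mul, P.star_eq, Q.star_eq, tr_mul_comm Q.1,
          tr_mul_comm P.1]
      rw [e1, smul_mul_assoc, smul_mul_assoc, mul_smul_comm, smul_smul, smul_smul, ← mul_assoc,
        ← mul_assoc]
    rw [Finset.sum_congr rfl fun s _ => e s, ← Finset.smul_sum, Fintype.sum_prod_type]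
    simp only [← Finset.mul_sum, ← Finset.sum_mul]
    rw [ha.expand _ hQ.1.1, hb.expand _ hP'.1.1, (mem_block.1 heB).2.1, (mem_block.1 heB).1.2.1]
  simp only [← mul_smul_comm] at h1
  rw [← Finset.mul_sum, h2, mul_smul_comm, mul_blockUnit hNM hP hQ hx.1] at h1
  have hc := ha.sum_mul_star_mul hN hQ
  have hc' := hb.sum_mul_star_mul (one_mem_commutant M) hP'
  have h3 := sum_blockFrame_mul hNM hN hP hQ ha hb hN (one_mem_commutant M)
    (by simpa only [mul_one] using hc) (by simpa only [mul_one] using hc') hx.1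
  simp only [one_mul] at h3
  have hd : ∀ s, ∃ d : ℂ, ∑ s' : Fin _ × Fin _, v s' * v s * star (v s') = d • (Q.1 * P.1) := by
    intro s
    obtain ⟨d, hd⟩ := exists_mul_minProj_eq_smul (isCommAlg_center N) (one_mem_center hN) hQ
      (ha.sum_mul_mem_center (ha.mem s.1))
    obtain ⟨d', hd'⟩ := exists_mul_minProj_eq_smul (isCommAlg_center _)
      (one_mem_center (one_mem_commutant M)) hP' (hb.sum_mul_mem_center (hb.mem s.2))
    exact ⟨d * d', sum_blockFrame_mul hNM hN hP hQ ha hb (ha.mem _) (hb.mem _) hd hd' heB⟩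
  choose d hd using hd
  set C := (Module.finrank ℂ (corner N Q) / tr Q.1 : ℂ) *
    (Module.finrank ℂ (corner (commutant M) P) / tr P.1) with hC
  have hC0 : C ≠ 0 := mul_ne_zero
    (div_ne_zero (Nat.cast_ne_zero.2 (finrank_corner_pos hQ).ne') hq)
    (div_ne_zero (Nat.cast_ne_zero.2 (finrank_corner_pos hP').ne') hp)
  have h4 : (C * r) • x = (∑ s, tr (star (v s) * x) * d s) • (Q.1 * P.1) := by
    calc (C * r) • x = r • ∑ s', v s' * x * star (v s') := by
          rw [mul_comm, ← smul_smul, ← h3]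
      _ = ∑ s', v s' * (r • x) * star (v s') := by
          rw [Finset.smul_sum]
          simp only [mul_smul_comm, smul_mul_assoc]
      _ = ∑ s', ∑ s, tr (star (v s) * x) • (v s' * v s * star (v s')) := by
          rw [h1]
          simp only [Finset.mul_sum, Finset.sum_mul, mul_smul_comm, smul_mul_assoc]
      _ = _ := by
          rw [Finset.sum_comm, Finset.sum_smul]
          simp only [← Finset.smul_sum, hd, smul_smul]
  refine ⟨(C * r)⁻¹ * ∑ s, tr (star (v s) * x) * d s, ?_⟩
  rw [← smul_smul, ← h4, smul_smul, inv_mul_cancel₀ (mul_ne_zero hC0 hr0), one_smul]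

include hN in
theorem blockUnit_mem_minProj (h0 : Q.1 * P.1 ≠ 0) :
    blockUnit hNM hP hQ ∈ minProj (center (block M N Q P)) := by
  refine ⟨mem_center.2 ⟨blockUnit_mem hNM hP hQ, fun x hx => ?_⟩, h0, fun q hq _ => ?_⟩
  · exact (mul_blockUnit hNM hP hQ hx).trans (blockUnit_mul hNM hP hQ hx).symm
  · obtain ⟨c, hc⟩ := exists_eq_smul_of_mem_center_block hNM hN hP hQ h0 hq
    have h2 := q.mul_self
    have h3 : Q.1 * P.1 * (Q.1 * P.1) = Q.1 * P.1 := (blockUnit hNM hP hQ).mul_self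
    rw [hc, smul_mul_assoc, mul_smul_comm, h3, smul_smul, ← sub_eq_zero, ← sub_smul, smul_eq_zero] at h2
    have h4 : c * (c - 1) = 0 := by linear_combination h2.resolve_right h0
    rcases mul_eq_zero.1 h4 with h | h
    · left; rw [hc, h, zero_smul]
    · right
      refine Subtype.ext ?_
      rw [hc, sub_eq_zero.1 h, one_smul]
      rfl

include hNM hN hP hQ in
/-- The canonical trace of a block. -/
theorem canTrace_block (h0 : Q.1 * P.1 ≠ 0) {x : H →L[ℂ] H} (hx : x ∈ block M N Q P) :
    canTrace (block M N Q P) x = tr x / (cdim N Q * cdim (commutant M) P : ℝ) := by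
  have hmin := blockUnit_mem_minProj hNM hN hP hQ h0
  have hcor : corner (block M N Q P) (blockUnit hNM hP hQ) = block M N Q P := by
    ext y
    exact ⟨fun h => h.1, fun h => ⟨h, blockUnit_mul hNM hP hQ h, mul_blockUnit hNM hP hQ h⟩⟩
  have hP' : P ∈ minProj (center (commutant M)) := by rwa [center_commutant (hNM hN)]
  have ht : 0 < (tr (Q.1 * P.1)).re := tr_proj_re_pos (P := blockUnit hNM hP hQ) h0
  have hfin := finrank_block hNM hN hP hQ
  have hre : (((tr (Q.1 * P.1)).re : ℝ) : ℂ) = tr (Q.1 * P.1) := tr_proj_re (blockUnit hNM hP hQ)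
  rw [← hre] at hfin
  have hfin' : (Module.finrank ℂ (corner N Q) : ℝ) * Module.finrank ℂ (corner (commutant M) P) *
      Module.finrank ℂ (block M N Q P) = (tr (Q.1 * P.1)).re ^ 2 := by exact_mod_cast hfin
  have hd : cdim (block M N Q P) (blockUnit hNM hP hQ) * (cdim N Q * cdim (commutant M) P) =
      (tr (Q.1 * P.1)).re := by
    rw [cdim, hcor, cdim, cdim, ← Real.sqrt_mul (Nat.cast_nonneg _),
      ← Real.sqrt_mul (Nat.cast_nonneg _), mul_comm, hfin', Real.sqrt_sq ht.le]
  have hpos : 0 < cdim N Q * cdim (commutant M) P := mul_pos (cdim_pos hQ) (cdim_pos hP')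
  rw [canTrace_eq_tr]
  nth_rewrite 1 [← blockUnit_mul hNM hP hQ hx]
  rw [← mul_assoc]
  have h2 := traceDensity_mul hmin
  change traceDensity _ * (Q.1 * P.1) = _ • (Q.1 * P.1) at h2
  rw [h2, smul_mul_assoc, blockUnit_mul hNM hP hQ hx, tr_smul]
  have h3 : cdim (block M N Q P) (blockUnit hNM hP hQ) / (tr (blockUnit hNM hP hQ).1).re =
      (cdim N Q * cdim (commutant M) P)⁻¹ := by
    change _ / (tr (Q.1 * P.1)).re = _
    rw [← hd]
    have : cdim (block M N Q P) (blockUnit hNM hP hQ) ≠ 0 := by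
      intro h
      rw [h, zero_mul] at hd
      exact ht.ne hd
    field_simp
  rw [h3, Complex.ofReal_inv, div_eq_inv_mul]

include hNM hN hP hQ in
theorem canTrace_block_faithful (h0 : Q.1 * P.1 ≠ 0) :
    ∀ x ∈ block M N Q P, canTrace (block M N Q P) (x * star x) = 0 → x = 0 := by
  intro x hx h
  have hP' : P ∈ minProj (center (commutant M)) := by rwa [center_commutant (hNM hN)]
  have hpos : 0 < cdim N Q * cdim (commutant M) P := mul_pos (cdim_pos hQ) (cdim_pos hP')
  rw [canTrace_block hNM hN hP hQ h0 (mul_mem hx (star_mem hx : star x ∈ block M N Q P))] at h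
  have h2 := (div_eq_zero_iff.1 h).resolve_right (Complex.ofReal_ne_zero.2 hpos.ne')
  rw [← star_eq_zero]
  exact eq_zero_of_tr_star_mul_self (by rwa [star_star])

end Blocks

/-! ### The density of a conditional expectation. -/

section RadonNikodym

/-- The canonical trace as a functional on the algebra. -/
def traceFunctional (A : OpAlg H) : A →ₗ[ℂ] ℂ where
  toFun a := tr (traceDensity A * a.1)
  map_add' a b := by
    change tr (traceDensity A * (a.1 + b.1)) = _
    rw [mul_add, tr_add]
  map_smul' c a := by
    change tr (traceDensity A * (c • a.1)) = _
    rw [mul_smul_comm, tr_smul]; rfl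

variable {M N : OpAlg H}

/-- The density of `Tr_N ∘ ε` with respect to `Tr_M`. -/
def CondExp.rnDensity (ε : CondExp M N) : H →L[ℂ] H :=
  density M (traceFunctional N ∘ₗ ε.toLin)

variable [FiniteDimensional ℂ H] (hNM : N ≤ M) (hN : (1 : H →L[ℂ] H) ∈ N) (ε : CondExp M N)

include hNM hN

theorem CondExp.rnDensity_mem : ε.rnDensity ∈ M := density_mem (hNM hN) _

theorem CondExp.rnDensity_spec {m : H →L[ℂ] H} (hm : m ∈ M) :
    tr (traceDensity M * (ε.rnDensity * m)) = tr (traceDensity N * (ε.toLin ⟨m, hm⟩).1) :=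
  density_spec (hNM hN) _ hm

omit hNM in
theorem CondExp.map_mul_left {n m : H →L[ℂ] H} (hn : n ∈ N) (hm : m ∈ M) (hnm : n * m ∈ M) :
    (ε.toLin ⟨n * m, hnm⟩ : H →L[ℂ] H) = n * ε.toLin ⟨m, hm⟩ := by
  have := ε.bimodule ⟨m, hm⟩ ⟨n * m, hnm⟩ ⟨n, hn⟩ ⟨1, hN⟩ (mul_one _).symm
  rw [this]
  exact mul_one _

omit hNM in
theorem CondExp.map_mul_right {n m : H →L[ℂ] H} (hn : n ∈ N) (hm : m ∈ M) (hmn : m * n ∈ M) :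
    (ε.toLin ⟨m * n, hmn⟩ : H →L[ℂ] H) = ε.toLin ⟨m, hm⟩ * n := by
  have := ε.bimodule ⟨m, hm⟩ ⟨m * n, hmn⟩ ⟨1, hN⟩ ⟨n, hn⟩ (by rw [one_mul])
  rw [this]
  exact congrArg (· * n) (one_mul _)

theorem CondExp.rnDensity_spec_mul {m n : H →L[ℂ] H} (hm : m ∈ M) (hn : n ∈ N) :
    tr (traceDensity M * (ε.rnDensity * (m * n))) =
      tr (traceDensity N * ((ε.toLin ⟨m, hm⟩).1 * n)) := by
  rw [ε.rnDensity_spec hNM hN (mul_mem hm (hNM hn)), ε.map_mul_right hN hn hm]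

/-- For `n ∈ N`: `Tr_M(n h m) = Tr_N(ε(m) n) = Tr_N(n ε(m)) = Tr_M(h n m)`. -/
theorem CondExp.rnDensity_mem_commutant : ε.rnDensity ∈ commutant N := by
  refine mem_commutant.2 fun n hn => ?_
  have hh := ε.rnDensity_mem hNM hN
  refine eq_of_canTrace_mul_eq (hNM hN) (mul_mem (hNM hn) hh) (mul_mem hh (hNM hn)) fun m hm => ?_
  have hnm := mul_mem (hNM hn) hm
  rw [mul_assoc, ← canTrace_mul_comm _ (hNM hn), mul_assoc, ε.rnDensity_spec_mul hNM hN hm hn,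
    mul_assoc, ε.rnDensity_spec hNM hN hnm, ε.map_mul_left hN hn hm, canTrace_mul_comm _ hn]

theorem CondExp.rnDensity_nonneg : 0 ≤ ε.rnDensity := by
  refine density_nonneg (hNM hN) fun a => ?_
  refine tr_mul_nonneg (traceDensity_nonneg N) ?_
  rw [ContinuousLinearMap.nonneg_iff_isPositive]
  refine ε.pos _ ?_
  rw [← ContinuousLinearMap.nonneg_iff_isPositive]
  exact star_mul_self_nonneg a.1

/-- A conditional expectation is determined by its density. -/
theorem CondExp.eq_of_rnDensity_eq {ε₁ ε₂ : CondExp M N} (h : ε₁.rnDensity = ε₂.rnDensity) :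
    ε₁ = ε₂ := by
  refine CondExp.ext (LinearMap.ext fun m => Subtype.ext ?_)
  refine eq_of_canTrace_mul_eq hN (ε₁.toLin m).2 (ε₂.toLin m).2 fun n hn => ?_
  rw [← ε₁.rnDensity_spec_mul hNM hN m.2 hn, ← ε₂.rnDensity_spec_mul hNM hN m.2 hn, h]

end RadonNikodym

/-! ### Conditional expectations built from a density. -/

section OfDensity

variable [FiniteDimensional ℂ H] {M N : OpAlg H}

/-- The functional `b ↦ Tr_M (h x b)` on `N`. -/
def weightedFunctional (M N : OpAlg H) (h x : H →L[ℂ] H) : N →ₗ[ℂ] ℂ where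
  toFun b := tr (traceDensity M * (h * (x * b.1)))
  map_add' a b := by
    change tr (traceDensity M * (h * (x * (a.1 + b.1)))) = _
    rw [mul_add, mul_add, mul_add, tr_add]
  map_smul' c a := by
    change tr (traceDensity M * (h * (x * (c • a.1)))) = _
    rw [mul_smul_comm, mul_smul_comm, mul_smul_comm, tr_smul]; rfl

/-- The conditional expectation `M → N` with density `h`. -/
def CondExp.ofDensity (hNM : N ≤ M) (hN : (1 : H →L[ℂ] H) ∈ N) {h : H →L[ℂ] H} (hM : h ∈ M)
    (hN' : h ∈ commutant N) (hpos : 0 ≤ h)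
    (hone : ∀ b ∈ N, tr (traceDensity M * (h * b)) = tr (traceDensity N * b)) : CondExp M N where
  toLin :=
    { toFun := fun x => ⟨density N (weightedFunctional M N h x), density_mem hN _⟩
      map_add' := fun x y => by
        refine Subtype.ext (density_unique hN (add_mem (density_mem hN _) (density_mem hN _))
          fun b hb => ?_)
        change tr (_ * ((density N _ + density N _) * b)) = _
        rw [add_mul, mul_add, tr_add, density_spec hN _ hb, density_spec hN _ hb]
        change tr (_ * (h * (x.1 * b))) + tr (_ * (h * (y.1 * b))) =
          tr (_ * (h * ((x.1 + y.1) * b)))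
        rw [add_mul, mul_add, mul_add, tr_add]
      map_smul' := fun c x => by
        refine Subtype.ext (density_unique hN (N.smul_mem c (density_mem hN _)) fun b hb => ?_)
        change tr (_ * ((c • density N _) * b)) = _
        rw [smul_mul_assoc, mul_smul_comm, tr_smul, density_spec hN _ hb]
        change c * tr (_ * (h * (x.1 * b))) = tr (_ * (h * ((c • x.1) * b)))
        rw [smul_mul_assoc, mul_smul_comm, mul_smul_comm, tr_smul] }
  pos := fun x hx => by
    rw [← ContinuousLinearMap.nonneg_iff_isPositive] at hx ⊢
    refine density_nonneg hN fun b => ?_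
    change 0 ≤ tr (traceDensity M * (h * (x.1 * (star b.1 * b.1))))
    -- Since `h` commutes with `b`, traciality turns the expression into the trace of `b x b*`
    -- against the positive operator `traceDensity M * h`.
    have hb := mem_commutant.1 hN' _ b.2
    have e : tr (traceDensity M * (h * (x.1 * (star b.1 * b.1)))) =
        tr (traceDensity M * h * (b.1 * x.1 * star b.1)) := by
      rw [← mul_assoc x.1, ← mul_assoc h, canTrace_mul_comm _ (hNM b.2), ← mul_assoc b.1,
        hb]
      simp only [mul_assoc]
    rw [e]
    refine tr_mul_nonneg ?_ (conj_nonneg' hx)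
    exact Commute.mul_nonneg (traceDensity_nonneg M) hpos (traceDensity_comm hM).symm
  unital := fun u hu => by
    have hu1 : u.1 = 1 := by
      have := congrArg Subtype.val (hu ⟨1, hNM hN⟩).1
      exact (mul_one u.1).symm.trans this
    refine density_unique hN (hu1 ▸ hN) fun b hb => ?_
    change _ = tr (traceDensity M * (h * (u.1 * b)))
    rw [hu1, one_mul, hone b hb]
  bimodule := fun a b n₁ n₂ hb => by
    refine density_unique hN (mul_mem (mul_mem n₁.2 (density_mem hN _)) n₂.2) fun c hc => ?_
    change tr (traceDensity N * (n₁.1 * density N (weightedFunctional M N h a.1) * n₂.1 * c)) =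
      tr (traceDensity M * (h * (b.1 * c)))
    have hn := mem_commutant.1 hN' _ n₁.2
    have e : h * (n₁.1 * a.1 * n₂.1 * c) = n₁.1 * (h * (a.1 * (n₂.1 * c))) := by
      rw [← mul_assoc n₁.1 h, hn]; simp only [mul_assoc]
    rw [hb, e, ← canTrace_mul_comm _ (hNM n₁.2), mul_assoc, mul_assoc, ← canTrace_mul_comm _ n₁.2,
      mul_assoc, density_spec hN _ (mul_mem (mul_mem n₂.2 hc) n₁.2)]
    change tr (traceDensity M * (h * (a.1 * (n₂.1 * c * n₁.1)))) = _
    simp only [mul_assoc]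

theorem CondExp.rnDensity_ofDensity (hNM : N ≤ M) (hN : (1 : H →L[ℂ] H) ∈ N) {h : H →L[ℂ] H}
    (hM : h ∈ M) (hN' : h ∈ commutant N) (hpos : 0 ≤ h)
    (hone : ∀ b ∈ N, tr (traceDensity M * (h * b)) = tr (traceDensity N * b)) :
    (CondExp.ofDensity hNM hN hM hN' hpos hone).rnDensity = h := by
  refine density_unique (hNM hN) hM fun m hm => ?_
  change _ = tr (traceDensity N * density N (weightedFunctional M N h m))
  have := density_spec hN (weightedFunctional M N h m) hN
  rw [mul_one] at this
  rw [this]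
  change _ = tr (traceDensity M * (h * (m * 1)))
  rw [mul_one]

end OfDensity

/-! ### Relative entropy in terms of the density. -/

section Entropy

variable [FiniteDimensional ℂ H] {M N : OpAlg H} (hNM : N ≤ M) (hN : (1 : H →L[ℂ] H) ∈ N)
  (ε : CondExp M N) {ω : (H →L[ℂ] H) →ₗ[ℂ] ℂ} {ψ : H} (hω : ∀ x, ω x = inner ℂ ψ (x ψ))

include hNM hN

/-- `Tr_M(h ρ m) = Tr_N(ε(ρ m)) = Tr_N(ρ ε(m)) = ω(ε(m))` for the density `ρ` of `ω` on `N`. -/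
theorem density_comp_condExp :
    density M (restrict N ω ∘ₗ ε.toLin) = ε.rnDensity * density N (restrict N ω) := by
  have hρ := density_mem hN (restrict N ω)
  refine density_unique (hNM hN) (mul_mem (ε.rnDensity_mem hNM hN) (hNM hρ)) fun m hm => ?_
  rw [mul_assoc, ε.rnDensity_spec hNM hN (mul_mem (hNM hρ) hm), ε.map_mul_left hN hρ hm,
    density_spec hN _ (ε.toLin ⟨m, hm⟩).2]
  rfl

include hω in
/-- The relative entropy of a vector state with respect to its composition with a conditional
expectation of finite index. -/
theorem relEntropy_comp_condExp (hinj : ∀ v, ε.rnDensity v = 0 → v = 0) :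
    relEntropy M (restrict M ω) (restrict N ω ∘ₗ ε.toLin) =
      (((inner ℂ ψ (CFC.log (density M (restrict M ω)) ψ) - inner ℂ ψ (CFC.log ε.rnDensity ψ) -
        inner ℂ ψ (CFC.log (density N (restrict N ω)) ψ) : ℂ).re : ℝ) : EReal) := by
  have hM := hNM hN
  have hd := density_comp_condExp hNM hN ε (ω := ω)
  have hsM := density_nonneg hM (restrict_positive (A := M) hω)
  have hsN := density_nonneg hN (restrict_positive (A := N) hω)
  have hcomm : Commute ε.rnDensity (density N (restrict N ω)) :=
    (mem_commutant.1 (ε.rnDensity_mem_commutant hNM hN) _ (density_mem hN _)).symm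
  -- As `h` is injective, the kernel of `h ρ_N` is that of `ρ_N`, which is contained in the kernel
  -- of `ρ_M`; the value `⊤` does not occur.
  have hker : LinearMap.ker (density M (restrict N ω ∘ₗ ε.toLin) : H →ₗ[ℂ] H) ≤
      LinearMap.ker (density M (restrict M ω) : H →ₗ[ℂ] H) := by
    intro v hv
    rw [hd] at hv
    have h2 : density N (restrict N ω) v = 0 := hinj _ hv
    have h3 := supp_apply hsN.isSelfAdjoint h2
    change density M (restrict M ω) v = 0
    rw [← density_mul_supp_of_le hω hNM hN, op_mul_apply, h3, map_zero]
  rw [relEntropy, if_pos hker, canTrace_eq_tr]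
  have hh := ε.rnDensity_nonneg hNM hN
  have hlog := log_mul_of_commute hh hsN hcomm hinj
  have hmem : CFC.log (density M (restrict M ω)) - CFC.log (density M (restrict N ω ∘ₗ ε.toLin)) ∈ M :=
    sub_mem (cfc_mem hM hsM.isSelfAdjoint (density_mem hM _) _) (cfc_mem hM
      (by rw [hd]; exact (IsSelfAdjoint.commute_iff hh.isSelfAdjoint hsN.isSelfAdjoint).1 hcomm)
      (density_mem hM _) _)
  rw [density_spec hM _ hmem]
  change (((ω (CFC.log (density M (restrict M ω)) -
    CFC.log (density M (restrict N ω ∘ₗ ε.toLin)))).re : ℝ) : EReal) = _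
  -- The support of `ρ_N` in the split logarithm fixes `ψ`, so it drops out.
  rw [hω, hd, hlog, sub_apply, add_apply, op_mul_apply, supp_density_apply hω hN, inner_sub_right,
    inner_add_right, sub_sub]

end Entropy

/-! ### Corners by projections of the common center. -/

section Corners

theorem Proj.mul_comm_of_mul_eq {p q : Proj H} (h : p.1 * q.1 = p.1) : q.1 * p.1 = p.1 := by
  have := congrArg star h
  rwa [star_mul, p.star_eq, q.star_eq] at this

theorem center_corner {A : OpAlg H} {E : Proj H} (hE : E.1 ∈ center A) :
    center (corner A E) = corner (center A) E := by
  have hEc := (mem_center.1 hE).2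
  ext x
  constructor
  · intro hx
    obtain ⟨⟨hxA, hEx, hxE⟩, hc⟩ := mem_center.1 hx
    refine ⟨mem_center.2 ⟨hxA, fun a ha => ?_⟩, hEx, hxE⟩
    have hmem : a * E.1 ∈ corner A E := by
      refine ⟨mul_mem ha hE.1, ?_, by rw [mul_assoc, E.mul_self]⟩
      rw [hEc a ha, ← mul_assoc, E.mul_self]
    have h := hc _ hmem
    rwa [mul_assoc, hEx, hEc a ha, ← mul_assoc, hxE] at h
  · rintro ⟨hx, hEx, hxE⟩
    exact mem_center.2 ⟨⟨hx.1, hEx, hxE⟩, fun a ha => (mem_center.1 hx).2 a ha.1⟩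

theorem mem_minProj_corner {Z : OpAlg H} {E p : Proj H} :
    p ∈ minProj (corner Z E) ↔ p ∈ minProj Z ∧ p.1 * E.1 = p.1 := by
  constructor
  · rintro ⟨⟨hpZ, hEp, hpE⟩, hp0, hmin⟩
    refine ⟨⟨hpZ, hp0, fun q hq hqp => ?_⟩, hpE⟩
    have hqE : q.1 * E.1 = q.1 := by rw [← hqp, mul_assoc, hpE]
    exact hmin q ⟨hq, Proj.mul_comm_of_mul_eq hqE, hqE⟩ hqp
  · rintro ⟨⟨hpZ, hp0, hmin⟩, hpE⟩
    exact ⟨⟨hpZ, Proj.mul_comm_of_mul_eq hpE, hpE⟩, hp0, fun q hq hqp => hmin q hq.1 hqp⟩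

theorem mem_minProj_center_corner {A : OpAlg H} {E p : Proj H} (hE : E.1 ∈ center A) :
    p ∈ minProj (center (corner A E)) ↔ p ∈ minProj (center A) ∧ p.1 * E.1 = p.1 := by
  rw [center_corner hE, mem_minProj_corner]

/-- This lets the index of a summand `ε_i` be computed inside the full inclusion, with the density
of `ε`. -/
theorem block_corner {M N : OpAlg H} {E P Q : Proj H} (hE : E.1 ∈ commonCenter M N)
    (hPE : P.1 * E.1 = P.1) : block (corner M E) (corner N E) Q P = block M N Q P := by
  have hEP := Proj.mul_comm_of_mul_eq hPE
  ext x
  constructor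
  · intro hx
    obtain ⟨⟨⟨⟨hxM, hEx, hxE⟩, hxc⟩, hQ⟩, hP⟩ := mem_block.1 hx
    refine mem_block.2 ⟨⟨⟨hxM, mem_commutant.2 fun n hn => ?_⟩, hQ⟩, hP⟩
    have hnE := (mem_center.1 hE.2).2 n hn
    have hmem : n * E.1 ∈ corner N E := by
      refine ⟨mul_mem hn hE.2.1, ?_, by rw [mul_assoc, E.mul_self]⟩
      rw [hnE, ← mul_assoc, E.mul_self]
    have h := mem_commutant.1 hxc _ hmem
    rwa [mul_assoc, hEx, hnE, ← mul_assoc, hxE] at h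
  · intro hx
    obtain ⟨⟨⟨hxM, hxc⟩, hQ⟩, hP⟩ := mem_block.1 hx
    refine mem_block.2 ⟨⟨⟨⟨hxM, ?_, ?_⟩, mem_commutant.2 fun n hn => ?_⟩, hQ⟩, hP⟩
    · rw [← hP.1, ← mul_assoc, hEP]
    · nth_rewrite 1 [← hP.2]
      rw [mul_assoc, hPE, hP.2]
    · exact mem_commutant.1 hxc n hn.1

end Corners

/-! ### The index as a trace of the inverse density. -/

section Index

variable [FiniteDimensional ℂ H] {M N : OpAlg H} (hNM : N ≤ M) (hN : (1 : H →L[ℂ] H) ∈ N)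
  (ε : CondExp M N) {E P Q : Proj H} (hE : E.1 ∈ commonCenter M N)
  {ε' : CondExp (corner M E) (corner N E)}
  (hpart : ∀ x : corner M E, (ε'.toLin x : H →L[ℂ] H) = ε.toLin ⟨x.1, x.2.1⟩)
  (hP : P ∈ minProj (center M)) (hPE : P.1 * E.1 = P.1) (hQ : Q ∈ minProj (center N))

-- On `P` the canonical trace of `M` is `tr` divided by the size of `P M'`, and on `Q` that of `N`
-- is `tr` times `n / tr Q`. So the canonical block trace of `h c` is `φ_k(c)`, which makes `h Q P`
-- the block density `p_{kj} ρ_{kj}`.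
include hNM hN hP hQ in
theorem CondExp.tr_rnDensity_mul {c : H →L[ℂ] H} (hc : c ∈ block M N Q P) :
    tr (ε.rnDensity * c) / (cdim N Q * cdim (commutant M) P : ℝ) =
      tr (ε.toLin ⟨c, (mem_block.1 hc).1.1.1⟩).1 / tr Q.1 := by
  obtain ⟨⟨⟨hcM, -⟩, hQc, -⟩, hPc, -⟩ := mem_block.1 hc
  have hM := hNM hN
  have h := ε.rnDensity_spec hNM hN hcM
  have e1 : traceDensity M * (ε.rnDensity * c) =
      ((cdim M P / (tr P.1).re : ℝ) : ℂ) • (ε.rnDensity * c) := by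
    have h2 : ε.rnDensity * c = P.1 * (ε.rnDensity * c) := by
      rw [← mul_assoc, ← (mem_center.1 hP.1).2 _ (ε.rnDensity_mem hNM hN), mul_assoc, hPc]
    rw [h2, ← mul_assoc, traceDensity_mul hP, smul_mul_assoc]
  have e2 : traceDensity N * (ε.toLin ⟨c, hcM⟩).1 =
      ((cdim N Q / (tr Q.1).re : ℝ) : ℂ) • (ε.toLin ⟨c, hcM⟩).1 := by
    have h2 : (ε.toLin ⟨c, hcM⟩).1 = Q.1 * (ε.toLin ⟨c, hcM⟩).1 := by
      rw [← ε.map_mul_left hN hQ.1.1 hcM (by rwa [hQc])]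
      exact congrArg (fun z : M => (ε.toLin z).1) (Subtype.ext hQc.symm)
    rw [h2, ← mul_assoc, traceDensity_mul hQ, smul_mul_assoc]
  rw [e1, e2, tr_smul, tr_smul, ← cdim_mul_cdim hM hP] at h
  rw [← tr_proj_re Q]
  have n0 := (cdim_pos hQ).ne'
  have m0 := (cdim_pos hP).ne'
  have m0' : cdim (commutant M) P ≠ 0 :=
    (cdim_pos (A := commutant M) (by rwa [center_commutant hM])).ne'
  have q0 := (tr_proj_re_pos hQ.2.1).ne'
  push_cast at h ⊢
  have n0' : (cdim N Q : ℂ) ≠ 0 := Complex.ofReal_ne_zero.2 n0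
  have m1 : (cdim M P : ℂ) ≠ 0 := Complex.ofReal_ne_zero.2 m0
  have m1' : (cdim (commutant M) P : ℂ) ≠ 0 := Complex.ofReal_ne_zero.2 m0'
  have q1 : (((tr Q.1).re : ℝ) : ℂ) ≠ 0 := Complex.ofReal_ne_zero.2 q0
  field_simp at h ⊢
  linear_combination h

include hNM hN hP hQ in
theorem CondExp.rnDensity_blockUnit_comm :
    Q.1 * P.1 * ε.rnDensity = ε.rnDensity * (Q.1 * P.1) := by
  rw [mul_assoc, ← (mem_center.1 hP.1).2 _ (ε.rnDensity_mem hNM hN), ← mul_assoc,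
    mem_commutant.1 (ε.rnDensity_mem_commutant hNM hN) _ hQ.1.1, mul_assoc]

include hNM hN hP hQ in
theorem mul_blockUnit_mem_block {x : H →L[ℂ] H} (hxM : x ∈ M) (hxN : x ∈ commutant N) :
    x * (Q.1 * P.1) ∈ block M N Q P := by
  have he := mem_block.1 (blockUnit_mem hNM hP hQ)
  refine mem_block.2 ⟨⟨⟨mul_mem hxM he.1.1.1, mul_mem hxN he.1.1.2⟩, ?_, ?_⟩, ?_, ?_⟩
  · rw [← mul_assoc, mem_commutant.1 hxN _ hQ.1.1, mul_assoc, he.1.2.1]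
  · rw [mul_assoc, he.1.2.2]
  · rw [← mul_assoc, ← (mem_center.1 hP.1).2 _ hxM, mul_assoc, he.2.1]
  · rw [mul_assoc, he.2.2]

include hNM hN hE hpart hP hPE hQ in
theorem CondExp.blockDensity_part (h0 : Q.1 * P.1 ≠ 0) :
    blockDensity ε' Q P = ε.rnDensity * (Q.1 * P.1) := by
  have hB := block_corner (Q := Q) hE hPE
  have hmem := mul_blockUnit_mem_block hNM hN hP hQ (ε.rnDensity_mem hNM hN)
    (ε.rnDensity_mem_commutant hNM hN)
  refine density_eq_of_faithful ?_ (hB ▸ hmem) fun c => ?_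
  · rw [hB]
    exact canTrace_block_faithful hNM hN hP hQ h0
  · have hc : c.1 ∈ block M N Q P := hB ▸ c.2
    have e : ε.rnDensity * (Q.1 * P.1) * c.1 = ε.rnDensity * c.1 := by
      rw [mul_assoc, blockUnit_mul hNM hP hQ hc]
    have hmem' : ε.rnDensity * c.1 ∈ block M N Q P := e ▸ mul_mem hmem hc
    refine (congrArg (fun B => canTrace B (ε.rnDensity * (Q.1 * P.1) * c.1)) hB).trans ?_
    rw [e, canTrace_block hNM hN hP hQ h0 hmem', ε.tr_rnDensity_mul hNM hN hP hQ hc]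
    exact congrArg (fun z => tr z / tr Q.1) (hpart ⟨c.1, c.2.1.1.1⟩).symm

include hNM hN hE hpart hP hPE hQ in
theorem CondExp.blockWeight_part (h0 : Q.1 * P.1 ≠ 0) :
    blockWeight ε' Q P = (tr (ε.rnDensity * (Q.1 * P.1))).re / (cdim N Q * cdim (commutant M) P) := by
  have hmem := mul_blockUnit_mem_block hNM hN hP hQ (ε.rnDensity_mem hNM hN)
    (ε.rnDensity_mem_commutant hNM hN)
  rw [blockWeight, ε.blockDensity_part hNM hN hE hpart hP hPE hQ h0, block_corner hE hPE,
    canTrace_block hNM hN hP hQ h0 hmem, Complex.div_ofReal_re]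

include hNM hN hP hQ in
theorem mul_blockUnit_nonneg {x : H →L[ℂ] H} (hx : 0 ≤ x) (hxM : x ∈ M) (hxN : x ∈ commutant N) :
    0 ≤ x * (Q.1 * P.1) := by
  have hb := mul_blockUnit_mem_block hNM hN hP hQ hxM hxN
  have h := conj_nonneg' (x := Q.1 * P.1) hx
  rwa [star_blockUnit hNM hP hQ, mul_assoc, blockUnit_mul hNM hP hQ hb] at h

theorem inverse_mem_commutant {A : OpAlg H} {x y : H →L[ℂ] H} (hx : x ∈ commutant A)
    (hyx : y * x = 1) (hxy : x * y = 1) : y ∈ commutant A := by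
  refine mem_commutant.2 fun a ha => ?_
  have h := mem_commutant.1 hx a ha
  calc a * y = y * (x * a) * y := by rw [← mul_assoc, hyx, one_mul]
    _ = y * a := by rw [← h, mul_assoc, mul_assoc, hxy, mul_one]

theorem inverse_mem {A : OpAlg H} (h1 : (1 : H →L[ℂ] H) ∈ A) {x y : H →L[ℂ] H} (hx : x ∈ A)
    (hyx : y * x = 1) (hxy : x * y = 1) : y ∈ A := by
  rw [← commutant_commutant h1] at hx ⊢
  exact inverse_mem_commutant hx hyx hxy

theorem nonneg_of_inverse {x y : H →L[ℂ] H} (hx : 0 ≤ x) (hyx : y * x = 1) : 0 ≤ y := by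
  have hys : star y = y := by
    have h := congrArg star hyx
    rw [star_mul, hx.isSelfAdjoint.star_eq, star_one] at h
    calc star y = y * x * star y := by rw [hyx, one_mul]
      _ = y := by rw [mul_assoc, h, mul_one]
  have h := conj_nonneg' (x := y) hx
  rwa [hys, hyx, one_mul] at h

include hNM hN hE hpart hP hPE hQ in
/-- The contribution of a block to the index, when the density is invertible. -/
theorem CondExp.blockTerm_eq (h0 : Q.1 * P.1 ≠ 0) {g : H →L[ℂ] H} (hg : g * ε.rnDensity = 1) :
    (ENNReal.ofReal (blockWeight ε' Q P))⁻¹ * blockIndex ε' Q P =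
      ENNReal.ofReal ((tr (g * (Q.1 * P.1))).re / (cdim N Q * cdim (commutant M) P)) := by
  have hM := hNM hN
  have hg' := mul_eq_one_symm hg
  have hh := ε.rnDensity_nonneg hNM hN
  have hhM := ε.rnDensity_mem hNM hN
  have hhN := ε.rnDensity_mem_commutant hNM hN
  have hgM := inverse_mem hM hhM hg hg'
  have hgN := inverse_mem_commutant hhN hg hg'
  have hbd := ε.blockDensity_part hNM hN hE hpart hP hPE hQ h0
  have hB := block_corner (Q := Q) hE hPE
  have hP' : P ∈ minProj (center (commutant M)) := by rwa [center_commutant hM]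
  have hd : 0 < cdim N Q * cdim (commutant M) P := mul_pos (cdim_pos hQ) (cdim_pos hP')
  have hee : Q.1 * P.1 * (Q.1 * P.1) = Q.1 * P.1 := (blockUnit hNM hP hQ).mul_self
  have hcomm := ε.rnDensity_blockUnit_comm hNM hN hP hQ
  set h := ε.rnDensity with hhdef
  set e := Q.1 * P.1 with hedef
  set w := blockWeight ε' Q P with hw
  have hwpos : 0 < w := by
    rw [hw, ε.blockWeight_part hNM hN hE hpart hP hPE hQ h0]
    refine div_pos ?_ hd
    have hnn := mul_blockUnit_nonneg hNM hN hP hQ hh hhM hhN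
    have hne : tr (h * e) ≠ 0 := fun hz => by
      have h2 := eq_zero_of_tr_eq_zero hnn hz
      refine h0 ?_
      calc e = g * (h * e) := by rw [← mul_assoc, hg, one_mul]
        _ = 0 := by rw [h2, mul_zero]
    exact (Complex.pos_iff.1 (lt_of_le_of_ne (tr_nonneg hnn) hne.symm)).1
  have hrho : blockRho ε' Q P = (w : ℂ)⁻¹ • (h * e) := by rw [blockRho, hbd]
  have hw0 : (w : ℂ) ≠ 0 := Complex.ofReal_ne_zero.2 hwpos.ne'
  have hgm := mul_blockUnit_mem_block hNM hN hP hQ hgM hgN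
  have hge : e * (g * e) = g * e := blockUnit_mul hNM hP hQ hgm
  -- The inverse of `ρ_{kj} = w⁻¹ h e` in the block is `w g e`; its factor `w` cancels the `1 /
  -- p_{kj}` of the index.
  have hl : ((w : ℂ) • (g * e)) * blockRho ε' Q P = e := by
    rw [hrho, smul_mul_smul_comm, mul_inv_cancel₀ hw0, one_smul, mul_assoc, ← mul_assoc e, hcomm,
      mul_assoc h, hee, ← mul_assoc, hg, one_mul]
  have hr : blockRho ε' Q P * ((w : ℂ) • (g * e)) = e := by
    rw [hrho, smul_mul_smul_comm, inv_mul_cancel₀ hw0, one_smul, mul_assoc, hge, ← mul_assoc, hg',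
      one_mul]
  have hex : ∃ x : H →L[ℂ] H, x ∈ block (corner M E) (corner N E) Q P ∧
      blockRho ε' Q P * x = Q.1 * P.1 ∧ x * blockRho ε' Q P = Q.1 * P.1 :=
    ⟨(w : ℂ) • (g * e), (block (corner M E) (corner N E) Q P).smul_mem _ (hB ▸ hgm), hr, hl⟩
  have hchoose : hex.choose = (w : ℂ) • (g * e) := by
    obtain ⟨c1, c2, -⟩ := hex.choose_spec
    have c1' : hex.choose ∈ block M N Q P := hB.le c1
    calc hex.choose = e * hex.choose := (blockUnit_mul hNM hP hQ c1').symm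
      _ = (w : ℂ) • (g * e) * (blockRho ε' Q P * hex.choose) := by rw [← mul_assoc, hl]
      _ = (w : ℂ) • (g * e) := by rw [c2, ← hedef, smul_mul_assoc, mul_assoc, hee]
  rw [blockIndex, dif_pos hex, hchoose, hB, canTrace_block hNM hN hP hQ h0
    ((block M N Q P).smul_mem _ hgm), tr_smul, Complex.div_ofReal_re, Complex.re_ofReal_mul, mul_div_assoc,
    ENNReal.ofReal_mul hwpos.le, ← mul_assoc, ENNReal.inv_mul_cancel
    (ENNReal.ofReal_pos.2 hwpos).ne' ENNReal.ofReal_ne_top, one_mul]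

-- Without an inverse of `ρ_{kj}` the block index is `⊤`, and its prefactor is never zero. A
-- vanishing weight is covered: then `blockRho` is `0` because `0⁻¹ = 0`.
include hNM hN hE hpart hP hPE hQ in
theorem CondExp.exists_inverse_of_blockTerm (h0 : Q.1 * P.1 ≠ 0)
    (hfin : (ENNReal.ofReal (blockWeight ε' Q P))⁻¹ * blockIndex ε' Q P ≠ ⊤) :
    ∃ y : H →L[ℂ] H, y * (ε.rnDensity * (Q.1 * P.1)) = Q.1 * P.1 := by
  have hex : ∃ x : H →L[ℂ] H, x ∈ block (corner M E) (corner N E) Q P ∧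
      blockRho ε' Q P * x = Q.1 * P.1 ∧ x * blockRho ε' Q P = Q.1 * P.1 := by
    by_contra hno
    refine hfin ?_
    rw [blockIndex, dif_neg hno]
    exact ENNReal.mul_top (ENNReal.inv_ne_zero.2 ENNReal.ofReal_ne_top)
  obtain ⟨x, -, -, hx⟩ := hex
  rw [blockRho, ε.blockDensity_part hNM hN hE hpart hP hPE hQ h0, mul_smul_comm, ← smul_mul_assoc] at hx
  exact ⟨_, hx⟩

-- `E` is central in `N`, so a minimal `Q` lies below `E` or is orthogonal to it; the latter is
-- impossible if `Q` meets `P ≤ E`.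
include hNM hN hE hP hPE in
theorem mem_index_range {Q : Proj H} : Q ∈ {Q ∈ minProj (center (corner N E)) | Q.1 * P.1 ≠ 0} ↔
    Q ∈ minProj (center N) ∧ Q.1 * P.1 ≠ 0 := by
  rw [Set.mem_ofPred_eq, mem_minProj_center_corner hE.2]
  refine ⟨fun h => ⟨h.1.1, h.2⟩, fun h => ⟨⟨h.1, ?_⟩, h.2⟩⟩
  refine (minProj_mul_eq_zero_or (isCommAlg_center N) h.1 hE.2).resolve_left fun hz => h.2 ?_
  rw [← Proj.mul_comm_of_mul_eq hPE, ← mul_assoc, hz, zero_mul]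

open Classical in
include hNM hN hE hP hPE in
theorem indexAt_eq_sum : indexAt ε' P =
    ∑ Q ∈ (minProj_finite (isCommAlg_center N)).toFinset with Q.1 * P.1 ≠ 0,
      (ENNReal.ofReal (blockWeight ε' Q P))⁻¹ * blockIndex ε' Q P := by
  rw [indexAt, ← finsum_mem_coe_finset]
  refine finsum_mem_congr (Set.ext fun Q => ?_) fun _ _ => rfl
  rw [mem_index_range hNM hN hE hP hPE]
  simp

include hNM hN hE hP hPE in
/-- The index in terms of the inverse of the density. -/
theorem CondExp.indexAt_part {g : H →L[ℂ] H} (hg : g * ε.rnDensity = 1)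
    (hpart : ∀ x : corner M E, (ε'.toLin x : H →L[ℂ] H) = ε.toLin ⟨x.1, x.2.1⟩) :
    indexAt ε' P = ENNReal.ofReal
      ((tr (traceDensity (commutant N) * (g * P.1))).re / cdim (commutant M) P) := by
  classical
  have hM := hNM hN
  have hg' := mul_eq_one_symm hg
  have hgM := inverse_mem hM (ε.rnDensity_mem hNM hN) hg hg'
  have hgN := inverse_mem_commutant (ε.rnDensity_mem_commutant hNM hN) hg hg'
  have hgn := nonneg_of_inverse (ε.rnDensity_nonneg hNM hN) hg
  have hP' : P ∈ minProj (center (commutant M)) := by rwa [center_commutant hM]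
  rw [indexAt_eq_sum hNM hN hE hP hPE]
  have hfin := minProj_finite (isCommAlg_center N)
  calc _ = ∑ Q ∈ hfin.toFinset with Q.1 * P.1 ≠ 0, ENNReal.ofReal
        ((tr (g * (Q.1 * P.1))).re / (cdim N Q * cdim (commutant M) P)) := by
        refine Finset.sum_congr rfl fun Q hQ => ?_
        rw [Finset.mem_filter, Set.Finite.mem_toFinset] at hQ
        exact ε.blockTerm_eq hNM hN hE hpart hP hPE hQ.1 hQ.2 hg
    _ = ∑ Q ∈ hfin.toFinset, ENNReal.ofReal
        ((tr (g * (Q.1 * P.1))).re / (cdim N Q * cdim (commutant M) P)) := by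
        rw [Finset.sum_filter]
        refine Finset.sum_congr rfl fun Q _ => ?_
        split_ifs with h
        · rfl
        · rw [not_not] at h
          rw [h, mul_zero, tr_zero, Complex.zero_re, zero_div, ENNReal.ofReal_zero]
    _ = ENNReal.ofReal (∑ Q ∈ hfin.toFinset,
        (tr (g * (Q.1 * P.1))).re / (cdim N Q * cdim (commutant M) P)) := by
        refine (ENNReal.ofReal_sum_of_nonneg fun Q hQ => ?_).symm
        rw [Set.Finite.mem_toFinset] at hQ
        refine div_nonneg ?_ (mul_nonneg (cdim_nonneg _ _) (cdim_nonneg _ _))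
        exact (Complex.nonneg_iff.1 (tr_nonneg (mul_blockUnit_nonneg hNM hN hP hQ hgn hgM hgN))).1
    _ = _ := by
        congr 1
        -- With `n n' = tr Q` for the sizes of `Q N` and `Q N'`, the factor `1 / n` becomes `n' / tr
        -- Q`, the value of the trace density of `N'` on `Q`. The sum over `Q` then collapses.
        have e : ∀ Q ∈ hfin.toFinset, (tr (g * (Q.1 * P.1))).re / (cdim N Q * cdim (commutant M) P) =
            (tr (traceDensity (commutant N) * Q.1 * (g * P.1))).re / cdim (commutant M) P := by
          intro Q hQ
          rw [Set.Finite.mem_toFinset] at hQ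
          have hQ' : Q ∈ minProj (center (commutant N)) := by rwa [center_commutant hN]
          rw [traceDensity_mul hQ', smul_mul_assoc, tr_smul, Complex.re_ofReal_mul,
            ← cdim_mul_cdim hN hQ, ← mul_assoc Q.1, mem_commutant.1 hgN _ hQ.1.1, mul_assoc g]
          have n0 := (cdim_pos hQ).ne'
          have n0' := (cdim_pos hQ').ne'
          have m0' := (cdim_pos hP').ne'
          field_simp
        rw [Finset.sum_congr rfl e, ← Finset.sum_div, ← Complex.re_sum, ← tr_sum, ← Finset.sum_mul,
          ← Finset.mul_sum, sum_minProj (isCommAlg_center N) (one_mem_center hN), mul_one]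

end Index

variable  [FiniteDimensional ℂ H]

/-! ### Logarithms of invertible positive operators. -/

section Logarithm

theorem exists_inverse_of_injective {a : H →L[ℂ] H} (ha : IsSelfAdjoint a)
    (hinj : ∀ v, a v = 0 → v = 0) : ∃ g : H →L[ℂ] H, g * a = 1 := by
  refine ⟨cfc (fun t : ℝ => t⁻¹) a, ext_eigenvectors ha fun α v hv => ?_⟩
  by_cases h0 : v = 0
  · simp [h0]
  have hα : α ≠ 0 := by
    rintro rfl
    exact h0 (hinj v (by simpa using hv))
  rw [op_mul_apply, hv, map_smul, cfc_apply_of_eigenvector ha hv, smul_smul, Complex.ofReal_inv,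
    mul_inv_cancel₀ (Complex.ofReal_ne_zero.2 hα), one_smul]
  rfl

theorem injective_of_mul_eq_one {g a : H →L[ℂ] H} (h : g * a = 1) (v : H) (hv : a v = 0) :
    v = 0 := by
  have h1 : g (a v) = v := congrArg (fun z : H →L[ℂ] H => z v) h
  rw [← h1, hv, map_zero]

theorem supp_eq_one {a : H →L[ℂ] H} (ha : IsSelfAdjoint a) (hinj : ∀ v, a v = 0 → v = 0) :
    supp a = 1 := by
  refine ext_eigenvectors ha fun α v hv => ?_
  by_cases h0 : v = 0
  · simp [h0]
  have hα : α ≠ 0 := by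
    rintro rfl
    exact h0 (hinj v (by simpa using hv))
  rw [supp, cfc_apply_of_eigenvector ha hv, if_neg hα, Complex.ofReal_one, one_smul]
  rfl

theorem log_inverse {a g : H →L[ℂ] H} (ha : 0 ≤ a) (hg : g * a = 1) : CFC.log g = -CFC.log a := by
  have hg' := mul_eq_one_symm hg
  have h := log_mul_of_commute (nonneg_of_inverse ha hg) ha (hg.trans hg'.symm)
    (injective_of_mul_eq_one hg')
  rw [hg, supp_eq_one ha.isSelfAdjoint (injective_of_mul_eq_one hg), mul_one, CFC.log_one] at h
  exact eq_neg_of_add_eq_zero_left h.symm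

theorem eq_of_log_eq {a b : H →L[ℂ] H} (ha : 0 ≤ a) (hb : 0 ≤ b) (hai : ∀ v, a v = 0 → v = 0)
    (hbi : ∀ v, b v = 0 → v = 0) (h : CFC.log a = CFC.log b) : a = b := by
  have key : ∀ c : H →L[ℂ] H, 0 ≤ c → (∀ v, c v = 0 → v = 0) → cfc Real.exp (CFC.log c) = c := by
    intro c hc hci
    refine ext_eigenvectors hc.isSelfAdjoint fun α v hv => ?_
    by_cases h0 : v = 0
    · simp [h0]
    have hα : α ≠ 0 := by
      rintro rfl
      exact h0 (hci v (by simpa using hv))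
    have hα' : 0 < α := lt_of_le_of_ne (nonneg_eigenvalue hc h0 hv) hα.symm
    have h1 := cfc_apply_of_eigenvector hc.isSelfAdjoint hv Real.log
    rw [cfc_apply_of_eigenvector (a := CFC.log c) IsSelfAdjoint.log h1, Real.exp_log hα', hv]
  rw [← key a ha hai, ← key b hb hbi, h]

/-- Every eigenvalue of `a - b` is its expectation in a unit eigenvector, hence zero. -/
theorem eq_of_inner_re_eq {a b : H →L[ℂ] H} (ha : IsSelfAdjoint a) (hb : IsSelfAdjoint b)
    (h : ∀ ψ : H, ‖ψ‖ = 1 → (inner ℂ ψ (a ψ) : ℂ).re = (inner ℂ ψ (b ψ) : ℂ).re) : a = b := by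
  rw [← sub_eq_zero]
  refine ext_eigenvectors (ha.sub hb) fun α v hv => ?_
  by_cases h0 : v = 0
  · simp [h0]
  have hn : ‖v‖ ≠ 0 := norm_ne_zero_iff.2 h0
  have hψ : ‖((‖v‖⁻¹ : ℝ) : ℂ) • v‖ = 1 := by
    rw [norm_smul, Complex.norm_real, norm_inv, norm_norm, inv_mul_cancel₀ hn]
  have h1 := h _ hψ
  rw [← sub_eq_zero, ← Complex.sub_re, ← inner_sub_right, ← sub_apply, map_smul, hv, smul_comm,
    inner_smul_right, inner_self_eq_norm_sq_to_K, hψ] at h1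
  have hα : α = 0 := by simpa using h1
  rw [hv, hα]
  simp

variable {Z : OpAlg H}

theorem log_projSum (hZ : IsCommAlg Z) (h1 : (1 : H →L[ℂ] H) ∈ Z) {f : Proj H → ℝ}
    (hf : ∀ p ∈ minProj Z, 0 ≤ f p) :
    CFC.log (projSum Z fun p => (f p : ℂ)) = projSum Z fun p => (Real.log (f p) : ℂ) := by
  have hsa := (projSum_nonneg hZ hf).isSelfAdjoint
  refine ext_minProj hZ h1 fun p hp => ?_
  rw [projSum_mul hZ _ hp]
  ext v
  have hv : (projSum Z fun p => (f p : ℂ)) (p.1 v) = (f p : ℂ) • p.1 v := by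
    rw [← op_mul_apply, projSum_mul hZ _ hp]; rfl
  exact cfc_apply_of_eigenvector hsa hv Real.log

end Logarithm

/-! ### The dual density and the sum of the two entropies. -/

section Dual

variable {M N : OpAlg H} (hNM : N ≤ M) (hN : (1 : H →L[ℂ] H) ∈ N)

theorem isCommAlg_commonCenter (M N : OpAlg H) : IsCommAlg (commonCenter M N) :=
  fun _ hx _ hy => isCommAlg_center M _ hx.1 _ hy.1

theorem exists_minProj_ge {Z Z' : OpAlg H} (hZ : IsCommAlg Z) (hZZ : Z' ≤ Z)
    (h1 : (1 : H →L[ℂ] H) ∈ Z') {P : Proj H} (hP : P ∈ minProj Z) :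
    ∃ E ∈ minProj Z', P.1 * E.1 = P.1 := by
  have hZ' : IsCommAlg Z' := fun x hx y hy => hZ x (hZZ hx) y (hZZ hy)
  obtain ⟨E, hE, h⟩ := exists_minProj_mul_ne_zero hZ' h1 hP.2.1
  exact ⟨E, hE, (minProj_mul_eq_zero_or hZ hP (hZZ hE.1)).resolve_left h⟩

theorem eq_zero_of_minProj_apply {Z : OpAlg H} (hZ : IsCommAlg Z) (h1 : (1 : H →L[ℂ] H) ∈ Z) {v : H}
    (h : ∀ p ∈ minProj Z, p.1 v = 0) : v = 0 := by
  have e := congrArg (fun z : H →L[ℂ] H => z v) (sum_minProj hZ h1)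
  rw [sum_apply, Finset.sum_eq_zero fun p hp => h p ((Set.Finite.mem_toFinset _).1 hp)] at e
  exact e.symm

include hNM hN in
/-- On each central summand of `M'`, the functional `Tr_{N'} (g ·)` is a multiple of `Tr_{M'}`. -/
theorem tr_mul_minProj_eq {P : Proj H} (hP : P ∈ minProj (center M)) {g b : H →L[ℂ] H}
    (hgM : g ∈ M) (hb : b ∈ commutant M) :
    tr (traceDensity (commutant N) * (g * (b * P.1))) * cdim (commutant M) P =
      tr (traceDensity (commutant N) * (g * P.1)) * tr (traceDensity (commutant M) * (b * P.1)) := by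
  have hM := hNM hN
  have hP' : P ∈ minProj (center (commutant M)) := by rwa [center_commutant hM]
  have h := tracial_eq (one_mem_commutant M) hP'
    (f := trLin ∘ₗ LinearMap.mulLeft ℂ (traceDensity (commutant N) * g)) (fun x hx y hy => by
      change tr (traceDensity (commutant N) * g * (x * y)) =
        tr (traceDensity (commutant N) * g * (y * x))
      -- The trace density of `N'` commutes with `y ∈ M' ≤ N'`, and so does `g ∈ M`; hence the
      -- weighted functional is tracial on `M'`.
      have e : y * (traceDensity (commutant N) * g) = traceDensity (commutant N) * g * y := by
        rw [← mul_assoc, traceDensity_comm (commutant_anti hNM hy), mul_assoc,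
          ← mem_commutant.1 hy _ hgM, mul_assoc]
      rw [← mul_assoc, tr_mul_comm, ← mul_assoc, e, mul_assoc]) hb
  change tr (traceDensity (commutant N) * g * (b * P.1)) * tr P.1 =
    tr (traceDensity (commutant N) * g * P.1) * tr (b * P.1) at h
  have e : traceDensity (commutant M) * (b * P.1) =
      ((cdim (commutant M) P / (tr P.1).re : ℝ) : ℂ) • (b * P.1) := by
    rw [← mul_assoc, ← traceDensity_comm hb, mul_assoc, traceDensity_mul hP', mul_smul_comm]
  rw [e, tr_smul, ← mul_assoc, ← mul_assoc _ g P.1]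
  have ht : (((tr P.1).re : ℝ) : ℂ) ≠ 0 := Complex.ofReal_ne_zero.2 (tr_proj_re_pos hP.2.1).ne'
  rw [← tr_proj_re P] at h
  push_cast
  field_simp
  linear_combination cdim (commutant M) P * h

variable {g : H →L[ℂ] H} (hgM : g ∈ M) {lam : Proj H → ℝ}
  (hlam : ∀ E ∈ minProj (commonCenter M N), ∀ P ∈ minProj (center M), P.1 * E.1 = P.1 →
    tr (traceDensity (commutant N) * (g * P.1)) = lam E * cdim (commutant M) P)
  (hpos : ∀ E ∈ minProj (commonCenter M N), 0 < lam E)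

include hNM hN in
theorem one_mem_commonCenter : (1 : H →L[ℂ] H) ∈ commonCenter M N :=
  ⟨one_mem_center (hNM hN), one_mem_center hN⟩

-- The normalization required of a density of a conditional expectation `N' → M'`. Under `P ≤ E` the
-- functional `Tr_{N'}(g ·)` is `lam E` times `Tr_{M'}`, and the common central factor divides this
-- constant out.
include hNM hN hgM hlam hpos in
theorem tr_dual_density {b : H →L[ℂ] H} (hb : b ∈ commutant M) :
    tr (traceDensity (commutant N) *
      (g * projSum (commonCenter M N) (fun E => ((lam E)⁻¹ : ℝ)) * b)) =
      tr (traceDensity (commutant M) * b) := by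
  have hM := hNM hN
  have hZ := isCommAlg_commonCenter M N
  set D := projSum (commonCenter M N) (fun E => (((lam E)⁻¹ : ℝ) : ℂ)) with hD
  have hDm : D ∈ commonCenter M N := projSum_mem hZ _
  have e1 : ∀ x : H →L[ℂ] H, x = ∑ P ∈ (minProj_finite (isCommAlg_center M)).toFinset, x * P.1 :=
    fun x => by rw [← Finset.mul_sum, sum_minProj (isCommAlg_center M) (one_mem_center hM), mul_one]
  rw [e1 b, Finset.mul_sum, Finset.mul_sum, Finset.mul_sum, tr_sum, tr_sum]
  refine Finset.sum_congr rfl fun P hP => ?_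
  rw [Set.Finite.mem_toFinset] at hP
  have hP' : P ∈ minProj (center (commutant M)) := by rwa [center_commutant hM]
  obtain ⟨E, hE, hPE⟩ := exists_minProj_ge (isCommAlg_center M)
    (inf_le_left : commonCenter M N ≤ center M) (one_mem_commonCenter hNM hN) hP
  have hDP : D * P.1 = (((lam E)⁻¹ : ℝ) : ℂ) • P.1 := by
    rw [← Proj.mul_comm_of_mul_eq hPE, ← mul_assoc, hD, projSum_mul hZ _ hE, smul_mul_assoc]
  have e2 : g * D * (b * P.1) = (((lam E)⁻¹ : ℝ) : ℂ) • (g * (b * P.1)) := by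
    rw [mul_assoc, ← mul_assoc D, mem_commutant.1 hb _ hDm.1.1, mul_assoc b, hDP, mul_smul_comm,
      mul_smul_comm]
  have h := tr_mul_minProj_eq hNM hN hP hgM hb
  rw [hlam E hE P hP hPE] at h
  have c0 : (cdim (commutant M) P : ℂ) ≠ 0 := Complex.ofReal_ne_zero.2 (cdim_pos hP').ne'
  have l0 : (lam E : ℂ) ≠ 0 := Complex.ofReal_ne_zero.2 (hpos E hE).ne'
  rw [e2, mul_smul_comm, tr_smul, Complex.ofReal_inv]
  field_simp
  refine mul_right_cancel₀ c0 ?_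
  rw [h]; ring

include hNM hN hpos in
theorem log_dual_density {h : H →L[ℂ] H} (hh : 0 ≤ h) (hg : g * h = 1) (hgM : g ∈ M) :
    CFC.log (g * projSum (commonCenter M N) (fun E => ((lam E)⁻¹ : ℝ))) =
      -CFC.log h - projSum (commonCenter M N) (fun E => (Real.log (lam E) : ℂ)) := by
  have hZ := isCommAlg_commonCenter M N
  have h1 := one_mem_commonCenter hNM hN
  have hnn : ∀ E ∈ minProj (commonCenter M N), 0 ≤ (lam E)⁻¹ := fun E hE =>
    (inv_pos.2 (hpos E hE)).le
  have hD0 := projSum_nonneg hZ hnn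
  have hDm := projSum_mem hZ (fun E => (((lam E)⁻¹ : ℝ) : ℂ))
  have hDinv := projSum_mul_inv hZ h1 (f := fun E => (((lam E)⁻¹ : ℝ) : ℂ)) fun E hE =>
    Complex.ofReal_ne_zero.2 (inv_pos.2 (hpos E hE)).ne'
  rw [log_mul_of_commute (nonneg_of_inverse hh hg) hD0 ((mem_center.1 hDm.1).2 _ hgM)
    (injective_of_mul_eq_one (mul_eq_one_symm hg)), supp_eq_one hD0.isSelfAdjoint
    (injective_of_mul_eq_one (mul_eq_one_symm hDinv)), mul_one, log_inverse hh hg,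
    log_projSum hZ h1 hnn, sub_eq_add_neg]
  congr 1
  refine ext_minProj hZ h1 fun p hp => ?_
  rw [projSum_mul hZ _ hp, neg_mul, projSum_mul hZ _ hp, Real.log_inv, Complex.ofReal_neg, neg_smul]

include hNM hN in
/-- The sum of the relative entropies for an inclusion and the dual inclusion. -/
theorem relEntropy_add_relEntropy (ε : CondExp M N) {A B : OpAlg H} (hA : A = commutant N)
    (hB : B = commutant M) (ε' : CondExp A B) (hinj : ∀ v, ε.rnDensity v = 0 → v = 0)
    (hinj' : ∀ v, ε'.rnDensity v = 0 → v = 0) {ω : (H →L[ℂ] H) →ₗ[ℂ] ℂ} {ψ : H}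
    (hω : ∀ x, ω x = inner ℂ ψ (x ψ)) :
    relEntropy M (restrict M ω) (restrict N ω ∘ₗ ε.toLin) +
      relEntropy A (restrict A ω) (restrict B ω ∘ₗ ε'.toLin) =
    (((-(inner ℂ ψ (CFC.log ε.rnDensity ψ) + inner ℂ ψ (CFC.log ε'.rnDensity ψ)) : ℂ).re : ℝ) :
      EReal) := by
  subst hA hB
  -- The logarithms of the densities on `C` and `C'` agree on `ψ`. Taking `C = M` and `C = N`
  -- cancels every term except those of the two conditional expectations.
  have key : ∀ C : OpAlg H, (1 : H →L[ℂ] H) ∈ C → CFC.log (density C (restrict C ω)) ψ =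
      CFC.log (density (commutant C) (restrict (commutant C) ω)) ψ := by
    intro C hC
    refine cfc_apply_eq_of_commute (density_isSelfAdjoint hC (restrict_positive hω))
      (density_isSelfAdjoint (one_mem_commutant C) (restrict_positive hω)) ?_
      (density_apply_eq_commutant hC hω) _
    exact mem_commutant.1 (density_mem (one_mem_commutant C) _) _ (density_mem hC _)
  rw [relEntropy_comp_condExp hNM hN ε hω hinj,
    relEntropy_comp_condExp (commutant_anti hNM) (one_mem_commutant M) ε' hω hinj', ← EReal.coe_add,
    ← Complex.add_re, key M (hNM hN), key N hN]
  congr 3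
  ring

end Dual

theorem starCommutant_toNonUnitalStarSubalgebra (M : StarSubalgebra ℂ (H →L[ℂ] H)) :
    (starCommutant M).toNonUnitalStarSubalgebra = commutant M.toNonUnitalStarSubalgebra :=
  SetLike.ext fun _ => Iff.rfl

theorem commutant_starCommutant {M : StarSubalgebra ℂ (H →L[ℂ] H)} :
    commutant (starCommutant M).toNonUnitalStarSubalgebra = M.toNonUnitalStarSubalgebra := by
  rw [starCommutant_toNonUnitalStarSubalgebra]
  exact commutant_commutant M.one_mem

theorem center_starCommutant {M : StarSubalgebra ℂ (H →L[ℂ] H)} :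
    center (starCommutant M).toNonUnitalStarSubalgebra = center M.toNonUnitalStarSubalgebra := by
  rw [starCommutant_toNonUnitalStarSubalgebra]
  exact center_commutant M.one_mem

theorem starCommutant_anti {M N : StarSubalgebra ℂ (H →L[ℂ] H)} (hNM : N ≤ M) :
    (starCommutant M).toNonUnitalStarSubalgebra ≤ (starCommutant N).toNonUnitalStarSubalgebra := by
  rw [starCommutant_toNonUnitalStarSubalgebra, starCommutant_toNonUnitalStarSubalgebra]
  exact commutant_anti hNM

theorem commonCenter_starCommutant {M N : StarSubalgebra ℂ (H →L[ℂ] H)} :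
    commonCenter (starCommutant N).toNonUnitalStarSubalgebra
      (starCommutant M).toNonUnitalStarSubalgebra =
      commonCenter M.toNonUnitalStarSubalgebra N.toNonUnitalStarSubalgebra := by
  rw [commonCenter, commonCenter, center_starCommutant, center_starCommutant, inf_comm]

/-! ### Consequences of finite scalar index. -/

section ScalarIndex

variable {M N : StarSubalgebra ℂ (H →L[ℂ] H)} (hNM : N ≤ M)

-- Finiteness of the index makes `h Q P` invertible in every nonzero block, and the products `Q P`
-- resolve the identity.
include hNM in
theorem rnDensity_injective
    {ε : CondExp M.toNonUnitalStarSubalgebra N.toNonUnitalStarSubalgebra} (hε : ε ∈ hatC M N)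
    (v : H) (hv : ε.rnDensity v = 0) : v = 0 := by
  classical
  have hNM' : N.toNonUnitalStarSubalgebra ≤ M.toNonUnitalStarSubalgebra := hNM
  have hN : (1 : H →L[ℂ] H) ∈ N.toNonUnitalStarSubalgebra := N.one_mem
  have hM := hNM' hN
  refine eq_zero_of_minProj_apply (isCommAlg_center M.toNonUnitalStarSubalgebra)
    (one_mem_center hM) fun P hP => ?_
  refine eq_zero_of_minProj_apply (isCommAlg_center N.toNonUnitalStarSubalgebra)
    (one_mem_center hN) fun Q hQ => ?_
  rw [← op_mul_apply]
  by_cases h0 : Q.1 * P.1 = 0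
  · rw [h0, zero_apply]
  obtain ⟨E, hE, hPE⟩ := exists_minProj_ge (isCommAlg_center M.toNonUnitalStarSubalgebra)
    inf_le_left (one_mem_commonCenter hNM' hN) hP
  have hs := hε E hE
  have hfin : indexAt (ε.part E hE.1) P ≠ ⊤ := by
    rw [hs.2 P ((mem_minProj_center_corner hE.1.1).2 ⟨hP, hPE⟩)]
    exact hs.1.ne
  rw [indexAt_eq_sum hNM' hN hE.1 hP hPE, ENNReal.sum_ne_top] at hfin
  obtain ⟨y, hy⟩ := ε.exists_inverse_of_blockTerm hNM' hN hE.1 (ε' := ε.part E hE.1)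
    (fun _ => rfl) hP hPE hQ h0 (hfin Q (by simp [hQ, h0]))
  rw [← hy, op_mul_apply, ← ε.rnDensity_blockUnit_comm hNM' hN hP hQ, op_mul_apply, hv, map_zero,
    map_zero]

include hNM in
/-- The value of the index of a summand, expressed by the inverse of the density. -/
theorem tr_inverse_density_eq
    {ε : CondExp M.toNonUnitalStarSubalgebra N.toNonUnitalStarSubalgebra} (hε : ε ∈ hatC M N)
    {g : H →L[ℂ] H} (hg : g * ε.rnDensity = 1) {E : Proj H}
    (hE : E ∈ minProj (commonCenter M.toNonUnitalStarSubalgebra N.toNonUnitalStarSubalgebra))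
    {P : Proj H} (hP : P ∈ minProj (center M.toNonUnitalStarSubalgebra)) (hPE : P.1 * E.1 = P.1) :
    0 < (index (ε.part E hE.1)).toReal ∧
    tr (traceDensity (commutant N.toNonUnitalStarSubalgebra) * (g * P.1)) =
      (index (ε.part E hE.1)).toReal * cdim (commutant M.toNonUnitalStarSubalgebra) P := by
  have hNM' : N.toNonUnitalStarSubalgebra ≤ M.toNonUnitalStarSubalgebra := hNM
  have hN : (1 : H →L[ℂ] H) ∈ N.toNonUnitalStarSubalgebra := N.one_mem
  have hM := hNM' hN
  have hg' := mul_eq_one_symm hg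
  have hgM := inverse_mem hM (ε.rnDensity_mem hNM' hN) hg hg'
  have hgn := nonneg_of_inverse (ε.rnDensity_nonneg hNM' hN) hg
  have hP' : P ∈ minProj (center (commutant M.toNonUnitalStarSubalgebra)) := by
    rwa [center_commutant hM]
  have hgP : 0 ≤ g * P.1 := by
    have h := conj_nonneg' (x := P.1) hgn
    rwa [P.star_eq, ← (mem_center.1 hP.1).2 _ hgM, mul_assoc, P.mul_self] at h
  have hgP0 : g * P.1 ≠ 0 := fun h => hP.2.1 (by
    calc P.1 = ε.rnDensity * (g * P.1) := by rw [← mul_assoc, hg', one_mul]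
      _ = 0 := by rw [h, mul_zero])
  have hnn := tr_mul_nonneg (traceDensity_nonneg (commutant N.toNonUnitalStarSubalgebra)) hgP
  have hne : tr (traceDensity (commutant N.toNonUnitalStarSubalgebra) * (g * P.1)) ≠ 0 := by
    intro h
    obtain ⟨r, hr, hrr⟩ := exists_sqrt hgP
    rw [← hrr] at h hgP0
    nth_rewrite 1 [← hr] at h
    rw [eq_zero_of_canTrace (one_mem_commutant _) h, mul_zero] at hgP0
    exact hgP0 rfl
  have hpos := Complex.pos_iff.1 (lt_of_le_of_ne hnn hne.symm)
  have hc := cdim_pos hP'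
  have hi := (hε E hE).2 P ((mem_minProj_center_corner hE.1.1).2 ⟨hP, hPE⟩)
  rw [← hi, ε.indexAt_part hNM' hN hE.1 hP hPE hg (fun _ => rfl),
    ENNReal.toReal_ofReal (div_nonneg hpos.1.le hc.le)]
  refine ⟨div_pos hpos.1 hc, ?_⟩
  rw [← Complex.ofReal_mul, div_mul_cancel₀ _ hc.ne']
  exact Complex.ext rfl (by simpa using hpos.2.symm)

end ScalarIndex

/-! ### The index of the dual conditional expectation. -/

section Main

variable {M N : StarSubalgebra ℂ (H →L[ℂ] H)} (hNM : N ≤ M)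

open Classical in
/-- The index of the summand of `ε` at a minimal projection of the common center. -/
def summandIndex (ε : CondExp M.toNonUnitalStarSubalgebra N.toNonUnitalStarSubalgebra)
    (E : Proj H) : ℝ :=
  if hE : E.1 ∈ commonCenter M.toNonUnitalStarSubalgebra N.toNonUnitalStarSubalgebra then
    (index (ε.part E hE)).toReal else 0

theorem summandIndex_eq (ε : CondExp M.toNonUnitalStarSubalgebra N.toNonUnitalStarSubalgebra)
    {E : Proj H}
    (hE : E.1 ∈ commonCenter M.toNonUnitalStarSubalgebra N.toNonUnitalStarSubalgebra) :
    summandIndex ε E = (index (ε.part E hE)).toReal := dif_pos hE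

include hNM in
theorem summandIndex_pos
    {ε : CondExp M.toNonUnitalStarSubalgebra N.toNonUnitalStarSubalgebra} (hε : ε ∈ hatC M N)
    {g : H →L[ℂ] H} (hg : g * ε.rnDensity = 1) (E : Proj H)
    (hE : E ∈ minProj (commonCenter M.toNonUnitalStarSubalgebra N.toNonUnitalStarSubalgebra)) :
    0 < summandIndex ε E := by
  obtain ⟨P, hP, hPE⟩ := exists_minProj_le (Z := center M.toNonUnitalStarSubalgebra) hE.1.1 hE.2.1
  rw [summandIndex_eq ε hE.1]
  exact (tr_inverse_density_eq hNM hε hg hE hP hPE).1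

include hNM in
/-- For a conditional expectation of the dual inclusion with the dual density, the summands have
the same scalar index. -/
theorem index_dual {ε : CondExp M.toNonUnitalStarSubalgebra N.toNonUnitalStarSubalgebra}
    (hε : ε ∈ hatC M N) {g : H →L[ℂ] H} (hg : g * ε.rnDensity = 1)
    {ε' : CondExp (starCommutant N).toNonUnitalStarSubalgebra
      (starCommutant M).toNonUnitalStarSubalgebra}
    (hε' : ε'.rnDensity = g *
      projSum (commonCenter M.toNonUnitalStarSubalgebra N.toNonUnitalStarSubalgebra)
        (fun E => ((summandIndex ε E)⁻¹ : ℝ))) {E : Proj H}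
    (hE : E ∈ minProj (commonCenter M.toNonUnitalStarSubalgebra N.toNonUnitalStarSubalgebra))
    (hE' : E.1 ∈ commonCenter (starCommutant N).toNonUnitalStarSubalgebra
      (starCommutant M).toNonUnitalStarSubalgebra) :
    HasScalarIndex (ε'.part E hE') ∧ index (ε'.part E hE') = index (ε.part E hE.1) := by
  have hNM' : N.toNonUnitalStarSubalgebra ≤ M.toNonUnitalStarSubalgebra := hNM
  have hN : (1 : H →L[ℂ] H) ∈ N.toNonUnitalStarSubalgebra := N.one_mem
  have hM := hNM' hN
  have hZ := isCommAlg_commonCenter M.toNonUnitalStarSubalgebra N.toNonUnitalStarSubalgebra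
  have hdual : (starCommutant M).toNonUnitalStarSubalgebra ≤
      (starCommutant N).toNonUnitalStarSubalgebra := starCommutant_anti hNM
  have hone : (1 : H →L[ℂ] H) ∈ (starCommutant M).toNonUnitalStarSubalgebra :=
    (starCommutant M).one_mem
  have eM : commutant (starCommutant M).toNonUnitalStarSubalgebra = M.toNonUnitalStarSubalgebra :=
    commutant_starCommutant
  have eN : commutant (starCommutant N).toNonUnitalStarSubalgebra = N.toNonUnitalStarSubalgebra :=
    commutant_starCommutant
  have cN : center (starCommutant N).toNonUnitalStarSubalgebra =
    center N.toNonUnitalStarSubalgebra := center_starCommutant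
  have hpos := summandIndex_pos hNM hε hg
  set D := projSum (commonCenter M.toNonUnitalStarSubalgebra N.toNonUnitalStarSubalgebra)
    (fun E => (((summandIndex ε E)⁻¹ : ℝ) : ℂ)) with hD
  set D' := projSum (commonCenter M.toNonUnitalStarSubalgebra N.toNonUnitalStarSubalgebra)
    (fun E => (summandIndex ε E : ℂ)) with hD'
  have hDD : D' * D = 1 := by
    have h := projSum_mul_inv hZ (one_mem_commonCenter hNM' hN)
      (f := fun E => (summandIndex ε E : ℂ)) fun E hE => Complex.ofReal_ne_zero.2 (hpos E hE).ne'
    simpa only [hD, hD', Complex.ofReal_inv] using h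
  have hDm : D ∈ commonCenter M.toNonUnitalStarSubalgebra N.toNonUnitalStarSubalgebra :=
    projSum_mem hZ _
  have hgM := inverse_mem hM (ε.rnDensity_mem hNM' hN) hg (mul_eq_one_symm hg)
  have hinv : ε.rnDensity * D' * ε'.rnDensity = 1 := by
    rw [hε', (mem_center.1 hDm.1).2 _ hgM, mul_assoc, ← mul_assoc D', hDD, one_mul,
      mul_eq_one_symm hg]
  -- The inverse of the dual density is `h D'`. The index formula for the dual inclusion thus gives
  -- `λ Tr_M(h Q) / n`, and `Tr_M(h Q) = Tr_N(ε(Q)) = Tr_N(Q) = n`.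
  have key : ∀ Q ∈ minProj (center N.toNonUnitalStarSubalgebra), Q.1 * E.1 = Q.1 →
      indexAt (ε'.part E hE') Q = ENNReal.ofReal (summandIndex ε E) := by
    intro Q hQ hQE
    have hQ' : Q ∈ minProj (center (starCommutant N).toNonUnitalStarSubalgebra) := by rwa [cN]
    rw [ε'.indexAt_part hdual hone hE' hQ' hQE hinv (fun _ => rfl), eM, eN]
    have e1 : ε.rnDensity * D' * Q.1 = (summandIndex ε E : ℂ) • (ε.rnDensity * Q.1) := by
      rw [mul_assoc]
      nth_rewrite 1 [← Proj.mul_comm_of_mul_eq hQE]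
      rw [← mul_assoc D', hD', projSum_mul hZ _ hE, smul_mul_assoc, mul_smul_comm,
        Proj.mul_comm_of_mul_eq hQE]
    have e2 : (ε.toLin ⟨Q.1, hNM' hQ.1.1⟩).1 = Q.1 := by
      have h1 := ε.unital ⟨1, hM⟩ fun a => ⟨Subtype.ext (one_mul _), Subtype.ext (mul_one _)⟩
      have h := ε.map_mul_left hN hQ.1.1 hM (by rw [mul_one]; exact hNM' hQ.1.1)
      exact (congrArg (fun z => (ε.toLin z).1) (Subtype.ext (mul_one _).symm)).trans
        (h.trans ((congrArg (Q.1 * ·) h1).trans (mul_one _)))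
    have q0 := (tr_proj_re_pos hQ.2.1).ne'
    have c0 := (cdim_pos hQ).ne'
    rw [e1, mul_smul_comm, tr_smul, ε.rnDensity_spec hNM' hN (hNM' hQ.1.1), e2, traceDensity_mul hQ,
      tr_smul, Complex.re_ofReal_mul, Complex.re_ofReal_mul, div_mul_cancel₀ _ q0,
      mul_div_cancel_right₀ _ c0]
  have hmem : ∀ Q : Proj H, Q ∈ minProj (center (corner (starCommutant N).toNonUnitalStarSubalgebra E)) ↔
      Q ∈ minProj (center N.toNonUnitalStarSubalgebra) ∧ Q.1 * E.1 = Q.1 := fun Q => by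
    rw [mem_minProj_center_corner hE'.1, cN]
  have hindex : index (ε'.part E hE') = ENNReal.ofReal (summandIndex ε E) := by
    refine le_antisymm (iSup₂_le fun Q hQ => ?_) ?_
    · rw [key Q ((hmem Q).1 hQ).1 ((hmem Q).1 hQ).2]
    · obtain ⟨Q, hQ, hQE⟩ := exists_minProj_le (Z := center N.toNonUnitalStarSubalgebra)
        hE.1.2 hE.2.1
      rw [← key Q hQ hQE]
      exact le_iSup₂ (f := fun Q _ => indexAt (ε'.part E hE') Q) Q ((hmem Q).2 ⟨hQ, hQE⟩)
  refine ⟨⟨?_, fun Q hQ => ?_⟩, ?_⟩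
  · rw [hindex]
    exact ENNReal.ofReal_lt_top
  · rw [hindex, key Q ((hmem Q).1 hQ).1 ((hmem Q).1 hQ).2]
  · rw [hindex, summandIndex_eq ε hE.1, ENNReal.ofReal_toReal (hε E hE).1.ne]

theorem inner_projSum_re {Z : OpAlg H} (hZ : IsCommAlg Z) {ω : (H →L[ℂ] H) →ₗ[ℂ] ℂ} {ψ : H}
    (hω : ∀ x, ω x = inner ℂ ψ (x ψ)) (f : Proj H → ℝ) :
    (inner ℂ ψ (projSum Z (fun E => (f E : ℂ)) ψ) : ℂ).re =
      ∑ᶠ E : minProj Z, (ω E.1.1).re * f E.1 := by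
  rw [finsum_set_coe_eq_finsum_mem (f := fun E : Proj H => (ω E.1).re * f E),
    finsum_mem_eq_finite_toFinset_sum _ (minProj_finite hZ), ← hω, projSum_eq hZ, map_sum,
    Complex.re_sum]
  refine Finset.sum_congr rfl fun E _ => ?_
  rw [map_smul, smul_eq_mul, Complex.re_ofReal_mul, mul_comm]

end Main

end EntropicCertainty

end

/-! ### Existence and uniqueness of the dual conditional expectation. -/

open EntropicCertainty in
theorem mainTheorem3 {H : Type*} [NormedAddCommGroup H] [InnerProductSpace ℂ H]
    [CompleteSpace H] [FiniteDimensional ℂ H]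
    (M N : StarSubalgebra ℂ (H →L[ℂ] H)) (hNM : N ≤ M)
    (ε : EntropicCertainty.CondExp M.toNonUnitalStarSubalgebra N.toNonUnitalStarSubalgebra)
    (hε : ε ∈ EntropicCertainty.hatC M N) :
    ∃ ε' : EntropicCertainty.CondExp
        (EntropicCertainty.starCommutant N).toNonUnitalStarSubalgebra
        (EntropicCertainty.starCommutant M).toNonUnitalStarSubalgebra,
      ε' ∈ EntropicCertainty.hatC (EntropicCertainty.starCommutant N) (EntropicCertainty.starCommutant M) ∧
      EntropicCertainty.CertaintyRelation ε ε' ∧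
      (∀ ε'' ∈ EntropicCertainty.hatC (EntropicCertainty.starCommutant N) (EntropicCertainty.starCommutant M),
        EntropicCertainty.CertaintyRelation ε ε'' → ε'' = ε') ∧
      ∀ (E : EntropicCertainty.Proj H)
        (hE : E ∈ EntropicCertainty.minProj (EntropicCertainty.commonCenter
          M.toNonUnitalStarSubalgebra N.toNonUnitalStarSubalgebra)),
        EntropicCertainty.index (ε'.part E (EntropicCertainty.commonCenter_dual hE.1)) =
          EntropicCertainty.index (ε.part E hE.1) := by
  have hNM' : N.toNonUnitalStarSubalgebra ≤ M.toNonUnitalStarSubalgebra := hNM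
  have hN : (1 : H →L[ℂ] H) ∈ N.toNonUnitalStarSubalgebra := N.one_mem
  have hM := hNM' hN
  have hZ := isCommAlg_commonCenter M.toNonUnitalStarSubalgebra N.toNonUnitalStarSubalgebra
  have hdual' : starCommutant M ≤ starCommutant N :=
    starCommutant_anti hNM
  have hdual : (starCommutant M).toNonUnitalStarSubalgebra ≤
      (starCommutant N).toNonUnitalStarSubalgebra := hdual'
  have hone : (1 : H →L[ℂ] H) ∈ (starCommutant M).toNonUnitalStarSubalgebra :=
    (starCommutant M).one_mem
  have hinj := rnDensity_injective hNM hε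
  have hhn := ε.rnDensity_nonneg hNM' hN
  obtain ⟨g, hg⟩ := exists_inverse_of_injective hhn.isSelfAdjoint hinj
  have hg' := mul_eq_one_symm hg
  have hgM := inverse_mem hM (ε.rnDensity_mem hNM' hN) hg hg'
  have hgN := inverse_mem_commutant (ε.rnDensity_mem_commutant hNM' hN) hg hg'
  have hpos := summandIndex_pos hNM hε hg
  have hnn : ∀ E ∈ minProj (commonCenter M.toNonUnitalStarSubalgebra N.toNonUnitalStarSubalgebra),
      0 ≤ (summandIndex ε E)⁻¹ := fun E hE => (inv_pos.2 (hpos E hE)).le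
  -- `g D = h⁻¹ ∑ λ_i⁻¹ E_i` is the only candidate for the dual density, forced by the logarithmic
  -- form of the relation.
  set D := projSum (commonCenter M.toNonUnitalStarSubalgebra N.toNonUnitalStarSubalgebra)
    (fun E => (((summandIndex ε E)⁻¹ : ℝ) : ℂ)) with hD
  have hDm : D ∈ commonCenter M.toNonUnitalStarSubalgebra N.toNonUnitalStarSubalgebra :=
    projSum_mem hZ _
  have hmem1 : g * D ∈ (starCommutant N).toNonUnitalStarSubalgebra := mul_mem hgN hDm.2.2
  have hmem2 : g * D ∈ commutant (starCommutant M).toNonUnitalStarSubalgebra :=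
    commutant_starCommutant.ge (mul_mem hgM hDm.1.1)
  have hnonneg : 0 ≤ g * D := Commute.mul_nonneg (nonneg_of_inverse hhn hg)
    (projSum_nonneg hZ hnn) ((mem_center.1 hDm.1).2 _ hgM)
  set ε' := CondExp.ofDensity hdual hone hmem1 hmem2 hnonneg fun b hb =>
    tr_dual_density hNM' hN hgM (lam := summandIndex ε) (fun E hE P hP hPE => by
      rw [(tr_inverse_density_eq hNM hε hg hE hP hPE).2, summandIndex_eq ε hE.1]) hpos hb with hε'def
  have hε' : ε'.rnDensity = g * D := CondExp.rnDensity_ofDensity hdual hone hmem1 hmem2 hnonneg _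
  have hidx := fun {E : Proj H} hE hE' => index_dual hNM hε hg hε' (E := E) hE hE'
  have hcc : commonCenter (starCommutant N).toNonUnitalStarSubalgebra
      (starCommutant M).toNonUnitalStarSubalgebra =
      commonCenter M.toNonUnitalStarSubalgebra N.toNonUnitalStarSubalgebra :=
    commonCenter_starCommutant
  have hhat : ε' ∈ hatC (starCommutant N) (starCommutant M) := fun E hE =>
    (hidx (hcc ▸ hE) hE.1).1
  have hlog := log_dual_density hNM' hN hpos hhn hg hgM
  have hcert : CertaintyRelation ε ε' := by
    rintro ω ⟨ψ, -, hω⟩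
    rw [relEntropy_add_relEntropy hNM' hN ε (starCommutant_toNonUnitalStarSubalgebra N)
      (starCommutant_toNonUnitalStarSubalgebra M) ε' hinj (rnDensity_injective hdual' hhat) hω,
      hε', hlog, sub_apply, neg_apply, inner_sub_right, inner_neg_right]
    congr 1
    refine Eq.trans ?_ ((inner_projSum_re hZ hω fun E => Real.log (summandIndex ε E)).trans
      (finsum_congr fun E => by rw [summandIndex_eq ε E.2.1]))
    congr 1
    ring
  refine ⟨ε', hhat, hcert, fun ε'' h1 h2 => ?_, fun E hE => (hidx hE _).2⟩
  refine CondExp.eq_of_rnDensity_eq hdual hone ?_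
  have hi' := rnDensity_injective hdual' hhat
  have hi'' := rnDensity_injective hdual' h1
  -- Both relations have the same right-hand side and the same contribution of `ε`. The logarithms
  -- of the two dual densities therefore have equal expectations in all unit vectors.
  refine eq_of_log_eq (ε''.rnDensity_nonneg hdual hone) (ε'.rnDensity_nonneg hdual hone) hi'' hi' ?_
  refine eq_of_inner_re_eq IsSelfAdjoint.log IsSelfAdjoint.log fun ψ hψ => ?_
  let ω : (H →L[ℂ] H) →ₗ[ℂ] ℂ :=
    (innerSL ℂ ψ).toLinearMap ∘ₗ (ContinuousLinearMap.apply ℂ H ψ).toLinearMap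
  have hω : ∀ x : H →L[ℂ] H, ω x = inner ℂ ψ (x ψ) := fun _ => rfl
  have h3 := (h2 ω ⟨ψ, hψ, hω⟩).trans (hcert ω ⟨ψ, hψ, hω⟩).symm
  rw [relEntropy_add_relEntropy hNM' hN ε (starCommutant_toNonUnitalStarSubalgebra N)
      (starCommutant_toNonUnitalStarSubalgebra M) ε' hinj hi' hω,
    relEntropy_add_relEntropy hNM' hN ε (starCommutant_toNonUnitalStarSubalgebra N)
      (starCommutant_toNonUnitalStarSubalgebra M) ε'' hinj hi'' hω, EReal.coe_eq_coe_iff,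
    Complex.neg_re, Complex.neg_re, Complex.add_re, Complex.add_re] at h3
  linarith
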